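/- **Setting.** Pauli operators are taken up to phase. A stabilizer code on $n$ qubits is given by pairwise commuting Pauli checks $s_1,\dots,s_m$; it is $(w,\Delta)$-LDPC if every check acts on at most $w$ qubits and every qubit is acted on by at most $\Delta$ checks. A logical operator is a Pauli operator that commutes with all checks and is not a product of checks; the distance $d$ is the minimal weight of a logical operator. Let $L$ be a logical operator of weight $W$, with support $V_0$, $|V_0|=W$; choose local bases such that $L=\prod_{v\in V_0}X_v$. The $Z$-type support of a check is the set of those $v\in V_0$ on which it acts as $Y$ or $Z$. For a graph $G_0$ on $V_0$, cycles $c_1,\dots,c_r$ of $G_0$ and a map $\ell:\{1,\dots,r\}\to\{1,\dots,R\}$, the *layered graph* $G$ has vertex set $\{0,\dots,R\}\times V_0$; each layer is a copy of $G_0$, each vertex is joined to its copy in the next layer, and for each $j$ the copy of $c_j=(u_1,\dots,u_N)$ in layer $\ell(j)$ is cellulated into triangles by the additional edges $u_1u_{N-1},\,u_{N-1}u_2,\,u_2u_{N-2},\dots$ (an edge already present is not repeated). The vertices in layers $1,\dots,R$ are dummy vertices. The *faces* of $G$ are the squares formed by an edge of $G_0$ in two consecutive layers, and the triangles of the cellulations.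 Given, for every check $s_j$, a perfect matching $M_j$ of its $Z$-type support by edges of $G_0$, the *deformed code* has as qubits the original qubits and one qubit for each edge of $G$, and as checks $A_v=X_v\prod_{e\ni v}X_e$ for all vertices $v$ of $G$ (with $X_v$ omitted if $v$ is a dummy vertex), $B_p=\prod_{e\in p}Z_e$ for all faces $p$, and $\tilde s_j=s_j\prod_{e\in M_j}Z_e$ with $M_j$ placed in layer $0$. The *fault-tolerant gauging measurement* with parameters $(a,T,b)$ consists of $a$ rounds of measurements of the checks $s_j$, with preparation of the edge qubits in $|0\rangle$ in the last of them; $T$ rounds of measurements of the checks of the deformed code; and $b$ rounds of measurements of the checks $s_j$, with a measurement of $Z_e$ on every edge qubit in the first of them. The measurements of the $s_j$ in the very first and very last round are perfect. A fault is a collection of single-qubit Pauli errors between rounds and of measurement (and preparation) errors, and its weight is their number. A detector is a collection of measurements and preparations the product of whose results is deterministic, in the absence of faults, for all initial states in the code space. A fault is a *spacetime logical fault* if it violates no detector, and a *spacetime stabilizer* if moreover it does not affect the result of the procedure, that is, all deterministic relations between the initial state, the measurement results and the final state are unchanged. The *spacetime fault distance* is the minimal weight of a spacetime logical fault that is not a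 spacetime stabilizer. **Statement.** For all $w,\Delta$ there is a constant $K=K(w,\Delta)$ such that for every $(w,\Delta)$-LDPC stabilizer code of distance $d$ and every logical operator $L$ of weight $W$ there are a graph $G_0$ on $V_0$, a layered graph $G$ over $G_0$ and matchings $M_j$ as above with the following properties. 1. (Construction.) Each $M_j$ is a perfect matching, by edges of $G_0$, of the $Z$-type support of $s_j$; $G_0$ has maximal degree at most $K$ and Cheeger constant $h(G_0)=\min_{0<|S|\le W/2}|\partial S|/|S|\ge 1$; the number of additional layers satisfies $R\le K\log^2W$; and the cellulated cycles $c_1,\dots,c_r$ generate the cycle space of $G_0$ over $\mathbb Z_2$. 2. (Desiderata.) $G$ is connected with maximal degree at most $K$; any two vertices in the $Z$-type support of a check are joined by a path in $G$ of length at most $K$; each single layer $G_0$ of $G$ has $h(G_0)\ge1$; and the faces have at most $4$ edges and generate the cycle space of $G$ over $\mathbb Z_2$, each edge of $G$ lying in at most $K$ faces. 3. (LDPC.) The checks of the deformed code commute, each acts on at most $K$ qubits, and each qubit is acted on by at most $K$ of them. 4. (Overhead.) The number of edges of $G$ plus the number of dummy vertices is at most $K\,W\log^2W$. 5. (Fault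 distance.) The spacetime fault distance of the gauging measurement with parameters $(a,d,b)$ is exactly $d$ for all $a,b\ge d$, and with parameters $(a,T,b)$ it is at least $d$ for all $a,T,b\ge d$. -/

import Mathlib

open scoped Classical ENNReal

noncomputable section

namespace Gauging

/-! ### Pauli operators and stabilizer codes

A Pauli operator on the qubits `Q`, up to phase: qubit `q` carries `X ^ x Z ^ z` where `P q = (x, z)`.
Multiplication up to phase is addition. Pairwise commuting Paulis up to phase are exactly the checks
of a stabilizer code up to the choice of eigenvalues, on which no notion below depends. -/
abbrev Pauli (Q : Type*) : Type _ := Q → ZMod 2 × ZMod 2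

/-- `0` if the single-qubit Paulis `a`, `b` commute and `1` if they anticommute. -/
def siteComm (a b : ZMod 2 × ZMod 2) : ZMod 2 := a.1 * b.2 + a.2 * b.1

/-- `0` if `P`, `P'` commute and `1` if they anticommute. -/
def Pauli.comm {Q : Type*} [Fintype Q] (P P' : Pauli Q) : ZMod 2 := ∑ q, siteComm (P q) (P' q)

/-- The qubits on which `P` acts nontrivially. -/
def Pauli.support {Q : Type*} [Fintype Q] (P : Pauli Q) : Finset Q :=
  Finset.univ.filter fun q => P q ≠ 0

def Pauli.weight {Q : Type*} [Fintype Q] (P : Pauli Q) : ℕ := P.support.card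

/-- The family `s` consists of the checks of a stabilizer code. -/
def IsStabilizerCode {Q ι : Type*} [Fintype Q] (s : ι → Pauli Q) : Prop :=
  ∀ i j, (s i).comm (s j) = 0

/-- The stabilizer group (up to phase). -/
def stabilizer {Q ι : Type*} (s : ι → Pauli Q) : Submodule (ZMod 2) (Pauli Q) :=
  Submodule.span (ZMod 2) (Set.range s)

/-- `P` represents a (nontrivial) logical operator: it commutes with all checks and is not itself in
the stabilizer group. -/
def IsLogical {Q ι : Type*} [Fintype Q] (s : ι → Pauli Q) (P : Pauli Q) : Prop :=
  (∀ j, P.comm (s j) = 0) ∧ P ∉ stabilizer s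

/-- The code has distance `d`. -/
def HasDistance {Q ι : Type*} [Fintype Q] (s : ι → Pauli Q) (d : ℕ) : Prop :=
  IsLeast {k | ∃ P : Pauli Q, IsLogical s P ∧ P.weight = k} d

/-- Every check acts on at most `w` qubits and every qubit is acted on by at most `Δ` checks. -/
def IsLDPC {Q ι : Type*} [Fintype Q] [Fintype ι] (s : ι → Pauli Q) (w Δ : ℕ) : Prop :=
  (∀ j, (s j).weight ≤ w) ∧ ∀ q, (Finset.univ.filter fun j => s j q ≠ 0).card ≤ Δ

/-- The `Z`-type support of `P` on the support of `L`, where on every qubit of the support of `L` the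
basis is such that `L` acts as `X` there. Without reference to a basis: the qubits at which `P`
anticommutes with the local factor of `L`. -/
def zSupport {Q : Type*} [Fintype Q] (L P : Pauli Q) : Finset L.support :=
  Finset.univ.filter fun v => siteComm (L v) (P v) ≠ 0

/-- If `L` is a product of `X` operators, then `zSupport L P` consists of the qubits in the support
of `L` on which `P` acts as `Y` or `Z`. -/
theorem mem_zSupport_of_isX {Q : Type*} [Fintype Q] (L P : Pauli Q)
    (hL : ∀ q ∈ L.support, L q = (1, 0)) (v : L.support) :
    v ∈ zSupport L P ↔ (P v).2 ≠ 0 := by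
  have h : L v = (1, 0) := hL v v.2
  unfold zSupport
  rw [Finset.mem_filter]
  simp [siteComm, h]

/-! ### Graphs -/

/-- The Cheeger constant `min |∂S| / |S|` over vertex sets with `0 < |S| ≤ |V| / 2`
(it is `∞` for a graph with a single vertex). -/
def cheeger {V : Type*} [Fintype V] (G : SimpleGraph V) : ℝ≥0∞ :=
  ⨅ (S : Finset V) (_ : S.Nonempty ∧ 2 * S.card ≤ Fintype.card V),
    ((G.interedges S Sᶜ).card : ℝ≥0∞) / (S.card : ℝ≥0∞)

/-- The `ℤ/2` boundary map on sets of edges. -/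
def boundary {V : Type*} [Fintype V] (G : SimpleGraph V) :
    (G.edgeSet → ZMod 2) →ₗ[ZMod 2] (V → ZMod 2) where
  toFun f v := ∑ e : G.edgeSet, if v ∈ (e : Sym2 V) then f e else 0
  map_add' f g := by
    funext v
    simp only [Pi.add_apply, ← Finset.sum_add_distrib]
    exact Finset.sum_congr rfl fun e _ => by split_ifs <;> simp
  map_smul' c f := by
    funext v
    simp only [Pi.smul_apply, smul_eq_mul, RingHom.id_apply, Finset.mul_sum]
    exact Finset.sum_congr rfl fun e _ => by split_ifs <;> simp

/-- The edge sets `c p` generate the cycle space `ker ∂` of `G` over `ℤ/2`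
(in particular each of them is a cycle, that is, has zero boundary). -/
def GeneratesCycles {V κ : Type*} [Fintype V] (G : SimpleGraph V) (c : κ → Set (Sym2 V)) : Prop :=
  (∀ p, c p ⊆ G.edgeSet) ∧
  Submodule.span (ZMod 2) (Set.range fun p => fun e : G.edgeSet => if (e : Sym2 V) ∈ c p then 1 else 0) =
    LinearMap.ker (boundary G)

/-- `M` is a set of edges of `G` that matches the vertices of `S` perfectly. -/
def IsPerfectMatchingOf {V : Type*} (G : SimpleGraph V) (S : Finset V) (M : Finset (Sym2 V)) : Prop :=
  (∀ e ∈ M, e ∈ G.edgeSet ∧ ∀ v ∈ e, v ∈ S) ∧ ∀ v ∈ S, ∃! e, e ∈ M ∧ v ∈ e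

/-! ### Layered graphs with cellulated cycles -/

/-- The data of a layered graph: a base graph, the number `R` of additional layers (layer `0` is the
base graph itself), a list of cycles of the base graph, and for every cycle `j` the layer
`layer j + 1 ∈ {1, …, R}` in which the copy of that cycle is cellulated. -/
structure LayeredGraph (V : Type*) where
  base : SimpleGraph V
  R : ℕ
  numCycles : ℕ
  root : Fin numCycles → V
  cycle : ∀ j, base.Walk (root j) (root j)
  isCycle : ∀ j, (cycle j).IsCycle
  layer : Fin numCycles → Fin R

namespace LayeredGraph

variable {V : Type*} (G : LayeredGraph V)

/-- Vertices are pairs (layer, vertex of the base graph). -/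
abbrev Vert : Type _ := Fin (G.R + 1) × V

/-- The zigzag enumeration `u (N - 1), u 0, u (N - 2), u 1, …` of the vertices `u 0, …, u (N - 1)` of
the `j`-th cycle, in the order in which the cycle visits them. -/
def zigzag (j : Fin G.numCycles) (k : ℕ) : V :=
  (G.cycle j).getVert (if Even k then (G.cycle j).length - 1 - k / 2 else k / 2)

/-- The layered graph: every layer is a copy of the base graph, every vertex is joined to its copy in
the next layer, and every cycle is cellulated into triangles in its layer, by joining consecutive
vertices of its zigzag enumeration (the first and the last of these edges lie on the cycle). -/
def graph : SimpleGraph G.Vert :=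
  SimpleGraph.fromRel fun a b =>
    (a.1 = b.1 ∧ G.base.Adj a.2 b.2) ∨
    (a.2 = b.2 ∧ (a.1 : ℕ) + 1 = (b.1 : ℕ)) ∨
    (a.1 = b.1 ∧ ∃ (j : Fin G.numCycles) (k : ℕ), a.1 = (G.layer j).succ ∧
      k + 1 < (G.cycle j).length ∧ a.2 = G.zigzag j k ∧ b.2 = G.zigzag j (k + 1))

/-- Edges of the layered graph; these carry the auxiliary qubits. -/
abbrev Edge : Type _ := G.graph.edgeSet

/-- Labels of the chosen cycles of the layered graph: a square for each pair of adjacent layers and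
each edge of the base graph, and the triangles of the cellulation of every cycle. -/
abbrev Face : Type _ :=
  (Fin G.R × G.base.edgeSet) ⊕ (Σ j : Fin G.numCycles, Fin ((G.cycle j).length - 2))

/-- The edges of a face. -/
def faceEdges : G.Face → Set (Sym2 G.Vert)
  | .inl (i, e) =>
      {Sym2.map (fun v => (i.castSucc, v)) (e : Sym2 V), Sym2.map (fun v => (i.succ, v)) (e : Sym2 V)} ∪
        {x | ∃ v ∈ (e : Sym2 V), x = s((i.castSucc, v), (i.succ, v))}
  | .inr ⟨j, k⟩ =>
      let i := (G.layer j).succ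
      {s((i, G.zigzag j k), (i, G.zigzag j (k + 1))),
        s((i, G.zigzag j (k + 1)), (i, G.zigzag j (k + 2))),
        s((i, G.zigzag j k), (i, G.zigzag j (k + 2)))}

end LayeredGraph

/-! ### The deformed code -/

section Deformed

variable {Q ι : Type*} [Fintype Q] {L : Pauli Q} (G : LayeredGraph L.support)

/-- The qubits of the deformed code: those of the original code and one for every edge of the graph.
The dummy vertices, in layers `1, …, R`, carry no qubit. -/
abbrev DefQubit : Type _ := Q ⊕ G.Edge

/-- The Gauss law operator `A_v`: `X` on every edge at `v`, times, if `v` is a vertex of layer `0`,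
the factor of `L` at the qubit `v` (this factor is `X_v` in the basis in which `L` is of type `X`). -/
def gaussOp (v : G.Vert) : Pauli (DefQubit G)
  | .inl q => if v.1 = 0 ∧ (v.2 : Q) = q then L q else 0
  | .inr e => if v ∈ (e : Sym2 G.Vert) then (1, 0) else 0

/-- The flux operator `B_p`: `Z` on every edge of the face `p`. -/
def fluxOp (p : G.Face) : Pauli (DefQubit G)
  | .inl _ => 0
  | .inr e => if (e : Sym2 G.Vert) ∈ G.faceEdges p then (0, 1) else 0

/-- The deformation of `P` along a set `γ` of edges of the base graph: `P` times `Z` on the copies in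
layer `0` of the edges in `γ`. -/
def deform (P : Pauli Q) (γ : Finset (Sym2 L.support)) : Pauli (DefQubit G)
  | .inl q => P q
  | .inr e => if ∃ x ∈ γ, (e : Sym2 G.Vert) = Sym2.map (fun v => (0, v)) x then (0, 1) else 0

/-- The checks of the deformed code: `A_v`, `B_p`, and the deformed original checks. -/
def deformedChecks (s : ι → Pauli Q) (M : ι → Finset (Sym2 L.support)) :
    G.Vert ⊕ G.Face ⊕ ι → Pauli (DefQubit G)
  | .inl v => gaussOp G v
  | .inr (.inl p) => fluxOp G p
  | .inr (.inr j) => deform G (s j) (M j)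

/-- The operator `P` of the original code, regarded as an operator on all qubits. -/
def extendOp (P : Pauli Q) : Pauli (DefQubit G)
  | .inl q => P q
  | .inr _ => 0

/-- The operator `Z_e`. -/
def edgeZ (e : G.Edge) : Pauli (DefQubit G)
  | .inl _ => 0
  | .inr e' => if e' = e then (0, 1) else 0

end Deformed

/-! ### Measurement procedures and their fault distance -/

/-- A procedure that consists of `rounds` successive rounds of Pauli measurements, with labels in `Λ`.
The preparation of a qubit in `|0⟩` counts as a measurement of `Z` whose result is known to be `+1`.
A Pauli error at time `r` happens immediately before round `r`. -/
structure Procedure (Q Λ : Type*) where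
  rounds : ℕ
  /-- The operator measured under a label. -/
  op : Λ → Pauli Q
  /-- The measurements that are made in a given round. -/
  measured : Fin rounds → Λ → Prop
  /-- The measurements (or preparations) that may be faulty. -/
  noisyMeas : Fin rounds → Λ → Prop
  /-- The qubits that are subject to Pauli errors at a given time. -/
  noisyQubit : Fin rounds → Q → Prop
  /-- The auxiliary qubits: they are prepared during the procedure and discarded again. -/
  auxiliary : Q → Prop
  /-- The checks of the code in which the procedure starts. -/
  inputChecks : Set (Pauli Q)

namespace Procedure

variable {Q Λ : Type*} [Fintype Q] [Fintype Λ] (Pr : Procedure Q Λ)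

/-- A collection of measurements `D`, with an operator `input` on the initial state and an operator
`output` on the final state, propagated backwards in time (Heisenberg picture): the operator whose
value, just before round `t`, is the value of `output` at the end times the results of the
measurements in `D` from round `t` on. -/
def backward (D : Fin Pr.rounds → Λ → ZMod 2) (output : Pauli Q) (t : ℕ) : Pauli Q :=
  output + ∑ r : Fin Pr.rounds, if t ≤ (r : ℕ) then ∑ l, D r l • Pr.op l else 0

/-- A deterministic relation: in the absence of faults, the product of the results of the measurements
in `D` and of the value of `output` on the final state equals, up to a fixed sign, the value of
`input` on the initial state. By the Heisenberg picture this holds precisely if no measurement that is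
made randomizes the operator that is propagated backwards from `output` to `input`. -/
structure IsRelation (D : Fin Pr.rounds → Λ → ZMod 2) (input output : Pauli Q) : Prop where
  measured : ∀ r l, D r l ≠ 0 → Pr.measured r l
  input_aux : ∀ q, Pr.auxiliary q → input q = 0
  output_aux : ∀ q, Pr.auxiliary q → output q = 0
  commutes : ∀ r l, Pr.measured r l → (Pr.op l).comm (Pr.backward D output (r + 1)) = 0
  backward_zero : Pr.backward D output 0 = input

/-- A detector: a collection of measurements and preparations the product of whose results is
deterministic for every initial state in the code space. -/
def IsDetector (D : Fin Pr.rounds → Λ → ZMod 2) : Prop :=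
  ∃ input ∈ Submodule.span (ZMod 2) Pr.inputChecks, Pr.IsRelation D input 0

/-- A spacetime fault: `meas r l = 1` if measurement `l` of round `r` is reported incorrectly, and
`err r` is the Pauli error at time `r`. -/
structure Fault where
  meas : Fin Pr.rounds → Λ → ZMod 2
  err : Fin Pr.rounds → Pauli Q
  meas_noisy : ∀ r l, meas r l ≠ 0 → Pr.noisyMeas r l
  err_noisy : ∀ r q, err r q ≠ 0 → Pr.noisyQubit r q

variable {Pr}

/-- The number of single-qubit Pauli errors plus the number of single measurement errors. -/
def Fault.weight (F : Pr.Fault) : ℕ :=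
  ∑ r, (F.err r).weight + ∑ r, (Finset.univ.filter fun l => F.meas r l ≠ 0).card

/-- `1` if the fault `F` inverts the relation given by `D` and `output`, and `0` otherwise. -/
def Fault.flips (F : Pr.Fault) (D : Fin Pr.rounds → Λ → ZMod 2) (output : Pauli Q) : ZMod 2 :=
  ∑ r, ∑ l, D r l * F.meas r l + ∑ r : Fin Pr.rounds, (F.err r).comm (Pr.backward D output r)

/-- A spacetime logical fault: no detector is violated. -/
def Fault.IsLogicalFault (F : Pr.Fault) : Prop :=
  ∀ D, Pr.IsDetector D → F.flips D 0 = 0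

/-- A spacetime stabilizer: no detector is violated, and the result of the procedure is not affected:
all the relations between the initial state, the measurement results (in particular the inferred value
of the measured logical operator) and the final state are those of the procedure without faults. -/
def Fault.IsStabilizer (F : Pr.Fault) : Prop :=
  F.IsLogicalFault ∧ ∀ D input output, Pr.IsRelation D input output → F.flips D output = 0

variable (Pr)

/-- The weights of the spacetime logical faults that are not spacetime stabilizers. -/
def logicalFaultWeights : Set ℕ :=
  {k | ∃ F : Pr.Fault, F.IsLogicalFault ∧ ¬ F.IsStabilizer ∧ F.weight = k}

/-- The spacetime fault distance is `d`. -/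
def HasFaultDistance (d : ℕ) : Prop := IsLeast Pr.logicalFaultWeights d

end Procedure

/-- The fault-tolerant gauging measurement of `L`: `a` rounds of measurements of the original checks,
with the preparation of the edge qubits in `|0⟩` in the last one of these rounds; `T` rounds of
measurements of the checks of the deformed code; `b` rounds of measurements of the original checks, with
the measurement of `Z_e` on all edge qubits in the first one of these rounds. The measurements of the
original checks in the very first and in the very last round are perfect. Edge qubits exist, and
suffer errors, only between preparation and final measurement. Labels: original checks, edges
(for preparation and readout), deformed checks. -/
def gaugingProcedure {Q ι : Type*} [Fintype Q] {L : Pauli Q} (G : LayeredGraph L.support)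
    (s : ι → Pauli Q) (M : ι → Finset (Sym2 L.support)) (a T b : ℕ) :
    Procedure (DefQubit G) (ι ⊕ G.Edge ⊕ (G.Vert ⊕ G.Face ⊕ ι)) where
  rounds := a + T + b
  op
    | .inl j => extendOp G (s j)
    | .inr (.inl e) => edgeZ G e
    | .inr (.inr k) => deformedChecks G s M k
  measured r
    | .inl _ => (r : ℕ) < a ∨ a + T ≤ (r : ℕ)
    | .inr (.inl _) => (r : ℕ) + 1 = a ∨ (r : ℕ) = a + T
    | .inr (.inr _) => a ≤ (r : ℕ) ∧ (r : ℕ) < a + T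
  noisyMeas r
    | .inl _ => ((r : ℕ) < a ∨ a + T ≤ (r : ℕ)) ∧ (r : ℕ) ≠ 0 ∧ (r : ℕ) + 1 ≠ a + T + b
    | .inr (.inl _) => (r : ℕ) + 1 = a ∨ (r : ℕ) = a + T
    | .inr (.inr _) => a ≤ (r : ℕ) ∧ (r : ℕ) < a + T
  noisyQubit r
    | .inl _ => (r : ℕ) ≠ 0
    | .inr _ => a ≤ (r : ℕ) ∧ (r : ℕ) ≤ a + T
  auxiliary
    | .inl _ => False
    | .inr _ => True
  inputChecks := Set.range fun j => extendOp G (s j)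

end Gauging

end

/-!
Fix the base graph `G₀`, the layered graph `G` over it, and think of a cochain, that is, of a
`ℤ/2`-valued function on the edges, as a gauge field. The one property of `G` on which everything
depends is `IsFluxExact`: a cochain without flux through the faces is the coboundary of a potential on
the vertices. By duality it also says that the faces generate the cycle space
(`generatesCycles_of_isFluxExact`).

*Fault distance.* A fault of weight less than `d` leaves one of the `T ≥ d` rounds of the deformed phase
without measurement faults. Accumulate the errors before that round, and those after it, into one Pauli
operator each, where faulty preparations and readouts of edge qubits count as `X` errors. Comparing that
round with the preparation, or with the readout and the perfect last round, yields detectors that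
show that both operators commute with all flux operators and all deformed checks. The `X` part of such
an operator on the edges has no flux, so it is a coboundary, and multiplication by Gauss law operators
removes it. This puts part of `L` on the original qubits, but since `G₀` has Cheeger constant at least
one, no more than the number of edge qubits that were cleaned. What is left on the original qubits
commutes with the checks and has weight less than `d`, so it is a stabilizer (`exists_cleaning`). Hence
the fault inverts no relation (`isStabilizer_of_weight_lt`): every relation is a sum of detectors, of the
relation that infers the value of `L`, and of relations that carry an operator commuting with `L` through
the procedure. Conversely, misreporting one Gauss law operator in all `T` rounds inverts the inferred
value of `L` and nothing else (`mem_logicalFaultWeights`).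

*The base graph* is a union of an expander of degree at most `68`, obtained from `34` random permutations
by a union bound (`exists_expander`), and of cliques on the `Z`-type supports of the checks, which
have even size because `L` commutes with the checks and thus have perfect matchings.

*The layers* come from the decongestion lemma of Freedman and Hastings (`exists_cycle_layers`). A graph
of bounded degree in which all degrees are at least two has a cycle with `O(log W)` vertices of degree at
least three (`exists_short_cycle`). Splitting off such cycles one after another produces vertex-disjoint
cycles whose number is a fraction `1 / O(log W)` of the cycle rank (`exists_disjoint_cycles`). They form one
layer; one edge of each is deleted, and `O(log² W)` repetitions reduce the graph to a tree. In a layer of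
disjoint cycles each vertex belongs to the cellulation of one cycle only, which bounds all degrees of the
layered graph. Its flux exactness follows because squares move a cochain from layer to layer and the
triangles fill each cycle in its own layer (`LayeredGraph.isFluxExact`).
-/

set_option linter.unusedSectionVars false

namespace Gauging

/-! ### The commutation form -/

section PauliAlgebra
variable {Q : Type*} [Fintype Q]

theorem siteComm_self (a : ZMod 2 × ZMod 2) : siteComm a a = 0 := by
  unfold siteComm; rw [mul_comm a.2]; exact CharTwo.add_self_eq_zero _

theorem siteComm_comm (a b : ZMod 2 × ZMod 2) : siteComm a b = siteComm b a := by
  unfold siteComm; ring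

/-- Commutation of Pauli operators as a bilinear form. -/
def commForm (Q : Type*) [Fintype Q] : Pauli Q →ₗ[ZMod 2] Pauli Q →ₗ[ZMod 2] ZMod 2 :=
  LinearMap.mk₂ (ZMod 2) Pauli.comm
    (fun a b c => by simp [Pauli.comm, siteComm, ← Finset.sum_add_distrib]; congr; ext; ring)
    (fun k a b => by simp [Pauli.comm, siteComm, Finset.mul_sum]; congr; ext; ring)
    (fun a b c => by simp [Pauli.comm, siteComm, ← Finset.sum_add_distrib]; congr; ext; ring)
    (fun k a b => by simp [Pauli.comm, siteComm, Finset.mul_sum]; congr; ext; ring)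

theorem commForm_apply (P P' : Pauli Q) : commForm Q P P' = P.comm P' := rfl

theorem Pauli.comm_symm (P P' : Pauli Q) : P.comm P' = P'.comm P :=
  Finset.sum_congr rfl fun _ _ => siteComm_comm _ _

theorem Pauli.comm_add_left (a b c : Pauli Q) : (a + b).comm c = a.comm c + b.comm c := by
  simp [← commForm_apply]

theorem Pauli.comm_add_right (a b c : Pauli Q) : a.comm (b + c) = a.comm b + a.comm c := by
  simp [← commForm_apply]

theorem Pauli.comm_zero_right (a : Pauli Q) : a.comm 0 = 0 := by
  simp [← commForm_apply]

theorem Pauli.comm_zero_left (a : Pauli Q) : Pauli.comm 0 a = 0 := by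
  simp [← commForm_apply]

theorem Pauli.comm_sum_left {κ : Type*} (t : Finset κ) (f : κ → Pauli Q) (a : Pauli Q) :
    (∑ i ∈ t, f i).comm a = ∑ i ∈ t, (f i).comm a := by
  simp [← commForm_apply]

theorem Pauli.comm_sum_right {κ : Type*} (t : Finset κ) (f : κ → Pauli Q) (a : Pauli Q) :
    a.comm (∑ i ∈ t, f i) = ∑ i ∈ t, a.comm (f i) := by
  simp [← commForm_apply]

theorem Pauli.comm_smul_left (k : ZMod 2) (a b : Pauli Q) : (k • a).comm b = k * a.comm b := by
  simp [← commForm_apply]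

theorem Pauli.comm_smul_right (k : ZMod 2) (a b : Pauli Q) : a.comm (k • b) = k * a.comm b := by
  simp [← commForm_apply]

theorem Pauli.comm_eq_zero_of_mem_stabilizer {ι : Type*} {s : ι → Pauli Q} {P g : Pauli Q}
    (hP : ∀ j, P.comm (s j) = 0) (hg : g ∈ stabilizer s) : P.comm g = 0 := by
  have : stabilizer s ≤ LinearMap.ker (commForm Q P) := by
    refine Submodule.span_le.2 ?_
    rintro _ ⟨j, rfl⟩
    exact hP j
  exact this hg

theorem Pauli.mem_support {P : Pauli Q} {q : Q} : q ∈ P.support ↔ P q ≠ 0 := by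
  simp [Pauli.support]

theorem Pauli.support_add_subset (a b : Pauli Q) : (a + b).support ⊆ a.support ∪ b.support := by
  intro q hq
  simp only [Pauli.support, Finset.mem_filter, Finset.mem_univ, true_and, Finset.mem_union,
    Pi.add_apply] at hq ⊢
  by_contra h
  push Not at h
  exact hq (by rw [h.1, h.2, add_zero])

theorem Pauli.weight_add_le (a b : Pauli Q) : (a + b).weight ≤ a.weight + b.weight :=
  (Finset.card_le_card (a.support_add_subset b)).trans (Finset.card_union_le _ _)

theorem Pauli.weight_zero : (0 : Pauli Q).weight = 0 := by
  simp [Pauli.weight, Pauli.support]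

theorem Pauli.weight_sum_le {κ : Type*} (t : Finset κ) (f : κ → Pauli Q) :
    (∑ i ∈ t, f i).weight ≤ ∑ i ∈ t, (f i).weight :=
  Finset.le_sum_of_subadditive _ Pauli.weight_zero.le Pauli.weight_add_le t f

/-- An operator that commutes with all checks and weighs less than the distance is a stabilizer. -/
theorem mem_stabilizer_of_weight_lt {ι : Type*} {s : ι → Pauli Q} {d : ℕ} (hd : HasDistance s d)
    {P : Pauli Q} (hP : ∀ j, P.comm (s j) = 0) (hw : P.weight < d) : P ∈ stabilizer s := by
  by_contra h
  exact absurd (hd.2 ⟨P, ⟨hP, h⟩, rfl⟩) (not_le.2 hw)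

theorem HasDistance.pos {ι : Type*} {s : ι → Pauli Q} {d : ℕ} (hd : HasDistance s d) : 0 < d := by
  obtain ⟨P, ⟨_, hP⟩, rfl⟩ := hd.1
  rw [Nat.pos_iff_ne_zero]
  intro h
  apply hP
  have : P = 0 := by
    funext q
    by_contra hq
    have : q ∈ P.support := by simpa [Pauli.support] using hq
    rw [Finset.card_eq_zero.1 h] at this
    simp at this
  rw [this]; exact zero_mem _

end PauliAlgebra

/-! ### Operators of the deformed code -/

section DeformedOps
variable {Q ι : Type*} [Fintype Q] {L : Pauli Q} (G : LayeredGraph L.support)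

theorem boundary_apply {V : Type*} [Fintype V] (H : SimpleGraph V) [Fintype H.edgeSet]
    [∀ (v : V) (e : Sym2 V), Decidable (v ∈ e)] (f : H.edgeSet → ZMod 2) (v : V) :
    boundary H f v = ∑ e : H.edgeSet, if v ∈ (e : Sym2 V) then f e else 0 := by
  simp only [boundary, LinearMap.coe_mk, AddHom.coe_mk]
  congr!

/-- The operator `P` on the original qubits times `Z` on the edges of the chain `γ`. -/
noncomputable def withZ (P : Pauli Q) (γ : G.Edge → ZMod 2) : Pauli (DefQubit G)
  | .inl q => P q
  | .inr e => (0, γ e)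

/-- The indicator chain of a set of edges of the layered graph. -/
noncomputable def edgeIndicator (c : Set (Sym2 G.Vert)) : G.Edge → ZMod 2 :=
  fun e => if (e : Sym2 G.Vert) ∈ c then 1 else 0

/-- The chain of the copies in layer `0` of the edges in `γ`. -/
noncomputable def layerZeroChain (γ : Finset (Sym2 L.support)) : G.Edge → ZMod 2 :=
  fun e => if ∃ x ∈ γ, (e : Sym2 G.Vert) = Sym2.map (fun v => (0, v)) x then 1 else 0

theorem extendOp_eq_withZ (P : Pauli Q) : extendOp G P = withZ G P 0 := by
  funext q; cases q <;> rfl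

theorem edgeZ_eq_withZ (e : G.Edge) : edgeZ G e = withZ G 0 (Pi.single e 1) := by
  funext q
  rcases q with q | e'
  · rfl
  · simp only [edgeZ, withZ, Pi.single_apply]; split_ifs <;> rfl

theorem fluxOp_eq_withZ (p : G.Face) :
    fluxOp G p = withZ G 0 (edgeIndicator G (G.faceEdges p)) := by
  funext q
  rcases q with q | e'
  · rfl
  · simp only [fluxOp, withZ, edgeIndicator]; split_ifs <;> rfl

theorem deform_eq_withZ (P : Pauli Q) (γ : Finset (Sym2 L.support)) :
    deform G P γ = withZ G P (layerZeroChain G γ) := by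
  funext q
  rcases q with q | e'
  · rfl
  · simp only [deform, withZ, layerZeroChain]; split_ifs <;> rfl

theorem withZ_add (P P' : Pauli Q) (γ γ' : G.Edge → ZMod 2) :
    withZ G P γ + withZ G P' γ' = withZ G (P + P') (γ + γ') := by
  funext q
  rcases q with q | e'
  · rfl
  · simp [withZ]

theorem withZ_zero : withZ G (0 : Pauli Q) 0 = 0 := by
  funext q
  rcases q with q | e' <;> rfl

theorem sum_edgeZ (γ : G.Edge → ZMod 2) : ∑ e, γ e • edgeZ G e = withZ G 0 γ := by
  funext q
  rcases q with q | e'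
  · simp [edgeZ, withZ, Finset.sum_apply]
  · simp only [Finset.sum_apply, Pi.smul_apply, edgeZ, withZ]
    rw [Finset.sum_eq_single e']
    · simp
    · intro b _ hb; rw [if_neg (Ne.symm hb)]; simp
    · simp

theorem comm_withZ (E : Pauli (DefQubit G)) (P : Pauli Q) (γ : G.Edge → ZMod 2) :
    E.comm (withZ G P γ) = Pauli.comm (fun q => E (.inl q)) P + ∑ e, (E (.inr e)).1 * γ e := by
  simp [Pauli.comm, Fintype.sum_sum_type, withZ, siteComm]

theorem withZ_comm_withZ (P P' : Pauli Q) (γ γ' : G.Edge → ZMod 2) :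
    (withZ G P γ).comm (withZ G P' γ') = P.comm P' := by
  rw [comm_withZ]; simp [withZ]

/-- The commutation relations of `P`, `γ` with the Gauss law operators: the chain `γ` ends exactly in
the vertices of layer `0` at which `P` anticommutes with the local factor of `L`. -/
def IsGaussInvariant (P : Pauli Q) (γ : G.Edge → ZMod 2) : Prop :=
  ∀ v : G.Vert, boundary G.graph γ v = if v.1 = 0 then siteComm (L v.2) (P v.2) else 0

/-- The Gauss law operator at `v` sees the local factor of `P` at `v` and the endpoints of `γ` at `v`. -/
theorem gaussOp_comm_withZ_eq (v : G.Vert) (P : Pauli Q) (γ : G.Edge → ZMod 2) :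
    (gaussOp G v).comm (withZ G P γ) =
      (if v.1 = 0 then siteComm (L v.2) (P v.2) else 0) + boundary G.graph γ v := by
  rw [comm_withZ]
  congr 1
  · unfold Pauli.comm
    by_cases h : v.1 = 0
    · rw [if_pos h, Finset.sum_eq_single (v.2 : Q)]
      · simp [gaussOp, h]
      · intro q _ hq
        simp [gaussOp, Ne.symm hq, siteComm]
      · simp
    · rw [if_neg h]
      exact Finset.sum_eq_zero fun q _ => by simp [gaussOp, h, siteComm]
  · simp only [boundary_apply, gaussOp]
    exact Finset.sum_congr rfl fun e _ => by split_ifs <;> simp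

theorem gaussOp_comm_withZ {P : Pauli Q} {γ : G.Edge → ZMod 2} (h : IsGaussInvariant G P γ)
    (v : G.Vert) : (gaussOp G v).comm (withZ G P γ) = 0 := by
  rw [gaussOp_comm_withZ_eq, h v]; exact CharTwo.add_self_eq_zero _

theorem gaussOp_comm_gaussOp (u v : G.Vert) : (gaussOp G u).comm (gaussOp G v) = 0 := by
  unfold Pauli.comm
  refine Finset.sum_eq_zero fun q _ => ?_
  rcases q with q | e
  · simp only [gaussOp]
    split_ifs
    · exact siteComm_self _
    all_goals simp [siteComm]
  · simp only [gaussOp]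
    split_ifs <;> simp [siteComm]

theorem isGaussInvariant_self : IsGaussInvariant G L 0 := by
  intro v; simp [siteComm_self]

/-- The edges in a cycle have no endpoints. -/
theorem isGaussInvariant_flux {p : G.Face}
    (h : boundary G.graph (edgeIndicator G (G.faceEdges p)) = 0) :
    IsGaussInvariant G (0 : Pauli Q) (edgeIndicator G (G.faceEdges p)) := by
  intro v; rw [h]; simp [siteComm]

theorem layerZero_map_injective (G : LayeredGraph L.support) :
    Function.Injective (Sym2.map (fun v : L.support => ((0, v) : G.Vert))) :=
  Sym2.map.injective fun _ _ h => (Prod.mk.inj h).2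

theorem layerZero_map_mem_edgeSet {x : Sym2 L.support} (hx : x ∈ G.base.edgeSet) :
    Sym2.map (fun v => ((0, v) : G.Vert)) x ∈ G.graph.edgeSet := by
  induction x with
  | _ u v =>
    rw [SimpleGraph.mem_edgeSet] at hx
    rw [Sym2.map_mk, SimpleGraph.mem_edgeSet, LayeredGraph.graph, SimpleGraph.fromRel_adj]
    refine ⟨fun h => hx.ne (Prod.mk.inj h).2, Or.inl (Or.inl ⟨rfl, hx⟩)⟩

/-- The boundary of a chain in layer `0` is the boundary in the base graph. -/
theorem boundary_layerZeroChain {γ : Finset (Sym2 L.support)} (hγ : ∀ x ∈ γ, x ∈ G.base.edgeSet)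
    (v : G.Vert) :
    boundary G.graph (layerZeroChain G γ) v =
      if v.1 = 0 then ((γ.filter fun x => v.2 ∈ x).card : ZMod 2) else 0 := by
  simp only [boundary_apply, layerZeroChain]
  have h1 : ∀ e : G.Edge, (if v ∈ (e : Sym2 G.Vert) then
      (if ∃ x ∈ γ, (e : Sym2 G.Vert) = Sym2.map (fun v => (0, v)) x then (1 : ZMod 2) else 0) else 0)
      = if v ∈ (e : Sym2 G.Vert) ∧ ∃ x ∈ γ, (e : Sym2 G.Vert) = Sym2.map (fun v => (0, v)) x
        then 1 else 0 := by
    intro e; split_ifs <;> simp_all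
  simp only [h1, Finset.sum_boole]
  split_ifs with h0
  · congr 1
    symm
    refine Finset.card_bij
      (fun x hx => ⟨Sym2.map (fun v => ((0, v) : G.Vert)) x,
        layerZero_map_mem_edgeSet G (hγ x (Finset.mem_filter.1 hx).1)⟩) ?_ ?_ ?_
    · intro x hx
      rw [Finset.mem_filter] at hx
      rw [Finset.mem_filter]
      refine ⟨Finset.mem_univ _, ?_, x, hx.1, rfl⟩
      rw [Sym2.mem_map]
      exact ⟨v.2, hx.2, Prod.ext h0.symm rfl⟩
    · intro x _ y _ hxy
      exact layerZero_map_injective G (Subtype.ext_iff.1 hxy)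
    · intro e he
      rw [Finset.mem_filter] at he
      obtain ⟨_, hv, x, hx, hex⟩ := he
      refine ⟨x, ?_, Subtype.ext hex.symm⟩
      rw [Finset.mem_filter]
      refine ⟨hx, ?_⟩
      rw [hex, Sym2.mem_map] at hv
      obtain ⟨w, hw, rfl⟩ := hv
      exact hw
  · rw [Finset.filter_eq_empty_iff.2, Finset.card_empty, Nat.cast_zero]
    rintro e - ⟨hv, x, hx, hex⟩
    rw [hex, Sym2.mem_map] at hv
    obtain ⟨w, hw, rfl⟩ := hv
    exact h0 rfl

/-- A perfect matching of the `Z`-type support of `P` ends exactly where `P` violates the Gauss law. -/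
theorem isGaussInvariant_matching {P : Pauli Q} {M : Finset (Sym2 L.support)}
    (hM : IsPerfectMatchingOf G.base (zSupport L P) M) :
    IsGaussInvariant G P (layerZeroChain G M) := by
  intro v
  rw [boundary_layerZeroChain G fun x hx => (hM.1 x hx).1]
  split_ifs with h0
  · by_cases hv : v.2 ∈ zSupport L P
    · obtain ⟨e, ⟨he, hve⟩, huniq⟩ := hM.2 _ hv
      have h1 : M.filter (fun x => v.2 ∈ x) = {e} := by
        ext x
        simp only [Finset.mem_filter, Finset.mem_singleton]
        exact ⟨fun h => huniq x h, fun h => h ▸ ⟨he, hve⟩⟩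
      rw [h1, Finset.card_singleton, Nat.cast_one]
      have h2 : siteComm (L v.2) (P v.2) ≠ 0 := (Finset.mem_filter.1 hv).2
      exact (Fin.eq_one_of_ne_zero _ h2).symm
    · have h1 : M.filter (fun x => v.2 ∈ x) = ∅ := by
        rw [Finset.filter_eq_empty_iff]
        intro x hx hvx
        exact hv ((hM.1 x hx).2 _ hvx)
      rw [h1, Finset.card_empty, Nat.cast_zero]
      by_contra h
      exact hv (Finset.mem_filter.2 ⟨Finset.mem_univ _, Ne.symm h⟩)
  · rfl

theorem sum_gaussOp_apply_inl (φ : G.Vert → ZMod 2) (q : Q) :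
    (∑ v, φ v • gaussOp G v) (.inl q) =
      if h : q ∈ L.support then φ (0, ⟨q, h⟩) • L q else 0 := by
  simp only [Finset.sum_apply, Pi.smul_apply, gaussOp]
  split_ifs with h
  · rw [Finset.sum_eq_single ((0, ⟨q, h⟩) : G.Vert)]
    · simp
    · intro v _ hv
      rw [if_neg, smul_zero]
      rintro ⟨h1, h2⟩
      exact hv (Prod.ext h1 (Subtype.ext h2))
    · simp
  · refine Finset.sum_eq_zero fun v _ => ?_
    rw [if_neg, smul_zero]
    rintro ⟨_, rfl⟩
    exact h v.2.2

theorem sum_gaussOp_apply_inr (φ : G.Vert → ZMod 2) (e : G.Edge) :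
    (∑ v, φ v • gaussOp G v) (.inr e) = (∑ v, if v ∈ (e : Sym2 G.Vert) then φ v else 0, 0) := by
  simp only [Finset.sum_apply, Pi.smul_apply, gaussOp]
  ext
  · rw [Prod.fst_sum]
    exact Finset.sum_congr rfl fun v _ => by split_ifs <;> simp
  · rw [Prod.snd_sum]
    exact Finset.sum_eq_zero fun v _ => by split_ifs <;> simp

theorem sum_endpoints {V : Type*} [Fintype V] {u v : V} (h : u ≠ v) (φ : V → ZMod 2)
    [∀ w, Decidable (w ∈ s(u, v))] :
    (∑ w, if w ∈ s(u, v) then φ w else 0) = φ u + φ v := by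
  rw [← Finset.sum_filter]
  have : Finset.univ.filter (fun w => w ∈ s(u, v)) = {u, v} := by
    ext w; simp
  rw [this, Finset.sum_pair h]

/-- The product of all Gauss law operators is the measured operator. -/
theorem sum_gaussOp : ∑ v, gaussOp G v = extendOp G L := by
  have h := sum_gaussOp_apply_inl G (fun _ => 1)
  have h' := sum_gaussOp_apply_inr G (fun _ => 1)
  simp only [one_smul] at h h'
  funext q
  rcases q with q | e
  · rw [h, extendOp]
    split_ifs with hq
    · rfl
    · by_contra h0
      exact hq (by simp [Pauli.support, Ne.symm h0])
  · rw [h', extendOp]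
    obtain ⟨e, he⟩ := e
    induction e with
    | _ u v =>
      refine Prod.ext ?_ rfl
      exact (sum_endpoints ((SimpleGraph.mem_edgeSet _).1 he).ne (fun _ => 1)).trans
        (CharTwo.add_self_eq_zero _)

end DeformedOps


/-! ### Relations of a measurement procedure -/

namespace Procedure
variable {Q Λ : Type*} [Fintype Q] [Fintype Λ] {Pr : Procedure Q Λ}

/-- The collection of measurements that consists of those in `f`, in round `r₀`. -/
noncomputable def atRound (Pr : Procedure Q Λ) (r₀ : Fin Pr.rounds) (f : Λ → ZMod 2) :
    Fin Pr.rounds → Λ → ZMod 2 := fun r l => if r = r₀ then f l else 0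

theorem backward_add (D D' : Fin Pr.rounds → Λ → ZMod 2) (o o' : Pauli Q) (t : ℕ) :
    Pr.backward (D + D') (o + o') t = Pr.backward D o t + Pr.backward D' o' t := by
  unfold backward
  rw [add_add_add_comm, ← Finset.sum_add_distrib]
  congr 1
  refine Finset.sum_congr rfl fun r _ => ?_
  split_ifs
  · rw [← Finset.sum_add_distrib]
    exact Finset.sum_congr rfl fun l _ => add_smul _ _ _
  · rw [add_zero]

theorem backward_add_left (D D' : Fin Pr.rounds → Λ → ZMod 2) (o : Pauli Q) (t : ℕ) :
    Pr.backward (D + D') o t = Pr.backward D o t + Pr.backward D' 0 t := by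
  rw [← backward_add, add_zero]

theorem backward_zero_left (o : Pauli Q) (t : ℕ) : Pr.backward 0 o t = o := by
  simp [backward]

theorem backward_atRound (r₀ : Fin Pr.rounds) (f : Λ → ZMod 2) (t : ℕ) :
    Pr.backward (Pr.atRound r₀ f) 0 t = if t ≤ (r₀ : ℕ) then ∑ l, f l • Pr.op l else 0 := by
  unfold backward
  rw [zero_add, Finset.sum_eq_single r₀]
  · simp [atRound]
  · intro r _ hr
    simp [atRound, hr]
  · simp

theorem flips_add (F : Pr.Fault) (D D' : Fin Pr.rounds → Λ → ZMod 2) (o o' : Pauli Q) :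
    F.flips (D + D') (o + o') = F.flips D o + F.flips D' o' := by
  have h1 : ∑ r, ∑ l, (D + D') r l * F.meas r l =
      ∑ r, ∑ l, D r l * F.meas r l + ∑ r, ∑ l, D' r l * F.meas r l := by
    simp only [Pi.add_apply, add_mul, Finset.sum_add_distrib]
  have h2 : ∑ r : Fin Pr.rounds, (F.err r).comm (Pr.backward (D + D') (o + o') r) =
      ∑ r : Fin Pr.rounds, (F.err r).comm (Pr.backward D o r) +
        ∑ r : Fin Pr.rounds, (F.err r).comm (Pr.backward D' o' r) := by
    simp only [backward_add, Pauli.comm_add_right, Finset.sum_add_distrib]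
  unfold Fault.flips
  rw [h1, h2]
  ring

theorem flips_add_left (F : Pr.Fault) (D D' : Fin Pr.rounds → Λ → ZMod 2) (o : Pauli Q) :
    F.flips (D + D') o = F.flips D o + F.flips D' 0 := by
  rw [← flips_add, add_zero]

theorem flips_eq_add (F : Pr.Fault) (D : Fin Pr.rounds → Λ → ZMod 2) (o : Pauli Q) :
    F.flips D o = F.flips D 0 + F.flips 0 o := by
  rw [← flips_add, add_zero, zero_add]

theorem backward_eq_add (D : Fin Pr.rounds → Λ → ZMod 2) (o : Pauli Q) (t : ℕ) :
    Pr.backward D o t = o + Pr.backward D 0 t := by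
  rw [backward, backward, zero_add]

theorem flips_zero_left (F : Pr.Fault) (o : Pauli Q) :
    F.flips 0 o = (∑ r, F.err r).comm o := by
  simp [Fault.flips, backward_zero_left, Pauli.comm_sum_left]

theorem flips_atRound (F : Pr.Fault) (r₀ : Fin Pr.rounds) (f : Λ → ZMod 2) :
    F.flips (Pr.atRound r₀ f) 0 = ∑ l, f l * F.meas r₀ l +
      (∑ r : Fin Pr.rounds, if (r : ℕ) ≤ r₀ then F.err r else 0).comm (∑ l, f l • Pr.op l) := by
  unfold Fault.flips
  congr 1
  · rw [Finset.sum_eq_single r₀]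
    · simp [atRound]
    · intro r _ hr
      simp [atRound, hr]
    · simp
  · rw [Pauli.comm_sum_left]
    refine Finset.sum_congr rfl fun r _ => ?_
    rw [backward_atRound]
    split_ifs
    · rfl
    · rw [Pauli.comm_zero_right, Pauli.comm_zero_left]

theorem IsRelation.add {D D' : Fin Pr.rounds → Λ → ZMod 2} {i i' o o' : Pauli Q}
    (h : Pr.IsRelation D i o) (h' : Pr.IsRelation D' i' o') :
    Pr.IsRelation (D + D') (i + i') (o + o') where
  measured r l hl := by
    by_cases h0 : D r l = 0
    · exact h'.measured r l fun h1 => hl (by simp [h0, h1])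
    · exact h.measured r l h0
  input_aux q hq := by rw [Pi.add_apply, h.input_aux q hq, h'.input_aux q hq, add_zero]
  output_aux q hq := by rw [Pi.add_apply, h.output_aux q hq, h'.output_aux q hq, add_zero]
  commutes r l hr := by
    rw [backward_add, Pauli.comm_add_right, h.commutes r l hr, h'.commutes r l hr, add_zero]
  backward_zero := by rw [backward_add, h.backward_zero, h'.backward_zero]

theorem backward_eq_add_sum (D : Fin Pr.rounds → Λ → ZMod 2) (o : Pauli Q) :
    Pr.backward D o 0 = o + ∑ l, (∑ r, D r l) • Pr.op l := by
  unfold backward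
  simp only [Nat.zero_le, if_true, Finset.sum_smul]
  rw [Finset.sum_comm]

end Procedure

theorem zmod_two_eq_one {c : ZMod 2} (hc : c ≠ 0) : c = 1 := by
  revert c; decide

theorem chain_add_self {E : Type*} (γ : E → ZMod 2) : γ + γ = 0 :=
  funext fun _ => CharTwo.add_self_eq_zero _

theorem pauli_add_self {Q : Type*} (P : Pauli Q) : P + P = 0 := by
  funext q; exact Prod.ext (CharTwo.add_self_eq_zero _) (CharTwo.add_self_eq_zero _)

/-! ### Relations of the gauging measurement -/

section GaugingRelations

variable {Q ι : Type*} [Fintype Q] [Fintype ι] {L : Pauli Q} (G : LayeredGraph L.support)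
  {s : ι → Pauli Q} {M : ι → Finset (Sym2 L.support)} {a T b : ℕ}

/-- The labels of original checks, with coefficients `f`. -/
def checkLabels (f : ι → ZMod 2) : ι ⊕ G.Edge ⊕ (G.Vert ⊕ G.Face ⊕ ι) → ZMod 2
  | .inl j => f j
  | .inr _ => 0

/-- The labels of the measurements of `Z` on the edges, with coefficients `γ`. -/
def edgeLabels (γ : G.Edge → ZMod 2) : ι ⊕ G.Edge ⊕ (G.Vert ⊕ G.Face ⊕ ι) → ZMod 2
  | .inl _ => 0
  | .inr (.inl e) => γ e
  | .inr (.inr _) => 0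

/-- The labels of deformed checks, with coefficients `f`. -/
def deformedLabels (f : G.Vert ⊕ G.Face ⊕ ι → ZMod 2) :
    ι ⊕ G.Edge ⊕ (G.Vert ⊕ G.Face ⊕ ι) → ZMod 2
  | .inl _ => 0
  | .inr (.inl _) => 0
  | .inr (.inr k) => f k

theorem sum_checkLabels_smul {A : Type*} [AddCommMonoid A] [Module (ZMod 2) A] (f : ι → ZMod 2)
    (g : ι ⊕ G.Edge ⊕ (G.Vert ⊕ G.Face ⊕ ι) → A) :
    ∑ l, checkLabels G f l • g l = ∑ j, f j • g (.inl j) := by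
  simp [Fintype.sum_sum_type, checkLabels]

theorem sum_edgeLabels_smul {A : Type*} [AddCommMonoid A] [Module (ZMod 2) A] (γ : G.Edge → ZMod 2)
    (g : ι ⊕ G.Edge ⊕ (G.Vert ⊕ G.Face ⊕ ι) → A) :
    ∑ l, edgeLabels G γ l • g l = ∑ e, γ e • g (.inr (.inl e)) := by
  simp [Fintype.sum_sum_type, edgeLabels]

theorem sum_deformedLabels_smul {A : Type*} [AddCommMonoid A] [Module (ZMod 2) A]
    (f : G.Vert ⊕ G.Face ⊕ ι → ZMod 2) (g : ι ⊕ G.Edge ⊕ (G.Vert ⊕ G.Face ⊕ ι) → A) :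
    ∑ l, deformedLabels G f l • g l = ∑ k, f k • g (.inr (.inr k)) := by
  simp [Fintype.sum_sum_type, deformedLabels]

/-- Every operator that is measured at some time commutes with a Gauss invariant operator whose
restriction to the original qubits commutes with the checks. -/
theorem op_comm_withZ {P : Pauli Q} {γ : G.Edge → ZMod 2} (hP : ∀ j, P.comm (s j) = 0)
    (hγ : IsGaussInvariant G P γ) (l : ι ⊕ G.Edge ⊕ (G.Vert ⊕ G.Face ⊕ ι)) :
    ((gaugingProcedure G s M a T b).op l).comm (withZ G P γ) = 0 := by
  rcases l with j | e | v | p | j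
  · show (extendOp G (s j)).comm _ = 0
    rw [extendOp_eq_withZ, withZ_comm_withZ, Pauli.comm_symm, hP]
  · show (edgeZ G e).comm _ = 0
    rw [edgeZ_eq_withZ, withZ_comm_withZ, Pauli.comm_zero_left]
  · exact gaussOp_comm_withZ G hγ v
  · show (fluxOp G p).comm _ = 0
    rw [fluxOp_eq_withZ, withZ_comm_withZ, Pauli.comm_zero_left]
  · show (deform G (s j) (M j)).comm _ = 0
    rw [deform_eq_withZ, withZ_comm_withZ, Pauli.comm_symm, hP]

theorem op_comm_extendOp {P : Pauli Q} (hP : ∀ j, P.comm (s j) = 0)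
    {l : ι ⊕ G.Edge ⊕ (G.Vert ⊕ G.Face ⊕ ι)} {r : Fin (a + T + b)}
    (hl : (gaugingProcedure G s M a T b).measured r l) (hr : ¬ (a ≤ (r : ℕ) ∧ (r : ℕ) < a + T)) :
    ((gaugingProcedure G s M a T b).op l).comm (extendOp G P) = 0 := by
  rcases l with j | e | k
  · show (extendOp G (s j)).comm _ = 0
    rw [extendOp_eq_withZ, extendOp_eq_withZ, withZ_comm_withZ, Pauli.comm_symm, hP]
  · show (edgeZ G e).comm _ = 0
    rw [edgeZ_eq_withZ, extendOp_eq_withZ, withZ_comm_withZ, Pauli.comm_zero_left]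
  · exact absurd hl hr

/-- A collection of measurements is a relation if the operator that it propagates backwards is, up to
`Z` operators on edges outside the deformed phase, trivial or one fixed Gauss invariant operator. -/
theorem isRelation_of_backward {P : Pauli Q} {γ : G.Edge → ZMod 2} (hP : ∀ j, P.comm (s j) = 0)
    (hγ : IsGaussInvariant G P γ)
    {D : Fin (a + T + b) → ι ⊕ G.Edge ⊕ (G.Vert ⊕ G.Face ⊕ ι) → ZMod 2} {i o : Pauli Q}
    (hD : ∀ r l, D r l ≠ 0 → (gaugingProcedure G s M a T b).measured r l)
    (hin : ∀ t, a ≤ t → t < a + T →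
      (gaugingProcedure G s M a T b).backward D (extendOp G o) (t + 1) = 0 ∨
      (gaugingProcedure G s M a T b).backward D (extendOp G o) (t + 1) = withZ G P γ)
    (hout : ∀ t, ¬ (a ≤ t ∧ t < a + T) →
      (gaugingProcedure G s M a T b).backward D (extendOp G o) (t + 1) = 0 ∨
      (gaugingProcedure G s M a T b).backward D (extendOp G o) (t + 1) = withZ G P γ ∨
      (gaugingProcedure G s M a T b).backward D (extendOp G o) (t + 1) = extendOp G P)
    (h0 : (gaugingProcedure G s M a T b).backward D (extendOp G o) 0 = extendOp G i) :
    (gaugingProcedure G s M a T b).IsRelation D (extendOp G i) (extendOp G o) where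
  measured := hD
  input_aux q hq := by
    rcases q with q | e
    · exact hq.elim
    · rfl
  output_aux q hq := by
    rcases q with q | e
    · exact hq.elim
    · rfl
  commutes r l hl := by
    by_cases hr : a ≤ (r : ℕ) ∧ (r : ℕ) < a + T
    · rcases hin r hr.1 hr.2 with h | h <;> rw [h]
      · exact Pauli.comm_zero_right _
      · exact op_comm_withZ G hP hγ l
    · rcases hout r hr with h | h | h <;> rw [h]
      · exact Pauli.comm_zero_right _
      · exact op_comm_withZ G hP hγ l
      · exact op_comm_extendOp G hP hl hr
  backward_zero := h0

end GaugingRelations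

/-! ### Chains and potentials on connected graphs -/

section Chains
variable {V : Type*} [Fintype V] {H : SimpleGraph V}

theorem boundary_single {u v : V} (h : H.Adj u v) :
    boundary H (Pi.single ⟨s(u, v), h⟩ 1) = Pi.single u 1 + Pi.single v 1 := by
  funext w
  rw [boundary_apply, Finset.sum_eq_single ⟨s(u, v), h⟩]
  · simp only [Pi.single_eq_same, Sym2.mem_iff, Pi.add_apply, Pi.single_apply]
    by_cases h1 : w = u
    · subst h1; simp [h.ne]
    · simp [h1]
  · intro e _ he; simp [he]
  · simp

theorem exists_boundary_eq_of_reachable {u v : V} (h : H.Reachable u v) :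
    ∃ γ, boundary H γ = Pi.single u 1 + Pi.single v 1 := by
  obtain ⟨p⟩ := h
  induction p with
  | nil =>
    refine ⟨0, ?_⟩
    rw [map_zero]; funext w; exact (CharTwo.add_self_eq_zero _).symm
  | @cons u v w h _ ih =>
    obtain ⟨γ, hγ⟩ := ih
    refine ⟨Pi.single ⟨s(u, v), h⟩ 1 + γ, ?_⟩
    rw [map_add, hγ, boundary_single]
    funext x
    simp only [Pi.add_apply]
    linear_combination CharTwo.add_self_eq_zero ((Pi.single v 1 : V → ZMod 2) x)

/-- On a connected graph every even set of vertices is a boundary. -/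
theorem exists_boundary_eq (hH : H.Connected) (g : V → ZMod 2) (hg : ∑ v, g v = 0) :
    ∃ γ, boundary H γ = g := by
  obtain ⟨v₀⟩ := hH.nonempty
  choose γ hγ using fun v => exists_boundary_eq_of_reachable (hH.preconnected v v₀)
  refine ⟨∑ v, g v • γ v, ?_⟩
  rw [map_sum]
  funext w
  simp only [map_smul, hγ, Finset.sum_apply, Pi.smul_apply, Pi.add_apply, smul_eq_mul, mul_add,
    Finset.sum_add_distrib, ← Finset.sum_mul, hg, zero_mul, add_zero]
  simp [Pi.single_apply]

theorem eq_of_connected {α : Type*} (hH : H.Connected) {c : V → α}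
    (hc : ∀ u v, H.Adj u v → c u = c v) (u v : V) : c u = c v := by
  obtain ⟨p⟩ := hH.preconnected u v
  induction p with
  | nil => rfl
  | cons h _ ih => exact (hc _ _ h).trans ih

/-- Every cochain on the edges of the graph with zero flux through all faces is the coboundary of a
potential on the vertices. -/
def IsFluxExact {V κ : Type*} [Fintype V] (H : SimpleGraph V) (c : κ → Set (Sym2 V)) : Prop :=
  ∀ A : H.edgeSet → ZMod 2, (∀ p, ∑ e : H.edgeSet, (if (e : Sym2 V) ∈ c p then A e else 0) = 0) →
    ∃ φ : V → ZMod 2, ∀ u v (h : H.Adj u v), A ⟨s(u, v), h⟩ = φ u + φ v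

theorem IsFluxExact.exists_potential {κ : Type*} {c : κ → Set (Sym2 V)} (h : IsFluxExact H c)
    [Fintype H.edgeSet] [∀ p (e : Sym2 V), Decidable (e ∈ c p)] (A : H.edgeSet → ZMod 2)
    (hA : ∀ p, ∑ e : H.edgeSet, (if (e : Sym2 V) ∈ c p then A e else 0) = 0) :
    ∃ φ : V → ZMod 2, ∀ u v (h : H.Adj u v), A ⟨s(u, v), h⟩ = φ u + φ v :=
  h A fun p => Eq.trans (by congr!) (hA p)

end Chains

/-! ### Cleaning errors in the deformed code -/

section Cleaning

variable {Q ι : Type*} [Fintype Q] {L : Pauli Q} (G : LayeredGraph L.support)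

variable {s : ι → Pauli Q} {M : ι → Finset (Sym2 L.support)}

/-- The number of edges of layer `0` at which a potential jumps is at least the size of the smaller of
its two level sets in layer `0`. -/
theorem card_le_card_jump
    (hC : ∀ S : Finset L.support, 2 * S.card ≤ Fintype.card L.support →
      S.card ≤ (G.base.interedges S Sᶜ).card)
    {A : G.Edge → ZMod 2} {φ : G.Vert → ZMod 2}
    (hA : ∀ u v (h : G.graph.Adj u v), A ⟨s(u, v), h⟩ = φ u + φ v)
    (hφ : 2 * (Finset.univ.filter fun v : L.support => φ (0, v) ≠ 0).card ≤
      Fintype.card L.support) :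
    (Finset.univ.filter fun v : L.support => φ (0, v) ≠ 0).card ≤
      (Finset.univ.filter fun e => A e ≠ 0).card := by
  refine (hC _ hφ).trans ?_
  have hadj : ∀ x ∈ G.base.interedges (Finset.univ.filter fun v : L.support => φ (0, v) ≠ 0)
      (Finset.univ.filter fun v : L.support => φ (0, v) ≠ 0)ᶜ,
      φ (0, x.1) ≠ 0 ∧ φ (0, x.2) = 0 ∧ G.base.Adj x.1 x.2 := by
    rintro ⟨u, v⟩ hx
    rw [SimpleGraph.mem_interedges_iff] at hx
    simpa using hx
  have hedge : ∀ u v, G.base.Adj u v → G.graph.Adj (0, u) (0, v) := fun u v h =>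
    layerZero_map_mem_edgeSet G (x := s(u, v)) h
  rw [← Finset.card_map (Function.Embedding.subtype fun e => e ∈ G.graph.edgeSet)]
  refine Finset.card_le_card_of_injOn (fun x => s((0, x.1), (0, x.2))) ?_ ?_
  · intro x hx
    obtain ⟨h1, h2, h3⟩ := hadj x hx
    simp only [Finset.coe_map, Set.mem_image, Finset.coe_filter, Set.mem_ofPred_eq]
    refine ⟨⟨s((0, x.1), (0, x.2)), hedge _ _ h3⟩, ⟨Finset.mem_univ _, ?_⟩, rfl⟩
    rw [hA, h2, add_zero]
    exact h1
  · rintro ⟨u, v⟩ hx ⟨u', v'⟩ hy hxy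
    obtain ⟨h1, h2, -⟩ := hadj _ hx
    obtain ⟨h1', h2', -⟩ := hadj _ hy
    simp only [Sym2.eq_iff, Prod.mk.injEq, true_and] at hxy
    rcases hxy with ⟨rfl, rfl⟩ | ⟨rfl, rfl⟩
    · rfl
    · exact absurd h2' h1

/-- Adding `1` to a potential does not change its coboundary, so that the potential may be chosen to be
nonzero on at most half of the vertices of layer `0`. -/
theorem exists_small_potential {A : G.Edge → ZMod 2}
    (hA : ∃ φ : G.Vert → ZMod 2, ∀ u v (h : G.graph.Adj u v), A ⟨s(u, v), h⟩ = φ u + φ v) :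
    ∃ φ : G.Vert → ZMod 2, (∀ u v (h : G.graph.Adj u v), A ⟨s(u, v), h⟩ = φ u + φ v) ∧
      2 * (Finset.univ.filter fun v : L.support => φ (0, v) ≠ 0).card ≤
        Fintype.card L.support := by
  obtain ⟨φ, hφ⟩ := hA
  by_cases h : 2 * (Finset.univ.filter fun v : L.support => φ (0, v) ≠ 0).card ≤
      Fintype.card L.support
  · exact ⟨φ, hφ, h⟩
  · refine ⟨fun v => φ v + 1, fun u v huv => ?_, ?_⟩
    · rw [hφ u v huv]
      linear_combination -CharTwo.add_self_eq_zero (1 : ZMod 2)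
    · have h1 : (Finset.univ.filter fun v : L.support => φ (0, v) + 1 ≠ 0) =
          (Finset.univ.filter fun v : L.support => ¬ φ (0, v) ≠ 0) := by
        refine Finset.filter_congr fun v _ => ?_
        generalize φ (0, v) = x
        revert x; decide
      rw [h1]
      have := Finset.card_filter_add_card_filter_not (s := (Finset.univ : Finset L.support))
        (fun v => φ (0, v) ≠ 0)
      rw [Finset.card_univ] at this
      omega

theorem weight_eq_add (E : Pauli (DefQubit G)) :
    E.weight = Pauli.weight (fun q => E (.inl q)) +
      (Finset.univ.filter fun e => E (.inr e) ≠ 0).card := by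
  have h : E.support = (Pauli.support fun q => E (.inl q)).map Function.Embedding.inl ∪
      (Finset.univ.filter fun e => E (.inr e) ≠ 0).map Function.Embedding.inr := by
    ext q
    simp only [Pauli.mem_support, Finset.mem_union, Finset.mem_map, Finset.mem_filter,
      Finset.mem_univ, true_and]
    rcases q with q | e
    · exact ⟨fun h => Or.inl ⟨q, h, rfl⟩, by rintro (⟨_, h, h'⟩ | ⟨_, _, h'⟩) <;> cases h'; exact h⟩
    · exact ⟨fun h => Or.inr ⟨e, h, rfl⟩, by rintro (⟨_, _, h'⟩ | ⟨_, h, h'⟩) <;> cases h'; exact h⟩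
  rw [Pauli.weight, h, Finset.card_union_of_disjoint, Finset.card_map, Finset.card_map,
    Pauli.weight]
  rw [Finset.disjoint_left]
  intro q hq hq'
  simp only [Finset.mem_map] at hq hq'
  obtain ⟨x, _, rfl⟩ := hq
  obtain ⟨y, _, h⟩ := hq'
  cases h

/-- Cleaning: an error of weight less than the distance that violates no flux operator and no deformed
check is, up to `Z` operators on edges, a product of Gauss law operators and original checks. The
expansion of the base graph ensures that the part of the measured operator that is needed to clean the
error from the edges weighs no more than what it removes. -/
theorem exists_cleaning {d : ℕ} (hd : HasDistance s d)
    (hC : ∀ S : Finset L.support, 2 * S.card ≤ Fintype.card L.support →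
      S.card ≤ (G.base.interedges S Sᶜ).card)
    (hX : IsFluxExact G.graph G.faceEdges)
    (hM : ∀ j, IsGaussInvariant G (s j) (layerZeroChain G (M j)))
    {E : Pauli (DefQubit G)} (hs : ∀ j, E.comm (deform G (s j) (M j)) = 0)
    (hB : ∀ p, E.comm (fluxOp G p) = 0) (hE : E.weight < d) :
    ∃ φ : G.Vert → ZMod 2, ∃ g ∈ stabilizer s, ∃ γ,
      E = ∑ v, φ v • gaussOp G v + withZ G g γ := by
  obtain ⟨φ, hφ, hsmall⟩ := exists_small_potential G (A := fun e => (E (.inr e)).1)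
      (hX.exists_potential (fun e => (E (.inr e)).1) fun p => by
    have := hB p
    rw [fluxOp_eq_withZ, comm_withZ, Pauli.comm_zero_right, zero_add] at this
    refine Eq.trans (Finset.sum_congr rfl fun e _ => ?_) this
    simp only [edgeIndicator]
    split_ifs <;> simp)
  have hjump := card_le_card_jump G (A := fun e => (E (.inr e)).1) hC hφ hsmall
  have hE' : ∃ g γ, E = ∑ v, φ v • gaussOp G v + withZ G g γ ∧
      ∀ q, g q = E (.inl q) + if h : q ∈ L.support then φ (0, ⟨q, h⟩) • L q else 0 := by
    refine ⟨fun q => E (.inl q) + if h : q ∈ L.support then φ (0, ⟨q, h⟩) • L q else 0,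
      fun e => (E (.inr e)).2, ?_, fun q => rfl⟩
    funext q
    rcases q with q | e
    · rw [Pi.add_apply, sum_gaussOp_apply_inl]
      simp only [withZ]
      rw [add_left_comm, show ∀ x : ZMod 2 × ZMod 2, x + x = 0 from
        fun x => Prod.ext (CharTwo.add_self_eq_zero _) (CharTwo.add_self_eq_zero _), add_zero]
    · rw [Pi.add_apply, sum_gaussOp_apply_inr]
      refine Prod.ext ?_ ?_
      · simp only [withZ, Prod.fst_add, add_zero]
        obtain ⟨e, he⟩ := e
        induction e with
        | _ u v => exact (hφ u v he).trans (sum_endpoints ((SimpleGraph.mem_edgeSet _).1 he).ne φ).symm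
      · simp [withZ]
  obtain ⟨g, γ, hEg, hg⟩ := hE'
  refine ⟨φ, g, mem_stabilizer_of_weight_lt hd (fun j => ?_) ?_, γ, hEg⟩
  · have h := hs j
    rw [hEg, Pauli.comm_add_left, Pauli.comm_sum_left, deform_eq_withZ, withZ_comm_withZ,
      Finset.sum_eq_zero, zero_add] at h
    · exact h
    · intro v _
      rw [Pauli.comm_smul_left, gaussOp_comm_withZ G (hM j), mul_zero]
  · refine lt_of_le_of_lt ?_ hE
    have h1 : g.support ⊆ Pauli.support (fun q => E (.inl q)) ∪
        (Finset.univ.filter fun v : L.support => φ (0, v) ≠ 0).map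
          (Function.Embedding.subtype _) := by
      intro q hq
      by_contra hq'
      rw [Finset.mem_union, Pauli.mem_support, Finset.mem_map] at hq'
      simp only [not_or, not_not, Finset.mem_filter, Finset.mem_univ, true_and] at hq'
      rw [Pauli.mem_support] at hq
      apply hq
      rw [hg, hq'.1, zero_add]
      split_ifs with h
      · by_cases h0 : φ (0, ⟨q, h⟩) = 0
        · rw [h0, zero_smul]
        · exact absurd ⟨⟨q, h⟩, h0, rfl⟩ hq'.2
      · rfl
    have h2 : (Finset.univ.filter fun e => (E (.inr e)).1 ≠ 0).card ≤
        (Finset.univ.filter fun e : G.Edge => E (.inr e) ≠ 0).card := by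
      refine Finset.card_le_card fun e he => ?_
      rw [Finset.mem_filter] at he ⊢
      exact ⟨he.1, fun h => he.2 (by rw [h]; rfl)⟩
    have h3 := Finset.card_le_card h1
    have h4 := Finset.card_union_le (Pauli.support fun q => E (.inl q))
      ((Finset.univ.filter fun v : L.support => φ (0, v) ≠ 0).map (Function.Embedding.subtype _))
    rw [Finset.card_map] at h4
    rw [weight_eq_add]
    unfold Pauli.weight
    omega

/-- An operator as in `exists_cleaning` commutes with every Gauss invariant operator that restricts to
an operator commuting with the checks. -/
theorem comm_withZ_of_cleaning {φ : G.Vert → ZMod 2} {g : Pauli Q} (hg : g ∈ stabilizer s)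
    {γ γ' : G.Edge → ZMod 2} {P : Pauli Q} (hP : ∀ j, P.comm (s j) = 0)
    (hγ : IsGaussInvariant G P γ') :
    Pauli.comm (∑ v, φ v • gaussOp G v + withZ G g γ) (withZ G P γ') = 0 := by
  rw [Pauli.comm_add_left, Pauli.comm_sum_left, withZ_comm_withZ, Pauli.comm_symm,
    Pauli.comm_eq_zero_of_mem_stabilizer hP hg, add_zero]
  refine Finset.sum_eq_zero fun v _ => ?_
  rw [Pauli.comm_smul_left, gaussOp_comm_withZ G hγ, mul_zero]

end Cleaning

/-! ### The fault distance of the gauging measurement -/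

section FaultDistance

variable {Q ι : Type*} [Fintype Q] [Fintype ι] {L : Pauli Q} {G : LayeredGraph L.support}
  {s : ι → Pauli Q} {M : ι → Finset (Sym2 L.support)} {a T b : ℕ}

/-- The product of the operators `X` on the edges in the chain `p`. -/
def edgeX (G : LayeredGraph L.support) (p : G.Edge → ZMod 2) : Pauli (DefQubit G)
  | .inl _ => 0
  | .inr e => (p e, 0)

theorem edgeX_comm_withZ (p : G.Edge → ZMod 2) (P : Pauli Q) (γ : G.Edge → ZMod 2) :
    (edgeX G p).comm (withZ G P γ) = ∑ e, p e * γ e := by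
  rw [comm_withZ]
  simp only [edgeX]
  rw [show (fun _ : Q => (0 : ZMod 2 × ZMod 2)) = 0 from rfl, Pauli.comm_zero_left, zero_add]

theorem weight_edgeX (p : G.Edge → ZMod 2) :
    (edgeX G p).weight = (Finset.univ.filter fun e => p e ≠ 0).card := by
  rw [weight_eq_add]
  simp only [edgeX]
  rw [show (fun _ : Q => (0 : ZMod 2 × ZMod 2)) = 0 from rfl, Pauli.weight_zero, zero_add]
  congr 1
  exact Finset.filter_congr fun e _ => by simp [Prod.ext_iff]

variable (F : (gaugingProcedure G s M a T b).Fault)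

/-- The product of all Pauli errors up to time `t`. -/
noncomputable def errUpTo (t : ℕ) : Pauli (DefQubit G) :=
  ∑ r : Fin (gaugingProcedure G s M a T b).rounds, if (r : ℕ) ≤ t then F.err r else 0

/-- The product of all Pauli errors after time `t`. -/
noncomputable def errAfter (t : ℕ) : Pauli (DefQubit G) :=
  ∑ r : Fin (gaugingProcedure G s M a T b).rounds, if (r : ℕ) ≤ t then 0 else F.err r

theorem errUpTo_add_errAfter (t : ℕ) : errUpTo F t + errAfter F t = ∑ r, F.err r := by
  unfold errUpTo errAfter
  refine Finset.sum_add_distrib.symm.trans (Finset.sum_congr rfl fun r _ => ?_)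
  split_ifs <;> simp

theorem err_inr_eq_zero {r : Fin (gaugingProcedure G s M a T b).rounds}
    (hr : ¬ (a ≤ (r : ℕ) ∧ (r : ℕ) ≤ a + T)) (e : G.Edge) :
    F.err r (.inr e) = 0 := by
  by_contra h
  exact hr (F.err_noisy r _ h)

theorem errUpTo_inr_of_lt {t : ℕ} (ht : t < a) (e : G.Edge) : errUpTo F t (.inr e) = 0 := by
  rw [errUpTo, Finset.sum_apply]
  refine Finset.sum_eq_zero fun r _ => ?_
  split_ifs
  · exact err_inr_eq_zero F (by omega) e
  · rfl

theorem errAfter_inr_of_le {t : ℕ} (ht : a + T ≤ t) (e : G.Edge) :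
    errAfter F t (.inr e) = 0 := by
  rw [errAfter, Finset.sum_apply]
  refine Finset.sum_eq_zero fun r _ => ?_
  split_ifs
  · rfl
  · exact err_inr_eq_zero F (by omega) e

theorem comm_withZ_zero_of_inr {E : Pauli (DefQubit G)} (hE : ∀ e, E (.inr e) = 0)
    (γ : G.Edge → ZMod 2) : E.comm (withZ G 0 γ) = 0 := by
  rw [comm_withZ, Pauli.comm_zero_right, zero_add]
  exact Finset.sum_eq_zero fun e _ => by rw [hE]; simp

/-- The round in which the edge qubits are prepared. -/
def prepRound (ha : 0 < a) : Fin (gaugingProcedure G s M a T b).rounds :=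
  ⟨a - 1, show a - 1 < a + T + b by omega⟩

/-- The round in which the edge qubits are read out. -/
def readRound (hb : 0 < b) : Fin (gaugingProcedure G s M a T b).rounds :=
  ⟨a + T, show a + T < a + T + b by omega⟩

/-- The last round. -/
def lastRound (hb : 0 < b) : Fin (gaugingProcedure G s M a T b).rounds :=
  ⟨a + T + b - 1, show a + T + b - 1 < a + T + b by omega⟩

variable (ha : 0 < a) (hb : 0 < b)

/-- The accumulated error up to time `t`; a faulty preparation counts as an `X` error. -/
noncomputable def pastError (t : ℕ) : Pauli (DefQubit G) :=
  errUpTo F t + edgeX G fun e => F.meas (prepRound ha) (.inr (.inl e))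

/-- The accumulated error after time `t`; a faulty readout counts as an `X` error. -/
noncomputable def futureError (t : ℕ) : Pauli (DefQubit G) :=
  errAfter F t + edgeX G fun e => F.meas (readRound hb) (.inr (.inl e))

theorem weight_edgeX_meas_le (r : Fin (gaugingProcedure G s M a T b).rounds) :
    (edgeX G fun e => F.meas r (.inr (.inl e))).weight ≤
      ∑ r, (Finset.univ.filter fun l => F.meas r l ≠ 0).card := by
  rw [weight_edgeX]
  refine le_trans ?_ (Finset.single_le_sum
    (f := fun r => (Finset.univ.filter fun l => F.meas r l ≠ 0).card)
    (fun _ _ => Nat.zero_le _) (Finset.mem_univ r))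
  refine Finset.card_le_card_of_injOn (fun e => .inr (.inl e)) ?_ ?_
  · intro e he
    simpa using he
  · intro e _ e' _ h
    simpa using h

theorem weight_pastError_le (t : ℕ) : (pastError F ha t).weight ≤ F.weight := by
  refine (Pauli.weight_add_le _ _).trans (add_le_add ?_ (weight_edgeX_meas_le F _))
  refine (Pauli.weight_sum_le _ _).trans (Finset.sum_le_sum fun r _ => ?_)
  split_ifs
  · exact le_rfl
  · rw [Pauli.weight_zero]; exact Nat.zero_le _

theorem weight_futureError_le (t : ℕ) : (futureError F hb t).weight ≤ F.weight := by
  refine (Pauli.weight_add_le _ _).trans (add_le_add ?_ (weight_edgeX_meas_le F _))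
  refine (Pauli.weight_sum_le _ _).trans (Finset.sum_le_sum fun r _ => ?_)
  split_ifs
  · rw [Pauli.weight_zero]; exact Nat.zero_le _
  · exact le_rfl

theorem sum_edgeLabels_op (γ : G.Edge → ZMod 2) :
    ∑ l, edgeLabels G γ l • (gaugingProcedure G s M a T b).op l = withZ G 0 γ := by
  rw [sum_edgeLabels_smul]
  exact sum_edgeZ G γ

theorem flips_prep (γ : G.Edge → ZMod 2) :
    F.flips ((gaugingProcedure G s M a T b).atRound (prepRound ha) (edgeLabels G γ)) 0 =
      (edgeX G fun e => F.meas (prepRound ha) (.inr (.inl e))).comm (withZ G 0 γ) := by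
  rw [Procedure.flips_atRound, sum_edgeLabels_op, edgeX_comm_withZ]
  have h1 := comm_withZ_zero_of_inr (errUpTo_inr_of_lt F (t := a - 1) (by omega)) γ
  have h2 := sum_edgeLabels_smul G γ (F.meas (prepRound ha))
  simp only [smul_eq_mul] at h2
  rw [h2]
  refine (congrArg₂ (· + ·) rfl h1).trans ?_
  rw [add_zero]
  exact Finset.sum_congr rfl fun e _ => mul_comm _ _

theorem flips_read (γ : G.Edge → ZMod 2) :
    F.flips ((gaugingProcedure G s M a T b).atRound (readRound hb) (edgeLabels G γ)) 0 =
      (edgeX G fun e => F.meas (readRound hb) (.inr (.inl e))).comm (withZ G 0 γ) +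
        (∑ r, F.err r).comm (withZ G 0 γ) := by
  rw [Procedure.flips_atRound, sum_edgeLabels_op, edgeX_comm_withZ,
    ← errUpTo_add_errAfter F (a + T), Pauli.comm_add_left,
    comm_withZ_zero_of_inr (errAfter_inr_of_le F le_rfl) γ, add_zero]
  have h2 := sum_edgeLabels_smul G γ (F.meas (readRound hb))
  simp only [smul_eq_mul] at h2
  rw [h2]
  refine congrArg₂ (· + ·) ?_ rfl
  exact Finset.sum_congr rfl fun e _ => mul_comm _ _

theorem flips_deformed {τ : Fin (gaugingProcedure G s M a T b).rounds} (hτ : ∀ l, F.meas τ l = 0)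
    {f : G.Vert ⊕ G.Face ⊕ ι → ZMod 2} {X : Pauli (DefQubit G)}
    (hf : ∑ k, f k • deformedChecks G s M k = X) :
    F.flips ((gaugingProcedure G s M a T b).atRound τ (deformedLabels G f)) 0 =
      (errUpTo F τ).comm X := by
  rw [Procedure.flips_atRound, sum_deformedLabels_smul, Finset.sum_eq_zero, zero_add]
  · exact congrArg _ hf
  · intro l _; rw [hτ, mul_zero]

theorem sum_checkLabels_op {f : ι → ZMod 2} {P : Pauli Q} (hf : ∑ j, f j • s j = P) :
    ∑ l, checkLabels G f l • (gaugingProcedure G s M a T b).op l = withZ G P 0 := by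
  rw [sum_checkLabels_smul]
  funext q
  rcases q with q | e
  · rw [← hf]; simp [gaugingProcedure, extendOp, withZ]
  · simp [gaugingProcedure, extendOp, withZ]; rfl

theorem flips_last {f : ι → ZMod 2} {P : Pauli Q} (hf : ∑ j, f j • s j = P) :
    F.flips ((gaugingProcedure G s M a T b).atRound (lastRound hb) (checkLabels G f)) 0 =
      (∑ r, F.err r).comm (withZ G P 0) := by
  have h2 : ∀ j, F.meas (lastRound hb) (.inl j) = 0 := by
    intro j
    by_contra h
    have := (F.meas_noisy _ _ h).2.2
    apply this
    show a + T + b - 1 + 1 = _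
    omega
  have h3 : errUpTo F (lastRound hb : Fin (gaugingProcedure G s M a T b).rounds) = ∑ r, F.err r := by
    unfold errUpTo
    refine Finset.sum_congr rfl fun r _ => if_pos ?_
    have hr : (r : ℕ) < a + T + b := r.2
    show (r : ℕ) ≤ a + T + b - 1
    omega
  rw [Procedure.flips_atRound, sum_checkLabels_op hf]
  refine (congrArg₂ (· + ·) ?_ (congrArg (fun E => Pauli.comm E (withZ G P 0)) h3)).trans
    (zero_add _)
  have h4 := sum_checkLabels_smul G f (F.meas (lastRound hb))
  simp only [smul_eq_mul] at h4
  rw [h4]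
  exact Finset.sum_eq_zero fun j _ => by rw [h2, mul_zero]

end FaultDistance

section FaultDistance

variable {Q ι : Type*} [Fintype Q] [Fintype ι] {L : Pauli Q} {G : LayeredGraph L.support}
  {s : ι → Pauli Q} {M : ι → Finset (Sym2 L.support)} {a T b : ℕ}
  (ha : 0 < a) (hb : 0 < b)

theorem extendOp_zero : extendOp G (0 : Pauli Q) = 0 := by
  rw [extendOp_eq_withZ, withZ_zero]

theorem Procedure.measured_of_atRound_ne_zero {Q Λ : Type*} [Fintype Q] [Fintype Λ]
    {Pr : Procedure Q Λ} {r₀ : Fin Pr.rounds} {f : Λ → ZMod 2}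
    (h : ∀ l, f l ≠ 0 → Pr.measured r₀ l) (r : Fin Pr.rounds) (l : Λ)
    (hl : Pr.atRound r₀ f r l ≠ 0) : Pr.measured r l := by
  unfold Procedure.atRound at hl
  split_ifs at hl with hr
  · exact hr ▸ h l hl
  · exact absurd rfl hl

theorem Procedure.measured_of_add_ne_zero {Q Λ : Type*} [Fintype Q] [Fintype Λ]
    {Pr : Procedure Q Λ} {D D' : Fin Pr.rounds → Λ → ZMod 2}
    (h : ∀ r l, D r l ≠ 0 → Pr.measured r l) (h' : ∀ r l, D' r l ≠ 0 → Pr.measured r l)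
    (r : Fin Pr.rounds) (l : Λ) (hl : (D + D') r l ≠ 0) : Pr.measured r l := by
  by_cases h0 : D r l = 0
  · exact h' r l fun h1 => hl (by simp [h0, h1])
  · exact h r l h0

theorem measured_prep (γ : G.Edge → ZMod 2) (l) (hl : edgeLabels G γ l ≠ 0) :
    (gaugingProcedure G s M a T b).measured (prepRound ha) l := by
  rcases l with j | e | k
  · exact absurd rfl hl
  · left; show a - 1 + 1 = a; omega
  · exact absurd rfl hl

theorem measured_read (γ : G.Edge → ZMod 2) (l) (hl : edgeLabels G γ l ≠ 0) :
    (gaugingProcedure G s M a T b).measured (readRound hb) l := by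
  rcases l with j | e | k
  · exact absurd rfl hl
  · right; rfl
  · exact absurd rfl hl

theorem measured_last (f : ι → ZMod 2) (l) (hl : checkLabels G f l ≠ 0) :
    (gaugingProcedure G s M a T b).measured (lastRound hb) l := by
  rcases l with j | k
  · right; show a + T ≤ a + T + b - 1; omega
  · exact absurd rfl hl

theorem measured_deformed {τ : Fin (gaugingProcedure G s M a T b).rounds}
    (hτ : a ≤ (τ : ℕ) ∧ (τ : ℕ) < a + T) (f : G.Vert ⊕ G.Face ⊕ ι → ZMod 2) (l)
    (hl : deformedLabels G f l ≠ 0) : (gaugingProcedure G s M a T b).measured τ l := by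
  rcases l with j | e | k
  · exact absurd rfl hl
  · exact absurd rfl hl
  · exact hτ

/-- The collection of the preparations in `γ` and of the deformed checks in `f` in round `τ`. -/
noncomputable def pastRelation (τ : Fin (gaugingProcedure G s M a T b).rounds)
    (f : G.Vert ⊕ G.Face ⊕ ι → ZMod 2) (γ : G.Edge → ZMod 2) :=
  (gaugingProcedure G s M a T b).atRound τ (deformedLabels G f) +
    (gaugingProcedure G s M a T b).atRound (prepRound ha) (edgeLabels G γ)

/-- The collection of the deformed checks in `f` in round `τ`, of the readouts in `γ`, and of the
original checks in `g` in the last round. -/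
noncomputable def futureRelation (τ : Fin (gaugingProcedure G s M a T b).rounds)
    (f : G.Vert ⊕ G.Face ⊕ ι → ZMod 2) (γ : G.Edge → ZMod 2) (g : ι → ZMod 2) :=
  (gaugingProcedure G s M a T b).atRound τ (deformedLabels G f) +
    (gaugingProcedure G s M a T b).atRound (readRound hb) (edgeLabels G γ) +
    (gaugingProcedure G s M a T b).atRound (lastRound hb) (checkLabels G g)

/-- The collection of the preparations and the readouts in `γ`. -/
noncomputable def throughRelation (G : LayeredGraph L.support) (s : ι → Pauli Q)
    (M : ι → Finset (Sym2 L.support)) (T : ℕ) (ha : 0 < a) (hb : 0 < b) (γ : G.Edge → ZMod 2) :=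
  (gaugingProcedure G s M a T b).atRound (prepRound ha) (edgeLabels G γ) +
    (gaugingProcedure G s M a T b).atRound (readRound hb) (edgeLabels G γ)

section
variable {P : Pauli Q} {γ : G.Edge → ZMod 2} (hP : ∀ j, P.comm (s j) = 0)
  (hγ : IsGaussInvariant G P γ) {τ : Fin (gaugingProcedure G s M a T b).rounds}
  (hτ : a ≤ (τ : ℕ) ∧ (τ : ℕ) < a + T) {f : G.Vert ⊕ G.Face ⊕ ι → ZMod 2}
  (hf : ∑ k, f k • deformedChecks G s M k = withZ G P γ) {g : ι → ZMod 2}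
  (hg : ∑ j, g j • s j = P)

theorem backward_deformed (hf : ∑ k, f k • deformedChecks G s M k = withZ G P γ) (t : ℕ) :
    (gaugingProcedure G s M a T b).backward
      ((gaugingProcedure G s M a T b).atRound τ (deformedLabels G f)) 0 t =
      if t ≤ (τ : ℕ) then withZ G P γ else 0 := by
  rw [Procedure.backward_atRound, sum_deformedLabels_smul]
  exact congrArg (fun X => if t ≤ (τ : ℕ) then X else 0) hf

theorem backward_prep (γ : G.Edge → ZMod 2) (t : ℕ) :
    (gaugingProcedure G s M a T b).backward
      ((gaugingProcedure G s M a T b).atRound (prepRound ha) (edgeLabels G γ)) 0 t =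
      if t ≤ a - 1 then withZ G 0 γ else 0 := by
  rw [Procedure.backward_atRound, sum_edgeLabels_op]; rfl

theorem backward_read (γ : G.Edge → ZMod 2) (t : ℕ) :
    (gaugingProcedure G s M a T b).backward
      ((gaugingProcedure G s M a T b).atRound (readRound hb) (edgeLabels G γ)) 0 t =
      if t ≤ a + T then withZ G 0 γ else 0 := by
  rw [Procedure.backward_atRound, sum_edgeLabels_op]; rfl

theorem backward_last (hg : ∑ j, g j • s j = P) (t : ℕ) :
    (gaugingProcedure G s M a T b).backward
      ((gaugingProcedure G s M a T b).atRound (lastRound hb) (checkLabels G g)) 0 t =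
      if t ≤ a + T + b - 1 then withZ G P 0 else 0 := by
  rw [Procedure.backward_atRound, sum_checkLabels_op hg]; rfl

include hP hγ hτ hf in
/-- An operator that is measured in round `τ` of the deformed phase, that commutes with all checks, and
whose `Z` part on the edges is fixed by the preparation, has there the value that `P` had initially. -/
theorem isRelation_past :
    (gaugingProcedure G s M a T b).IsRelation (pastRelation ha τ f γ) (extendOp G P) 0 := by
  have hback : ∀ t, (gaugingProcedure G s M a T b).backward (pastRelation ha τ f γ)
      (extendOp G 0) t = (if t ≤ (τ : ℕ) then withZ G P γ else 0) +
        (if t ≤ a - 1 then withZ G 0 γ else 0) := by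
    intro t
    rw [pastRelation, extendOp_zero, Procedure.backward_add_left, backward_deformed hf,
      backward_prep]
  rw [← extendOp_zero (G := G)]
  refine isRelation_of_backward G hP hγ ?_ ?_ ?_ ?_
  · exact Procedure.measured_of_add_ne_zero
      (Procedure.measured_of_atRound_ne_zero (measured_deformed hτ f))
      (Procedure.measured_of_atRound_ne_zero (measured_prep ha γ))
  · intro t h1 h2
    rw [hback, if_neg (by omega : ¬ t + 1 ≤ a - 1), add_zero]
    split_ifs
    · exact Or.inr rfl
    · exact Or.inl rfl
  · intro t ht
    rw [hback]
    by_cases h1 : t < a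
    · rw [if_pos (by omega : t + 1 ≤ (τ : ℕ))]
      split_ifs
      · rw [withZ_add, chain_add_self, add_zero, extendOp_eq_withZ]
        exact Or.inr (Or.inr rfl)
      · rw [add_zero]; exact Or.inr (Or.inl rfl)
    · rw [if_neg (by omega), if_neg (by omega), add_zero]
      exact Or.inl rfl
  · rw [hback, if_pos (Nat.zero_le _), if_pos (Nat.zero_le _), withZ_add, chain_add_self,
      add_zero, extendOp_eq_withZ]

include hP hγ hτ hf hg in
/-- A product of checks that is measured in round `τ` of the deformed phase agrees, after the readout of
its edge qubits, with the value of the checks in the last round. -/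
theorem isRelation_future :
    (gaugingProcedure G s M a T b).IsRelation (futureRelation hb τ f γ g) 0 0 := by
  have hback : ∀ t, (gaugingProcedure G s M a T b).backward (futureRelation hb τ f γ g)
      (extendOp G 0) t = (if t ≤ (τ : ℕ) then withZ G P γ else 0) +
        (if t ≤ a + T then withZ G 0 γ else 0) +
        (if t ≤ a + T + b - 1 then withZ G P 0 else 0) := by
    intro t
    rw [futureRelation, extendOp_zero, Procedure.backward_add_left, Procedure.backward_add_left,
      backward_deformed hf, backward_read, backward_last hb hg]
  have hzero : withZ G P γ + withZ G 0 γ + withZ G P 0 = 0 := by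
    rw [withZ_add, withZ_add, chain_add_self, add_zero, add_zero, pauli_add_self, withZ_zero]
  rw [← extendOp_zero (G := G)]
  refine isRelation_of_backward G hP hγ ?_ ?_ ?_ ?_
  · exact Procedure.measured_of_add_ne_zero (Procedure.measured_of_add_ne_zero
      (Procedure.measured_of_atRound_ne_zero (measured_deformed hτ f))
      (Procedure.measured_of_atRound_ne_zero (measured_read hb γ)))
      (Procedure.measured_of_atRound_ne_zero (measured_last hb g))
  · intro t h1 h2
    rw [hback, if_pos (by omega : t + 1 ≤ a + T), if_pos (by omega : t + 1 ≤ a + T + b - 1)]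
    split_ifs
    · exact Or.inl hzero
    · rw [zero_add, withZ_add, zero_add, add_zero]; exact Or.inr rfl
  · intro t ht
    rw [hback]
    by_cases h1 : t < a
    · rw [if_pos (by omega : t + 1 ≤ (τ : ℕ)), if_pos (by omega), if_pos (by omega)]
      exact Or.inl hzero
    · rw [if_neg (by omega), if_neg (by omega), add_zero, zero_add]
      split_ifs
      · rw [extendOp_eq_withZ]; exact Or.inr (Or.inr rfl)
      · exact Or.inl rfl
  · rw [hback, if_pos (Nat.zero_le _), if_pos (Nat.zero_le _), if_pos (Nat.zero_le _), hzero,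
      extendOp_zero]

include hP hγ in
/-- An operator that becomes Gauss invariant with the chain `γ` passes through the procedure, up to the
preparations and the readouts of the edges in `γ`. -/
theorem isRelation_through :
    (gaugingProcedure G s M a T b).IsRelation (throughRelation G s M T ha hb γ)
      (extendOp G P) (extendOp G P) := by
  have hback : ∀ t, (gaugingProcedure G s M a T b).backward (throughRelation G s M T ha hb γ)
      (extendOp G P) t = extendOp G P + ((if t ≤ a - 1 then withZ G 0 γ else 0) +
        (if t ≤ a + T then withZ G 0 γ else 0)) := by
    intro t
    rw [throughRelation, Procedure.backward_eq_add, Procedure.backward_add_left, backward_prep,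
      backward_read]
  have hzero : withZ G 0 γ + withZ G 0 γ = 0 := pauli_add_self _
  refine isRelation_of_backward G hP hγ ?_ ?_ ?_ ?_
  · exact Procedure.measured_of_add_ne_zero
      (Procedure.measured_of_atRound_ne_zero (measured_prep ha γ))
      (Procedure.measured_of_atRound_ne_zero (measured_read hb γ))
  · intro t h1 h2
    rw [hback, if_neg (by omega : ¬ t + 1 ≤ a - 1), if_pos (by omega : t + 1 ≤ a + T), zero_add,
      extendOp_eq_withZ, withZ_add, add_zero, zero_add]
    exact Or.inr rfl
  · intro t ht
    rw [hback]
    by_cases h1 : t < a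
    · rw [if_pos (by omega : t + 1 ≤ a + T)]
      split_ifs
      · rw [hzero, add_zero]; exact Or.inr (Or.inr rfl)
      · rw [zero_add, extendOp_eq_withZ, withZ_add, add_zero, zero_add]; exact Or.inr (Or.inl rfl)
    · rw [if_neg (by omega), if_neg (by omega), add_zero, add_zero]
      exact Or.inr (Or.inr rfl)
  · rw [hback, if_pos (Nat.zero_le _), if_pos (Nat.zero_le _), hzero, add_zero]

variable (F : (gaugingProcedure G s M a T b).Fault)

theorem flips_past (hclean : ∀ l, F.meas τ l = 0)
    (hf : ∑ k, f k • deformedChecks G s M k = withZ G P γ) :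
    F.flips (pastRelation ha τ f γ) 0 = (pastError F ha τ).comm (withZ G P γ) := by
  rw [pastRelation, Procedure.flips_add_left, flips_deformed F hclean hf, flips_prep, pastError,
    Pauli.comm_add_left, edgeX_comm_withZ, edgeX_comm_withZ]

theorem flips_future (hclean : ∀ l, F.meas τ l = 0)
    (hf : ∑ k, f k • deformedChecks G s M k = withZ G P γ) (hg : ∑ j, g j • s j = P) :
    F.flips (futureRelation hb τ f γ g) 0 = (futureError F hb τ).comm (withZ G P γ) := by
  have h1 : (∑ r, F.err r).comm (withZ G 0 γ) + (∑ r, F.err r).comm (withZ G P 0) =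
      (errUpTo F τ).comm (withZ G P γ) + (errAfter F τ).comm (withZ G P γ) := by
    rw [← Pauli.comm_add_right, withZ_add, zero_add, add_zero, ← errUpTo_add_errAfter F τ,
      Pauli.comm_add_left]
  rw [futureRelation, Procedure.flips_add_left, Procedure.flips_add_left,
    flips_deformed F hclean hf, flips_read, flips_last F hb hg, futureError, Pauli.comm_add_left,
    edgeX_comm_withZ, edgeX_comm_withZ]
  linear_combination h1 + CharTwo.add_self_eq_zero ((errUpTo F τ).comm (withZ G P γ))

theorem flips_through (t : ℕ) :
    F.flips (throughRelation G s M T ha hb γ) (extendOp G P) =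
      (pastError F ha t).comm (withZ G P γ) + (futureError F hb t).comm (withZ G P γ) := by
  rw [Procedure.flips_eq_add, Procedure.flips_zero_left, throughRelation,
    Procedure.flips_add_left, flips_prep, flips_read, pastError, futureError,
    Pauli.comm_add_left (errUpTo F t), Pauli.comm_add_left (errAfter F t), edgeX_comm_withZ,
    edgeX_comm_withZ, edgeX_comm_withZ, edgeX_comm_withZ]
  have h1 : (∑ r, F.err r).comm (extendOp G P) + (∑ r, F.err r).comm (withZ G 0 γ) =
      (errUpTo F t).comm (withZ G P γ) + (errAfter F t).comm (withZ G P γ) := by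
    rw [← Pauli.comm_add_right, extendOp_eq_withZ, withZ_add, zero_add, add_zero,
      ← errUpTo_add_errAfter F t, Pauli.comm_add_left]
  linear_combination h1

end
end FaultDistance

section FaultDistance

variable {Q ι : Type*} [Fintype Q] [Fintype ι] {L : Pauli Q} {G : LayeredGraph L.support}
  {s : ι → Pauli Q} {M : ι → Finset (Sym2 L.support)} {a T b : ℕ}

/-- `withZ` as a linear map. -/
noncomputable def withZLinear (G : LayeredGraph L.support) :
    (Pauli Q × (G.Edge → ZMod 2)) →ₗ[ZMod 2] Pauli (DefQubit G) where
  toFun x := withZ G x.1 x.2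
  map_add' x y := (withZ_add G _ _ _ _).symm
  map_smul' c x := by
    funext q
    rcases q with q | e
    · rfl
    · exact Prod.ext (mul_zero _).symm rfl

theorem span_inputChecks (G : LayeredGraph L.support) (s : ι → Pauli Q)
    (M : ι → Finset (Sym2 L.support)) (a T b : ℕ) :
    Submodule.span (ZMod 2) (gaugingProcedure G s M a T b).inputChecks =
      (stabilizer s).map ((withZLinear G).comp (LinearMap.inl _ _ _)) := by
  rw [stabilizer, Submodule.map_span, ← Set.range_comp]
  exact congrArg (fun f => Submodule.span (ZMod 2) (Set.range f))
    (funext fun j => extendOp_eq_withZ G (s j))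

theorem mem_span_inputChecks {X : Pauli (DefQubit G)} :
    X ∈ Submodule.span (ZMod 2) (gaugingProcedure G s M a T b).inputChecks ↔
      ∃ g ∈ stabilizer s, X = extendOp G g := by
  rw [span_inputChecks, Submodule.mem_map]
  constructor
  · rintro ⟨g, hg, rfl⟩
    exact ⟨g, hg, (extendOp_eq_withZ G g).symm⟩
  · rintro ⟨g, hg, rfl⟩
    exact ⟨g, hg, (extendOp_eq_withZ G g).symm⟩

/-- A relation without final operator relates the measurement results to a product of checks and a
power of the measured operator; the exponent is the number, modulo two, of times that each Gauss law
operator is contained in the relation. -/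
theorem exists_input_of_isRelation (hG : G.graph.Connected)
    {D : Fin (gaugingProcedure G s M a T b).rounds → ι ⊕ G.Edge ⊕ (G.Vert ⊕ G.Face ⊕ ι) → ZMod 2}
    {i : Pauli (DefQubit G)} (hD : (gaugingProcedure G s M a T b).IsRelation D i 0) :
    ∃ c : ZMod 2, ∃ g ∈ stabilizer s, i = extendOp G (g + c • L) ∧
      ∀ v, ∑ r, D r (.inr (.inr (.inl v))) = c := by
  let n : ι ⊕ G.Edge ⊕ (G.Vert ⊕ G.Face ⊕ ι) → ZMod 2 := fun l => ∑ r, D r l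
  let W : Submodule (ZMod 2) (Pauli (DefQubit G)) :=
    ((stabilizer s).prod ⊤).map (withZLinear G)
  have hW : ∀ {g : Pauli Q} (γ), g ∈ stabilizer s → withZ G g γ ∈ W := fun γ hg =>
    ⟨(_, γ), ⟨hg, trivial⟩, rfl⟩
  have hs : ∀ j, s j ∈ stabilizer s := fun j => Submodule.subset_span ⟨j, rfl⟩
  have hi : i = ∑ l, n l • (gaugingProcedure G s M a T b).op l := by
    rw [← hD.backward_zero, Procedure.backward_eq_add_sum, zero_add]
  have hsplit : i + ∑ v, n (.inr (.inr (.inl v))) • gaussOp G v ∈ W := by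
    rw [hi]
    rw [Fintype.sum_sum_type, Fintype.sum_sum_type, Fintype.sum_sum_type, Fintype.sum_sum_type]
    have h1 : ∀ A B C D' E : Pauli (DefQubit G), A + (B + (C + (D' + E))) + C =
        A + (B + (D' + E)) := by
      intro A B C D' E
      calc _ = A + (B + (D' + E)) + (C + C) := by abel
        _ = _ := by rw [pauli_add_self, add_zero]
    refine (h1 _ _ _ _ _).symm ▸ ?_
    refine W.add_mem (W.sum_mem fun j _ => W.smul_mem _ ?_) (W.add_mem
      (W.sum_mem fun e _ => W.smul_mem _ ?_) (W.add_mem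
      (W.sum_mem fun p _ => W.smul_mem _ ?_) (W.sum_mem fun j _ => W.smul_mem _ ?_)))
    · show extendOp G (s j) ∈ W
      rw [extendOp_eq_withZ G (s j)]; exact hW 0 (hs j)
    · show edgeZ G e ∈ W
      rw [edgeZ_eq_withZ G e]; exact hW _ (zero_mem _)
    · show fluxOp G p ∈ W
      rw [fluxOp_eq_withZ G p]; exact hW _ (zero_mem _)
    · show deform G (s j) (M j) ∈ W
      rw [deform_eq_withZ G (s j) (M j)]; exact hW _ (hs j)
  obtain ⟨⟨g, γ⟩, ⟨hg, -⟩, hgγ⟩ := hsplit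
  have hi' : i = withZ G g γ + ∑ v, n (.inr (.inr (.inl v))) • gaussOp G v := by
    have : withZ G g γ = i + ∑ v, n (.inr (.inr (.inl v))) • gaussOp G v := hgγ
    rw [this, add_assoc, pauli_add_self, add_zero]
  have haux : ∀ e, i (.inr e) = 0 := fun e => hD.input_aux (.inr e) trivial
  -- edge qubits do not occur in the input, so adjacent Gauss law operators occur equally often
  have hconst : ∀ u v, G.graph.Adj u v → n (.inr (.inr (.inl u))) = n (.inr (.inr (.inl v))) := by
    intro u v huv
    have h1 := haux ⟨s(u, v), huv⟩
    rw [hi', Pi.add_apply, sum_gaussOp_apply_inr G (fun v => n (.inr (.inr (.inl v))))] at h1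
    have h2 := (sum_endpoints huv.ne fun v => n (.inr (.inr (.inl v)))).symm.trans
      ((zero_add _).symm.trans (congrArg Prod.fst h1))
    exact CharTwo.add_eq_zero.1 h2
  obtain ⟨v₀⟩ := hG.nonempty
  have hc := fun v => eq_of_connected hG hconst v v₀
  refine ⟨n (.inr (.inr (.inl v₀))), g, hg, ?_, hc⟩
  have hi'' : i = withZ G (g + n (.inr (.inr (.inl v₀))) • L) γ := by
    rw [hi']
    simp only [hc, ← Finset.smul_sum, sum_gaussOp]
    funext q
    rcases q with q | e
    · rfl
    · simp only [Pi.add_apply, Pi.smul_apply, extendOp, withZ, smul_zero, add_zero]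
  have hγ : γ = 0 := by
    funext e
    have := haux e
    rw [hi''] at this
    exact congrArg Prod.snd this
  rw [hi'', hγ, extendOp_eq_withZ]

/-- Fewer than `T` faults leave a round of the deformed phase without measurement faults. -/
theorem exists_clean_round (F : (gaugingProcedure G s M a T b).Fault) (hF : F.weight < T) :
    ∃ τ : Fin (gaugingProcedure G s M a T b).rounds, (a ≤ (τ : ℕ) ∧ (τ : ℕ) < a + T) ∧
      ∀ l, F.meas τ l = 0 := by
  by_contra hcon
  push Not at hcon
  have h1 : T ≤ (Finset.univ.filter fun r : Fin (gaugingProcedure G s M a T b).rounds =>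
      ∃ l, F.meas r l ≠ 0).card := by
    have h0 := Finset.card_le_card_of_injOn (s := (Finset.univ : Finset (Fin T)))
      (t := Finset.univ.filter fun r : Fin (gaugingProcedure G s M a T b).rounds =>
        ∃ l, F.meas r l ≠ 0)
      (fun i => ⟨a + i, show a + (i : ℕ) < a + T + b by omega⟩) (fun i _ => by
        simp only [Finset.coe_filter, Finset.mem_univ, true_and]
        exact hcon ⟨a + i, show a + (i : ℕ) < a + T + b by omega⟩
          ⟨Nat.le_add_right _ _, by show a + (i : ℕ) < _; omega⟩)
      (fun i _ j _ h => by
        have : a + (i : ℕ) = a + (j : ℕ) := congrArg Fin.val h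
        exact Fin.ext (by omega))
    rwa [Finset.card_univ, Fintype.card_fin] at h0
  have h2 : (Finset.univ.filter fun r : Fin (gaugingProcedure G s M a T b).rounds =>
      ∃ l, F.meas r l ≠ 0).card ≤
      ∑ r, (Finset.univ.filter fun l => F.meas r l ≠ 0).card := by
    rw [Finset.card_eq_sum_ones]
    refine (Finset.sum_le_sum fun r hr => ?_).trans
      (Finset.sum_le_sum_of_subset (Finset.filter_subset _ _))
    obtain ⟨l, hl⟩ := (Finset.mem_filter.1 hr).2
    exact Finset.card_pos.2 ⟨l, by simpa using hl⟩
  have h3 : ∑ r, (Finset.univ.filter fun l => F.meas r l ≠ 0).card ≤ F.weight :=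
    Nat.le_add_left _ _
  omega

theorem backward_of_rounds_le {Q Λ : Type*} [Fintype Q] [Fintype Λ] {Pr : Procedure Q Λ}
    (D : Fin Pr.rounds → Λ → ZMod 2) (o : Pauli Q) {t : ℕ} (ht : Pr.rounds ≤ t) :
    Pr.backward D o t = o := by
  unfold Procedure.backward
  rw [Finset.sum_eq_zero, add_zero]
  intro r _
  rw [if_neg (by omega)]

theorem sum_single_deformedChecks (k : G.Vert ⊕ G.Face ⊕ ι) :
    ∑ k', (Pi.single k 1 : G.Vert ⊕ G.Face ⊕ ι → ZMod 2) k' • deformedChecks G s M k' =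
      deformedChecks G s M k := by
  rw [Finset.sum_eq_single k]
  · rw [Pi.single_eq_same, one_smul]
  · intro k' _ hk; rw [Pi.single_eq_of_ne hk, zero_smul]
  · simp

/-- The coefficients of the relation that infers the measured operator from the Gauss law operators. -/
def gaussLabels (G : LayeredGraph L.support) (ι : Type*) : G.Vert ⊕ G.Face ⊕ ι → ZMod 2
  | .inl _ => 1
  | .inr _ => 0

theorem sum_gaussLabels :
    ∑ k, gaussLabels G ι k • deformedChecks G s M k = withZ G L 0 := by
  rw [← extendOp_eq_withZ, ← sum_gaussOp]
  simp [Fintype.sum_sum_type, gaussLabels, deformedChecks]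

/-- An operator that commutes with the measured operator is Gauss invariant together with a suitable
set of edges. -/
theorem exists_isGaussInvariant (hG : G.graph.Connected) {P : Pauli Q} (hPL : L.comm P = 0) :
    ∃ γ, IsGaussInvariant G P γ := by
  obtain ⟨γ, hγ⟩ := exists_boundary_eq hG
    (fun v : G.Vert => if v.1 = 0 then siteComm (L v.2) (P v.2) else 0) (by
      rw [Fintype.sum_prod_type, Finset.sum_eq_single 0]
      · simp only [if_true]
        rw [Finset.sum_coe_sort L.support fun q => siteComm (L q) (P q), ← hPL, Pauli.comm]
        refine Finset.sum_subset (Finset.subset_univ _) fun q _ hq => ?_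
        rw [Pauli.mem_support, not_not] at hq
        rw [hq]; simp [siteComm]
      · intro i _ hi
        exact Finset.sum_eq_zero fun v _ => if_neg hi
      · simp)
  exact ⟨γ, fun v => congrFun hγ v⟩

variable (hG : G.graph.Connected) (hs : IsStabilizerCode s) {d : ℕ} (hd : HasDistance s d)
  (hL : IsLogical s L)
  (hC : ∀ S : Finset L.support, 2 * S.card ≤ Fintype.card L.support →
    S.card ≤ (G.base.interedges S Sᶜ).card)
  (hX : IsFluxExact G.graph G.faceEdges)
  (hB : ∀ p, boundary G.graph (edgeIndicator G (G.faceEdges p)) = 0)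
  (hM : ∀ j, IsGaussInvariant G (s j) (layerZeroChain G (M j)))

include hG hs hd hL hC hX hB hM in
/-- The lower bound on the fault distance. Some round of the deformed phase is free of measurement
faults. The errors before it and the errors after it violate no deformed check and no flux, so both
can be cleaned; the cleaned errors commute with the operators in all relations. -/
theorem isStabilizer_of_weight_lt (had : d ≤ a) (hTd : d ≤ T) (hbd : d ≤ b)
    (F : (gaugingProcedure G s M a T b).Fault) (hF : F.IsLogicalFault) (hw : F.weight < d) :
    F.IsStabilizer := by
  have ha : 0 < a := hd.pos.trans_le had
  have hb : 0 < b := hd.pos.trans_le hbd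
  obtain ⟨τ, hτ, hclean⟩ := exists_clean_round F (hw.trans_le hTd)
  have hcheck : ∀ j, (∑ k', (Pi.single (.inr (.inr j)) 1 : G.Vert ⊕ G.Face ⊕ ι → ZMod 2) k' •
      deformedChecks G s M k') = withZ G (s j) (layerZeroChain G (M j)) := fun j => by
    rw [sum_single_deformedChecks]; exact deform_eq_withZ G (s j) (M j)
  have hflux : ∀ p, (∑ k', (Pi.single (.inr (.inl p)) 1 : G.Vert ⊕ G.Face ⊕ ι → ZMod 2) k' •
      deformedChecks G s M k') = withZ G 0 (edgeIndicator G (G.faceEdges p)) := fun p => by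
    rw [sum_single_deformedChecks]; exact fluxOp_eq_withZ G p
  have hs' : ∀ i j, (s i).comm (s j) = 0 := hs
  have h0s : ∀ j, Pauli.comm 0 (s j) = 0 := fun j => Pauli.comm_zero_left _
  obtain ⟨φ₁, g₁, hg₁, γ₁, hE₁⟩ := exists_cleaning G hd hC hX hM (E := pastError F ha τ)
    (fun j => by
      rw [deform_eq_withZ, ← flips_past ha F hclean (hcheck j)]
      exact hF _ ⟨_, mem_span_inputChecks.2 ⟨_, Submodule.subset_span ⟨j, rfl⟩, rfl⟩,
        isRelation_past ha (hs' j) (hM j) hτ (hcheck j)⟩)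
    (fun p => by
      rw [fluxOp_eq_withZ, ← flips_past ha F hclean (hflux p)]
      exact hF _ ⟨_, mem_span_inputChecks.2 ⟨_, zero_mem _, rfl⟩,
        isRelation_past ha h0s (isGaussInvariant_flux G (hB p)) hτ (hflux p)⟩)
    ((weight_pastError_le F ha τ).trans_lt hw)
  obtain ⟨φ₂, g₂, hg₂, γ₂, hE₂⟩ := exists_cleaning G hd hC hX hM (E := futureError F hb τ)
    (fun j => by
      have hg : ∑ j', (Pi.single j 1 : ι → ZMod 2) j' • s j' = s j := by
        rw [Finset.sum_eq_single j]
        · rw [Pi.single_eq_same, one_smul]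
        · intro k' _ hk; rw [Pi.single_eq_of_ne hk, zero_smul]
        · simp
      rw [deform_eq_withZ, ← flips_future hb F hclean (hcheck j) hg]
      exact hF _ ⟨0, zero_mem _, isRelation_future hb (hs' j) (hM j) hτ (hcheck j) hg⟩)
    (fun p => by
      have hg : ∑ j', (0 : ι → ZMod 2) j' • s j' = 0 := by simp
      rw [fluxOp_eq_withZ, ← flips_future hb F hclean (hflux p) hg]
      exact hF _ ⟨0, zero_mem _,
        isRelation_future hb h0s (isGaussInvariant_flux G (hB p)) hτ (hflux p) hg⟩)
    ((weight_futureError_le F hb τ).trans_lt hw)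
  -- relations without final operator: detectors, possibly times the inferred value of `L`
  have hzero : ∀ D i, (gaugingProcedure G s M a T b).IsRelation D i 0 → F.flips D 0 = 0 := by
    intro D i hD
    obtain ⟨c, g, hg, rfl, -⟩ := exists_input_of_isRelation hG hD
    by_cases hc : c = 0
    · refine hF D ⟨_, mem_span_inputChecks.2 ⟨g, hg, ?_⟩, hD⟩
      rw [hc, zero_smul, add_zero]
    · have hc1 : c = 1 := zmod_two_eq_one hc
      -- adding the relation that infers `L` makes it a detector
      have hρ := isRelation_past (a := a) (T := T) (b := b) ha hL.1 (isGaussInvariant_self G) hτ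
        (sum_gaussLabels (s := s) (M := M))
      have hsum := hD.add hρ
      rw [add_zero] at hsum
      have h1 := hF _ ⟨_, mem_span_inputChecks.2 ⟨g, hg, by
        rw [hc1, one_smul, extendOp_eq_withZ, extendOp_eq_withZ, withZ_add, add_assoc,
          pauli_add_self, add_zero, add_zero, extendOp_eq_withZ]⟩, hsum⟩
      rw [Procedure.flips_add_left, flips_past ha F hclean sum_gaussLabels, hE₁,
        comm_withZ_of_cleaning G hg₁ hL.1 (isGaussInvariant_self G), add_zero] at h1
      exact h1
  refine ⟨hF, fun D i o hD => ?_⟩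
  have ho : o = extendOp G fun q => o (.inl q) := by
    funext q
    rcases q with q | e
    · rfl
    · exact hD.output_aux (.inr e) trivial
  obtain ⟨P, rfl⟩ : ∃ P : Pauli Q, o = extendOp G P := ⟨_, ho⟩
  have hP : ∀ j, P.comm (s j) = 0 := by
    intro j
    have h1 := hD.commutes (lastRound hb) (.inl j) (Or.inr (show a + T ≤ a + T + b - 1 by omega))
    rw [backward_of_rounds_le _ _ (show a + T + b ≤ a + T + b - 1 + 1 by omega)] at h1
    have h2 : (extendOp G (s j)).comm (extendOp G P) = 0 := h1
    rwa [extendOp_eq_withZ, extendOp_eq_withZ, withZ_comm_withZ, Pauli.comm_symm] at h2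
  -- the Gauss law operators, whose product is `L`, are measured in round `τ`
  have hPL : L.comm P = 0 := by
    have h1 : (extendOp G L).comm ((gaugingProcedure G s M a T b).backward D (extendOp G P)
        (τ + 1)) = 0 := by
      rw [← sum_gaussOp, Pauli.comm_sum_left]
      exact Finset.sum_eq_zero fun v _ => hD.commutes τ (.inr (.inr (.inl v))) hτ
    rw [Procedure.backward, Pauli.comm_add_right, Pauli.comm_sum_right, Finset.sum_eq_zero,
      add_zero, extendOp_eq_withZ, extendOp_eq_withZ, withZ_comm_withZ] at h1
    · exact h1
    · intro r _
      split_ifs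
      · rw [Pauli.comm_sum_right]
        refine Finset.sum_eq_zero fun l _ => ?_
        rw [Pauli.comm_smul_right, Pauli.comm_symm, extendOp_eq_withZ,
          op_comm_withZ G hL.1 (isGaussInvariant_self G), mul_zero]
      · exact Pauli.comm_zero_right _
  obtain ⟨γ, hγ⟩ := exists_isGaussInvariant hG hPL
  -- subtracting a relation with the same final operator leaves one without final operator
  have hthrough := isRelation_through (T := T) (M := M) ha hb hP hγ
  have h1 := hzero _ _ (by
    have := hD.add hthrough
    rwa [pauli_add_self (extendOp G P)] at this)
  have h2 : F.flips (D + throughRelation G s M T ha hb γ) (extendOp G P + extendOp G P) =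
      F.flips D (extendOp G P) + F.flips (throughRelation G s M T ha hb γ) (extendOp G P) :=
    Procedure.flips_add F _ _ _ _
  rw [pauli_add_self (extendOp G P), h1, flips_through ha hb F τ, hE₁, hE₂,
    comm_withZ_of_cleaning G hg₁ hP hγ, comm_withZ_of_cleaning G hg₂ hP hγ, add_zero,
    add_zero] at h2
  exact h2.symm

/-- The fault that inverts all measurements of a single Gauss law operator. -/
noncomputable def timelikeFault (G : LayeredGraph L.support) (s : ι → Pauli Q)
    (M : ι → Finset (Sym2 L.support)) (a T b : ℕ) (v : G.Vert) :
    (gaugingProcedure G s M a T b).Fault where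
  meas r l := if (a ≤ (r : ℕ) ∧ (r : ℕ) < a + T) ∧ l = .inr (.inr (.inl v)) then 1 else 0
  err _ := 0
  meas_noisy r l h := by
    split_ifs at h with h'
    · rw [h'.2]; exact h'.1
    · exact absurd rfl h
  err_noisy r q h := absurd rfl h

theorem weight_timelikeFault (v : G.Vert) : (timelikeFault G s M a T b v).weight = T := by
  have h1 : ∀ r : Fin (gaugingProcedure G s M a T b).rounds, (Finset.univ.filter fun l =>
      (timelikeFault G s M a T b v).meas r l ≠ 0).card =
      if a ≤ (r : ℕ) ∧ (r : ℕ) < a + T then 1 else 0 := by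
    intro r
    split_ifs with hr
    · rw [Finset.card_eq_one]
      refine ⟨.inr (.inr (.inl v)), ?_⟩
      ext l
      simp [timelikeFault, hr]
    · rw [Finset.card_eq_zero, Finset.filter_eq_empty_iff]
      intro l _
      simp [timelikeFault, hr]
  rw [Procedure.Fault.weight, Finset.sum_eq_zero, zero_add, Finset.sum_congr rfl fun r _ => h1 r]
  · rw [← Finset.card_filter]
    have h2 : (Finset.univ.filter fun r : Fin (a + T + b) => a ≤ (r : ℕ) ∧ (r : ℕ) < a + T) =
        Finset.univ.map ⟨fun i : Fin T => (⟨a + i, by omega⟩ : Fin (a + T + b)), fun i j h => by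
          have : a + (i : ℕ) = a + (j : ℕ) := congrArg Fin.val h
          exact Fin.ext (by omega)⟩ := by
      ext r
      rw [Finset.mem_filter, Finset.mem_map]
      constructor
      · intro hr
        refine ⟨⟨r - a, by omega⟩, Finset.mem_univ _, Fin.ext ?_⟩
        show a + ((r : ℕ) - a) = r
        omega
      · rintro ⟨i, -, rfl⟩
        refine ⟨Finset.mem_univ _, Nat.le_add_right a i, ?_⟩
        show a + (i : ℕ) < a + T
        omega
    refine (congrArg Finset.card h2).trans ?_
    rw [Finset.card_map, Finset.card_univ, Fintype.card_fin]
  · intro r _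
    exact Pauli.weight_zero

theorem flips_timelikeFault (v : G.Vert)
    {D : Fin (gaugingProcedure G s M a T b).rounds → ι ⊕ G.Edge ⊕ (G.Vert ⊕ G.Face ⊕ ι) → ZMod 2}
    {i o : Pauli (DefQubit G)} (hD : (gaugingProcedure G s M a T b).IsRelation D i o) :
    (timelikeFault G s M a T b v).flips D o = ∑ r, D r (.inr (.inr (.inl v))) := by
  rw [Procedure.Fault.flips]
  have h1 : ∀ r, (timelikeFault G s M a T b v).err r = 0 := fun r => rfl
  simp only [h1, Pauli.comm_zero_left, Finset.sum_const_zero, add_zero]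
  refine Finset.sum_congr rfl fun r _ => ?_
  rw [Finset.sum_eq_single (.inr (.inr (.inl v)))]
  · by_cases h : D r (.inr (.inr (.inl v))) = 0
    · rw [h, zero_mul]
    · have hr : a ≤ (r : ℕ) ∧ (r : ℕ) < a + T := hD.measured r _ h
      simp [timelikeFault, hr]
  · intro l _ hl
    simp [timelikeFault, hl]
  · simp

include hG hL in
/-- Inverting all measurements of one Gauss law operator changes the inferred value of the measured
operator and violates no detector. -/
theorem mem_logicalFaultWeights (ha : 0 < a) (hT : 0 < T) :
    T ∈ (gaugingProcedure G s M a T b).logicalFaultWeights := by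
  obtain ⟨v⟩ := hG.nonempty
  refine ⟨timelikeFault G s M a T b v, ?_, ?_, weight_timelikeFault v⟩
  · rintro D ⟨i, hi, hD⟩
    rw [flips_timelikeFault v hD]
    obtain ⟨c, g, hg, h1, h2⟩ := exists_input_of_isRelation hG hD
    rw [h2]
    by_contra hc
    obtain ⟨g', hg', h3⟩ := mem_span_inputChecks.1 hi
    have h4 : g + c • L = g' := funext fun q => congrFun (h1.symm.trans h3) (.inl q)
    rw [zmod_two_eq_one hc, one_smul] at h4
    apply hL.2
    rw [← add_sub_cancel_left g L, h4]
    exact sub_mem hg' hg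
  · intro h
    have hτ : a ≤ ((⟨a, show a < a + T + b by omega⟩ :
        Fin (gaugingProcedure G s M a T b).rounds) : ℕ) ∧
        ((⟨a, show a < a + T + b by omega⟩ :
          Fin (gaugingProcedure G s M a T b).rounds) : ℕ) < a + T := by
      simp only; omega
    have hρ := isRelation_past ha hL.1 (isGaussInvariant_self G) hτ
      (sum_gaussLabels (s := s) (M := M))
    have h1 := h.2 _ _ _ hρ
    rw [flips_timelikeFault v hρ, Finset.sum_eq_single ⟨a, show a < a + T + b by omega⟩] at h1
    · revert h1
      simp [pastRelation, Procedure.atRound, deformedLabels, edgeLabels, gaussLabels]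
    · intro r _ hr
      simp [pastRelation, Procedure.atRound, edgeLabels, hr]
    · simp

end FaultDistance

/-! ### Expander graphs -/

section Expander

variable {V : Type*} [Fintype V]

/-- The permutations that map `Z` into `T`. -/
noncomputable def permsInto (Z T : Finset V) : Finset (Equiv.Perm V) :=
  Finset.univ.filter fun π => ∀ v ∈ Z, π v ∈ T

theorem exists_perm_map_eq {U U' : Finset V} (h : U.card = U'.card) :
    ∃ σ : Equiv.Perm V, U.map σ.toEmbedding = U' := by
  let e : {x // x ∈ U} ≃ {x // x ∈ U'} := Finset.equivOfCardEq h
  refine ⟨e.extendSubtype, Finset.eq_of_subset_of_card_le ?_ (by rw [Finset.card_map, h])⟩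
  intro x hx
  rw [Finset.mem_map] at hx
  obtain ⟨y, hy, rfl⟩ := hx
  exact e.extendSubtype_mem y hy

/-- All subsets of the same size are equally likely to be the image of `Z`, so the number of permutations
that map `Z` into `T` is proportional to the number of subsets of `T` of the size of `Z`. -/
theorem card_permsInto_eq (Z : Finset V) : ∃ c, ∀ T : Finset V,
    (permsInto Z T).card = T.card.choose Z.card * c := by
  refine ⟨(Finset.univ.filter fun π : Equiv.Perm V => Z.map π.toEmbedding = Z).card, fun T => ?_⟩
  have h1 : permsInto Z T = (T.powersetCard Z.card).biUnion fun U =>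
      Finset.univ.filter fun π : Equiv.Perm V => Z.map π.toEmbedding = U := by
    ext π
    simp only [permsInto, Finset.mem_filter, Finset.mem_univ, true_and, Finset.mem_biUnion,
      Finset.mem_powersetCard, exists_eq_right', Finset.card_map, and_true]
    constructor
    · intro h x hx
      rw [Finset.mem_map] at hx
      obtain ⟨y, hy, rfl⟩ := hx
      exact h y hy
    · intro h v hv
      exact h (Finset.mem_map_of_mem _ hv)
  rw [h1, Finset.card_biUnion, Finset.sum_const_nat, Finset.card_powersetCard]
  · intro U hU
    obtain ⟨σ, hσ⟩ := exists_perm_map_eq (Finset.mem_powersetCard.1 hU).2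
    -- composition with a permutation that maps `Z` onto `U`
    refine Finset.card_bij (fun π _ => σ * π) ?_ ?_ ?_
    · intro π hπ
      rw [Finset.mem_filter] at hπ ⊢
      refine ⟨Finset.mem_univ _, ?_⟩
      have : Z.map (σ * π).toEmbedding = (Z.map π.toEmbedding).map σ.toEmbedding := by
        rw [Finset.map_map]; rfl
      rw [this, hπ.2, hσ]
    · intro π _ π' _ h
      exact mul_left_cancel h
    · intro π hπ
      rw [Finset.mem_filter] at hπ
      refine ⟨σ⁻¹ * π, ?_, by simp⟩
      rw [Finset.mem_filter]
      refine ⟨Finset.mem_univ _, ?_⟩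
      have : Z.map (σ⁻¹ * π).toEmbedding = (Z.map π.toEmbedding).map (σ⁻¹).toEmbedding := by
        rw [Finset.map_map]; rfl
      rw [this, hπ.2, ← hσ, Finset.map_map]
      convert Finset.map_refl
      ext x
      simp
  · intro U _ U' _ hUU'
    rw [Function.onFun, Finset.disjoint_left]
    intro π h h'
    exact hUU' ((Finset.mem_filter.1 h).2.symm.trans (Finset.mem_filter.1 h').2)

theorem descFactorial_mul_pow_le {t n : ℕ} (h : t ≤ n) (z : ℕ) :
    t.descFactorial z * n ^ z ≤ t ^ z * n.descFactorial z := by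
  induction z with
  | zero => simp
  | succ z ih =>
    rw [Nat.descFactorial_succ, Nat.descFactorial_succ, pow_succ, pow_succ]
    have h1 : (t - z) * n ≤ t * (n - z) := by
      rw [Nat.sub_mul, Nat.mul_sub]
      have : t * z ≤ z * n := by rw [mul_comm]; exact Nat.mul_le_mul_left _ h
      omega
    calc (t - z) * t.descFactorial z * (n ^ z * n)
        = (t.descFactorial z * n ^ z) * ((t - z) * n) := by ring
      _ ≤ (t ^ z * n.descFactorial z) * (t * (n - z)) := Nat.mul_le_mul ih h1
      _ = _ := by ring

theorem choose_mul_pow_le {t n : ℕ} (h : t ≤ n) (z : ℕ) :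
    t.choose z * n ^ z ≤ t ^ z * n.choose z := by
  have h1 := descFactorial_mul_pow_le h z
  rw [Nat.descFactorial_eq_factorial_mul_choose, Nat.descFactorial_eq_factorial_mul_choose] at h1
  refine Nat.le_of_mul_le_mul_left ?_ (Nat.factorial_pos z)
  calc _ = z.factorial * t.choose z * n ^ z := by ring
    _ ≤ _ := h1
    _ = _ := by ring

/-- A random permutation maps `Z` into `T` with probability at most `(|T| / |V|) ^ |Z|`. -/
theorem card_permsInto_le {Z T : Finset V}
    (hV : 0 < Fintype.card V) :
    ((permsInto Z T).card : ℝ) ≤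
      ((T.card : ℝ) / Fintype.card V) ^ Z.card * (Fintype.card V).factorial := by
  obtain ⟨c, hc⟩ := card_permsInto_eq Z
  have h1 : (Fintype.card V).factorial = (Fintype.card V).choose Z.card * c := by
    rw [← Finset.card_univ, ← hc, Finset.card_univ, ← Fintype.card_perm, permsInto]
    simp [Finset.card_univ]
  rw [hc, h1]
  have h2 := choose_mul_pow_le (Finset.card_le_univ T) Z.card
  have h3 : (T.card.choose Z.card : ℝ) * (Fintype.card V : ℝ) ^ Z.card ≤
      (T.card : ℝ) ^ Z.card * (Fintype.card V).choose Z.card := by exact_mod_cast h2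
  have hn : (0 : ℝ) < (Fintype.card V : ℝ) ^ Z.card := by positivity
  push_cast
  rw [div_pow, ← mul_assoc]
  refine mul_le_mul_of_nonneg_right ?_ (Nat.cast_nonneg _)
  rw [div_mul_eq_mul_div, le_div_iff₀ hn]
  exact h3

theorem choose_le_three_mul_div_pow (n : ℕ) {z : ℕ} (hz : 0 < z) :
    (n.choose z : ℝ) ≤ (3 * n / z) ^ z := by
  have h1 : (n.choose z : ℝ) ≤ (n : ℝ) ^ z / z.factorial := Nat.choose_le_pow_div z n
  have h2 := Real.pow_div_factorial_le_exp (z : ℝ) (Nat.cast_nonneg z) z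
  have h3 : Real.exp z ≤ 3 ^ z := by
    rw [← Real.exp_one_pow]
    exact pow_le_pow_left₀ (Real.exp_pos _).le (by linarith [Real.exp_one_lt_d9]) _
  have hz' : (0 : ℝ) < z := by exact_mod_cast hz
  have hf : (0 : ℝ) < z.factorial := by exact_mod_cast Nat.factorial_pos z
  have h4 : (z : ℝ) ^ z ≤ 3 ^ z * z.factorial := by
    rw [← div_le_iff₀ hf]; exact h2.trans h3
  refine h1.trans ?_
  rw [div_pow, mul_pow, div_le_div_iff₀ hf (by positivity)]
  calc (n : ℝ) ^ z * z ^ z ≤ n ^ z * (3 ^ z * z.factorial) := by gcongr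
    _ = _ := by ring

/-- The expected number of pairs of a set of size `z` and a set of size `3 z` that contains the images of
the former under `34` random permutations is at most `2 ^ (-z)`. -/
theorem expected_bad_pairs_le {n z : ℕ} (hn : 30 ≤ n) (hz : 0 < z) (hzn : 4 * z ≤ n + 2) :
    (n.choose z : ℝ) * n.choose (3 * z) * (((3 * z : ℕ) : ℝ) / n) ^ (z * 34) ≤ (1 / 2) ^ z := by
  have hn' : (0 : ℝ) < n := by exact_mod_cast (by omega : 0 < n)
  have hz' : (0 : ℝ) < z := by exact_mod_cast hz
  have h1 := choose_le_three_mul_div_pow n hz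
  have h2 := choose_le_three_mul_div_pow n (z := 3 * z) (by omega)
  set x : ℝ := ((3 * z : ℕ) : ℝ) / n with hx
  have hx0 : 0 < x := by rw [hx]; push_cast; positivity
  have hx1 : x ≤ 4 / 5 := by
    rw [hx, div_le_div_iff₀ hn' (by norm_num)]
    exact_mod_cast (by omega : 3 * z * 5 ≤ 4 * n)
  have e1 : (3 * n / z : ℝ) = 9 / x := by rw [hx]; push_cast; field_simp; norm_num
  have e2 : (3 * n / (3 * z : ℕ) : ℝ) = 3 / x := by rw [hx]; push_cast; field_simp
  rw [e1] at h1
  rw [e2] at h2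
  calc (n.choose z : ℝ) * n.choose (3 * z) * x ^ (z * 34)
      ≤ (9 / x) ^ z * (3 / x) ^ (3 * z) * x ^ (z * 34) := by gcongr
    _ = (243 * x ^ 30) ^ z := by
        rw [pow_mul (3 / x) 3 z, mul_comm z 34, pow_mul x 34 z, ← mul_pow, ← mul_pow]
        congr 1
        field_simp
        norm_num
    _ ≤ (1 / 2) ^ z := by
        refine pow_le_pow_left₀ (by positivity) ?_ _
        calc 243 * x ^ 30 ≤ 243 * (4 / 5) ^ 30 := by gcongr
          _ ≤ 1 / 2 := by norm_num

theorem sum_half_pow_lt_one (m : ℕ) : ∑ z ∈ Finset.Icc 1 m, (1 / 2 : ℝ) ^ z < 1 := by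
  have : ∑ z ∈ Finset.Icc 1 m, (1 / 2 : ℝ) ^ z = 1 - (1 / 2) ^ m := by
    induction m with
    | zero => simp
    | succ m ih => rw [Finset.sum_Icc_succ_top (by omega), ih]; ring
  rw [this]
  have : (0 : ℝ) < (1 / 2) ^ m := by positivity
  linarith

/-- There are `34` permutations such that the images of every set `Z` of about a quarter of the points or
less cannot be covered by a set three times as large. -/
theorem exists_expanding_perms (hn : 30 ≤ Fintype.card V) :
    ∃ f : Fin 34 → Equiv.Perm V, ∀ Z T : Finset V, 0 < Z.card → 4 * Z.card ≤ Fintype.card V + 2 →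
      T.card = 3 * Z.card → ∃ i, ∃ v ∈ Z, f i v ∉ T := by
  set n := Fintype.card V with hndef
  by_contra hcon
  push Not at hcon
  let m := (n + 2) / 4
  let pairs : ℕ → Finset (Finset V × Finset V) := fun z =>
    (Finset.univ.powersetCard z) ×ˢ (Finset.univ.powersetCard (3 * z))
  -- union bound: otherwise every family of permutations maps some `Z` into some `T`
  have hcover : (Finset.univ : Finset (Fin 34 → Equiv.Perm V)) ⊆
      (Finset.Icc 1 m).biUnion fun z => (pairs z).biUnion fun ZT =>
        Fintype.piFinset fun _ : Fin 34 => permsInto ZT.1 ZT.2 := by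
    intro f _
    obtain ⟨Z, T, h0, h1, h2, h3⟩ := hcon f
    simp only [Finset.mem_biUnion]
    refine ⟨Z.card, Finset.mem_Icc.2 ⟨h0, by omega⟩, (Z, T), ?_, ?_⟩
    · simp [pairs, h2]
    · rw [Fintype.mem_piFinset]
      intro i
      simpa [permsInto] using h3 i
  have hcard := (Finset.card_le_card hcover).trans (Finset.card_biUnion_le.trans
    (Finset.sum_le_sum fun z _ => Finset.card_biUnion_le))
  rw [Finset.card_univ, Fintype.card_pi, Finset.prod_const, Finset.card_univ, Fintype.card_fin,
    Fintype.card_perm] at hcard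
  simp only [Fintype.card_piFinset, Finset.prod_const, Finset.card_univ, Fintype.card_fin] at hcard
  have hfact : (0 : ℝ) < (n.factorial : ℝ) ^ 34 := by
    have := Nat.factorial_pos n
    positivity
  have hreal : ((n.factorial : ℝ)) ^ 34 ≤ ∑ z ∈ Finset.Icc 1 m, ∑ ZT ∈ pairs z,
      ((permsInto ZT.1 ZT.2).card : ℝ) ^ 34 := by exact_mod_cast hcard
  have hterm : ∀ z ∈ Finset.Icc 1 m, ∑ ZT ∈ pairs z, ((permsInto ZT.1 ZT.2).card : ℝ) ^ 34 ≤
      (1 / 2) ^ z * (n.factorial : ℝ) ^ 34 := by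
    intro z hz
    rw [Finset.mem_Icc] at hz
    have hz4 : 4 * z ≤ n + 2 := by omega
    have h1 : ∀ ZT ∈ pairs z, ((permsInto ZT.1 ZT.2).card : ℝ) ^ 34 ≤
        (((3 * z : ℕ) : ℝ) / n) ^ (z * 34) * (n.factorial : ℝ) ^ 34 := by
      intro ZT hZT
      simp only [pairs, Finset.mem_product, Finset.mem_powersetCard] at hZT
      have h2 := card_permsInto_le (Z := ZT.1) (T := ZT.2) (by omega)
      rw [hZT.1.2, hZT.2.2] at h2
      rw [pow_mul, ← mul_pow]
      exact pow_le_pow_left₀ (Nat.cast_nonneg _) h2 _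
    refine (Finset.sum_le_sum h1).trans ?_
    rw [Finset.sum_const, nsmul_eq_mul, Finset.card_product, Finset.card_powersetCard,
      Finset.card_powersetCard, Finset.card_univ, ← mul_assoc]
    refine mul_le_mul_of_nonneg_right ?_ hfact.le
    push_cast
    have := expected_bad_pairs_le hn hz.1 hz4
    push_cast at this
    exact this
  have hlt := (hreal.trans (Finset.sum_le_sum hterm))
  rw [← Finset.sum_mul] at hlt
  have := sum_half_pow_lt_one m
  nlinarith

theorem card_interedges_eq_sum (H : SimpleGraph V) (S : Finset V) :
    (H.interedges S Sᶜ).card = ∑ v ∈ S, (Finset.univ.filter fun w => w ∉ S ∧ H.Adj v w).card := by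
  rw [← Finset.card_sigma]
  refine Finset.card_bij (fun x _ => ⟨x.1, x.2⟩) ?_ ?_ ?_
  · rintro ⟨u, v⟩ h
    rw [SimpleGraph.mem_interedges_iff] at h
    simpa using h
  · rintro ⟨u, v⟩ _ ⟨u', v'⟩ _ h
    simpa using h
  · rintro ⟨u, v⟩ h
    refine ⟨(u, v), ?_, rfl⟩
    rw [SimpleGraph.mem_interedges_iff]
    simpa using h

/-- The graph in which every vertex is joined to its images under the permutations `f i`. -/
def permGraph {k : ℕ} (f : Fin k → Equiv.Perm V) : SimpleGraph V :=
  SimpleGraph.fromRel fun u v => ∃ i, f i u = v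

/-- The graph of expanding permutations has edge expansion at least one. If fewer than `|S|` edges leave
`S`, then more than half of the vertices of `S` have at most one neighbour outside `S`; half of the
vertices of `S`, chosen among these, have too few neighbours. -/
theorem card_le_interedges_of_expanding (hn : 30 ≤ Fintype.card V) {k : ℕ}
    {f : Fin k → Equiv.Perm V}
    (hf : ∀ Z T : Finset V, 0 < Z.card → 4 * Z.card ≤ Fintype.card V + 2 →
      T.card = 3 * Z.card → ∃ i, ∃ v ∈ Z, f i v ∉ T)
    (S : Finset V) (hS : 2 * S.card ≤ Fintype.card V) :
    S.card ≤ ((permGraph f).interedges S Sᶜ).card := by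
  set H := permGraph f with hH
  by_contra! hcon
  rw [card_interedges_eq_sum] at hcon
  set out : V → Finset V := fun v => Finset.univ.filter fun w => w ∉ S ∧ H.Adj v w with hout
  change ∑ v ∈ S, (out v).card < S.card at hcon
  set Z₀ := S.filter fun v => (out v).card ≤ 1 with hZ₀
  have h1 : 2 * (S.card - Z₀.card) ≤ ∑ v ∈ S, (out v).card := by
    have h2 : ∑ v ∈ S.filter (fun v => ¬ (out v).card ≤ 1), 2 ≤ ∑ v ∈ S, (out v).card :=
      (Finset.sum_le_sum fun v hv => by
        have := (Finset.mem_filter.1 hv).2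
        omega).trans (Finset.sum_le_sum_of_subset (Finset.filter_subset _ _))
    have h3 := Finset.card_filter_add_card_filter_not (s := S) fun v => (out v).card ≤ 1
    rw [Finset.sum_const, smul_eq_mul] at h2
    change Z₀.card + _ = _ at h3
    omega
  obtain ⟨Z, hZ, hZc⟩ := Finset.exists_subset_card_eq (s := Z₀) (n := (S.card + 1) / 2) (by omega)
  have h4 : (S ∪ Z.biUnion out).card ≤ 3 * Z.card := by
    have h5 := Finset.card_union_le S (Z.biUnion out)
    have h6 : (Z.biUnion out).card ≤ Z.card * 1 := Finset.card_biUnion_le_card_mul _ _ _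
      fun v hv => (Finset.mem_filter.1 (hZ hv)).2
    omega
  obtain ⟨T, hT, hTc⟩ := Finset.exists_superset_card_eq h4 (by omega)
  obtain ⟨i, v, hv, hvT⟩ := hf Z T (by omega) (by omega) hTc
  apply hvT
  apply hT
  by_cases hfS : f i v ∈ S
  · exact Finset.mem_union_left _ hfS
  · refine Finset.mem_union_right _ (Finset.mem_biUnion.2 ⟨v, hv, ?_⟩)
    rw [hout, Finset.mem_filter]
    refine ⟨Finset.mem_univ _, hfS, ?_⟩
    rw [hH, permGraph, SimpleGraph.fromRel_adj]
    refine ⟨?_, Or.inl ⟨i, rfl⟩⟩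
    intro h
    exact hfS (h ▸ (Finset.mem_filter.1 (hZ hv)).1)

theorem degree_permGraph_le {k : ℕ} (f : Fin k → Equiv.Perm V) (v : V) :
    (permGraph f).degree v ≤ 2 * k := by
  rw [← SimpleGraph.card_neighborFinset_eq_degree]
  have h : (permGraph f).neighborFinset v ⊆
      (Finset.univ.image fun i => f i v) ∪ Finset.univ.image fun i => (f i).symm v := by
    intro w hw
    rw [SimpleGraph.mem_neighborFinset, permGraph, SimpleGraph.fromRel_adj] at hw
    rcases hw.2 with ⟨i, hi⟩ | ⟨i, hi⟩
    · exact Finset.mem_union_left _ (Finset.mem_image.2 ⟨i, Finset.mem_univ _, hi⟩)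
    · refine Finset.mem_union_right _ (Finset.mem_image.2 ⟨i, Finset.mem_univ _, ?_⟩)
      rw [← hi, Equiv.symm_apply_apply]
  refine (Finset.card_le_card h).trans ((Finset.card_union_le _ _).trans ?_)
  have h1 := Finset.card_image_le (s := (Finset.univ : Finset (Fin k))) (f := fun i => f i v)
  have h2 := Finset.card_image_le (s := (Finset.univ : Finset (Fin k)))
    (f := fun i => (f i).symm v)
  rw [Finset.card_univ, Fintype.card_fin] at h1 h2
  omega

/-- On every finite set of vertices there is a graph of degree at most `68` with edge expansion at least
one. -/
theorem exists_expander (V : Type*) [Fintype V] : ∃ H : SimpleGraph V, (∀ v, H.degree v ≤ 68) ∧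
    ∀ S : Finset V, 2 * S.card ≤ Fintype.card V → S.card ≤ (H.interedges S Sᶜ).card := by
  by_cases hn : 30 ≤ Fintype.card V
  · obtain ⟨f, hf⟩ := exists_expanding_perms hn
    exact ⟨_, degree_permGraph_le f, card_le_interedges_of_expanding hn hf⟩
  · obtain ⟨H, hH⟩ : ∃ H : SimpleGraph V, ∀ u v, H.Adj u v ↔ u ≠ v := ⟨⊤, fun _ _ => Iff.rfl⟩
    refine ⟨H, fun v => ?_, fun S hS => ?_⟩
    · have := H.degree_lt_card_verts v
      omega
    · rw [card_interedges_eq_sum, Finset.card_eq_sum_ones]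
      refine Finset.sum_le_sum fun v hv => Finset.card_pos.2 ?_
      have hpos : 0 < S.card := Finset.card_pos.2 ⟨v, hv⟩
      obtain ⟨w, hw⟩ : ∃ w, w ∉ S := by
        by_contra! h
        have : S = Finset.univ := Finset.eq_univ_iff_forall.2 h
        rw [this, Finset.card_univ] at hS hpos
        omega
      refine ⟨w, ?_⟩
      rw [Finset.mem_filter]
      exact ⟨Finset.mem_univ _, hw, (hH v w).2 fun h => hw (h ▸ hv)⟩

end Expander

/-! ### Short cycles -/

section ShortCycles

variable {V : Type*} [Fintype V] (H : SimpleGraph V)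

/-- The number of neighbours of `v` in `A`. -/
noncomputable def degIn (A : Finset V) (v : V) : ℕ := (A.filter fun w => H.Adj v w).card

/-- The number of branch vertices of the subgraph on `A` (vertices of degree at least three) in `C`. -/
noncomputable def branchCount (A C : Finset V) : ℕ := (C.filter fun v => 3 ≤ degIn H A v).card

variable {H}

theorem branchCount_mono {A C C' : Finset V} (h : C ⊆ C') : branchCount H A C ≤ branchCount H A C' :=
  Finset.card_le_card (Finset.filter_subset_filter _ h)

theorem branchCount_union_le (A C C' : Finset V) :
    branchCount H A (C ∪ C') ≤ branchCount H A C + branchCount H A C' := by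
  unfold branchCount
  rw [Finset.filter_union]
  exact Finset.card_union_le _ _

theorem branchCount_singleton_le (A : Finset V) (v : V) : branchCount H A {v} ≤ 1 :=
  (Finset.card_filter_le _ _).trans (Finset.card_singleton v).le

/-- A vertex `w` that has two neighbours in a set `U` closes up the paths to them in `U` to a cycle. -/
theorem exists_cycle_of_two_neighbours {U : Finset V} {r u u' w : V} (hw : w ∉ U) (huu' : u ≠ u')
    (hu : H.Adj u w) (hu' : H.Adj u' w) (p : H.Walk r u) (p' : H.Walk r u')
    (hp : ∀ x ∈ p.support, x ∈ U) (hp' : ∀ x ∈ p'.support, x ∈ U) :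
    ∃ c : H.Walk w w, c.IsCycle ∧ c.support.toFinset ⊆
      p.support.toFinset ∪ p'.support.toFinset ∪ {w} := by
  set q := (p.reverse.append p').bypass with hq
  have hqs : ∀ x ∈ q.support, x ∈ p.support ∨ x ∈ p'.support := by
    intro x hx
    have := (p.reverse.append p').support_bypass_subset_support hx
    rw [SimpleGraph.Walk.mem_support_append_iff, SimpleGraph.Walk.support_reverse,
      List.mem_reverse] at this
    exact this
  have hwq : w ∉ q.support := fun h => hw ((hqs w h).elim (hp w) (hp' w))
  refine ⟨SimpleGraph.Walk.cons hu.symm (q.concat hu'), ?_, ?_⟩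
  · rw [SimpleGraph.Walk.cons_isCycle_iff]
    refine ⟨(SimpleGraph.Walk.bypass_isPath _).concat hwq hu', ?_⟩
    rw [SimpleGraph.Walk.edges_concat, List.concat_eq_append, List.mem_append,
      List.mem_singleton]
    rintro (h | h)
    · exact hwq (q.fst_mem_support_of_mem_edges h)
    · rw [Sym2.eq_iff] at h
      rcases h with ⟨rfl, _⟩ | ⟨_, h⟩
      · exact hu'.ne rfl
      · exact huu' h
  · intro x hx
    rw [List.mem_toFinset, SimpleGraph.Walk.support_cons, SimpleGraph.Walk.support_concat,
      List.mem_cons, List.mem_append,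
      List.mem_singleton] at hx
    simp only [Finset.mem_union, List.mem_toFinset, Finset.mem_singleton]
    rcases hx with h | h | h
    · exact Or.inr h
    · exact Or.inl (hqs x h)
    · exact Or.inr h

/-- Exploration of a graph of minimal degree two. The set `U` has been explored from `r`, and `h u`
bounds the number of branch vertices on the way to `u`. If the edges that leave `U`, with the weights
`2 ^ (-h)`, have total weight at least one, then some of them is not deep; following it either closes a
cycle with few branch vertices, or enlarges `U` without decreasing the total weight. -/
theorem exists_short_cycle_of_explored {A : Finset V} {k : ℕ} (hdeg : ∀ v ∈ A, 2 ≤ degIn H A v)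
    (hk : ∑ v ∈ A, degIn H A v < 2 ^ (k + 1)) (r : V) (N : ℕ) : ∀ (U : Finset V) (h : V → ℕ),
      (A \ U).card ≤ N → U ⊆ A → (∀ u ∈ U, h u ≤ k + 1) →
      (∀ u ∈ U, ∃ p : H.Walk r u, (∀ x ∈ p.support, x ∈ U) ∧
        branchCount H A p.support.toFinset ≤ h u + 1) →
      1 ≤ ∑ u ∈ U, (degIn H (A \ U) u : ℝ) * (1 / 2) ^ h u →
      ∃ (v : V) (c : H.Walk v v), c.IsCycle ∧ (∀ x ∈ c.support, x ∈ A) ∧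
        branchCount H A c.support.toFinset ≤ 2 * k + 4 := by
  induction N with
  | zero =>
    intro U h hN hUA _ _ hkraft
    exfalso
    rw [Nat.le_zero, Finset.card_eq_zero] at hN
    rw [hN] at hkraft
    simp [degIn] at hkraft
    linarith
  | succ N ih =>
    intro U h hN hUA hh hwalk hkraft
    -- an edge leaving `U` that is not deep
    obtain ⟨u, huU, huk, w, hwA, hwU, huw⟩ : ∃ u ∈ U, h u ≤ k ∧ ∃ w ∈ A, w ∉ U ∧ H.Adj u w := by
      by_contra! hcon
      have h1 : ∑ u ∈ U, (degIn H (A \ U) u : ℝ) * (1 / 2) ^ h u ≤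
          ∑ u ∈ U, (degIn H A u : ℝ) * (1 / 2) ^ (k + 1) := by
        refine Finset.sum_le_sum fun u hu => ?_
        by_cases hc : h u ≤ k
        · have : degIn H (A \ U) u = 0 := by
            rw [degIn, Finset.card_eq_zero, Finset.filter_eq_empty_iff]
            intro w hw
            rw [Finset.mem_sdiff] at hw
            exact hcon u hu hc w hw.1 hw.2
          rw [this, Nat.cast_zero, zero_mul]
          positivity
        · have h2 : degIn H (A \ U) u ≤ degIn H A u :=
            Finset.card_le_card (Finset.filter_subset_filter _ Finset.sdiff_subset)
          have h3 : ((1 : ℝ) / 2) ^ h u ≤ (1 / 2) ^ (k + 1) :=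
            pow_le_pow_of_le_one (by norm_num) (by norm_num) (by omega)
          have h4 : (degIn H (A \ U) u : ℝ) ≤ degIn H A u := by exact_mod_cast h2
          gcongr
      have h2 : ∑ u ∈ U, (degIn H A u : ℝ) ≤ ∑ u ∈ A, (degIn H A u : ℝ) :=
        Finset.sum_le_sum_of_subset_of_nonneg hUA fun _ _ _ => Nat.cast_nonneg _
      have h3 : ∑ u ∈ A, (degIn H A u : ℝ) < 2 ^ (k + 1) := by exact_mod_cast hk
      rw [← Finset.sum_mul] at h1
      have h4 : (0 : ℝ) < (1 / 2) ^ (k + 1) := by positivity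
      have h5 : (2 : ℝ) ^ (k + 1) * (1 / 2) ^ (k + 1) = 1 := by rw [← mul_pow]; norm_num
      nlinarith
    obtain ⟨p, hpU, hpb⟩ := hwalk u huU
    by_cases hsec : ∃ u' ∈ U, u' ≠ u ∧ H.Adj u' w
    · obtain ⟨u', hu'U, hne, hu'w⟩ := hsec
      obtain ⟨p', hp'U, hp'b⟩ := hwalk u' hu'U
      obtain ⟨c, hc, hcs⟩ := exists_cycle_of_two_neighbours hwU hne.symm huw hu'w p p' hpU hp'U
      refine ⟨w, c, hc, fun x hx => ?_, ?_⟩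
      · have := hcs (List.mem_toFinset.2 hx)
        simp only [Finset.mem_union, List.mem_toFinset, Finset.mem_singleton] at this
        rcases this with (h1 | h1) | rfl
        · exact hUA (hpU x h1)
        · exact hUA (hp'U x h1)
        · exact hwA
      · have h1 := branchCount_mono (H := H) (A := A) hcs
        have h2 := branchCount_union_le (H := H) A (p.support.toFinset ∪ p'.support.toFinset) {w}
        have h3 := branchCount_union_le (H := H) A p.support.toFinset p'.support.toFinset
        have h4 := branchCount_singleton_le (H := H) A w
        have h5 := hh u' hu'U
        omega
    · push Not at hsec
      set b := branchCount H A {w} with hb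
      have hb1 : b ≤ 1 := branchCount_singleton_le A w
      refine ih (insert w U) (Function.update h w (h u + b)) ?_ ?_ ?_ ?_ ?_
      · have h1 : A \ U = insert w (A \ insert w U) := by
          ext x
          simp only [Finset.mem_sdiff, Finset.mem_insert]
          by_cases hx : x = w
          · subst hx; simp [hwA, hwU]
          · simp [hx]
        rw [h1, Finset.card_insert_of_notMem (by simp)] at hN
        omega
      · exact Finset.insert_subset hwA hUA
      · intro x hx
        by_cases hxw : x = w
        · rw [hxw, Function.update_self]; omega
        · rw [Function.update_of_ne hxw]
          exact hh x (Finset.mem_of_mem_insert_of_ne hx hxw)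
      · intro x hx
        by_cases hxw : x = w
        · subst hxw
          refine ⟨p.concat huw, ?_, ?_⟩
          · intro y hy
            rw [SimpleGraph.Walk.support_concat, List.mem_append, List.mem_singleton] at hy
            rcases hy with hy | rfl
            · exact Finset.mem_insert_of_mem (hpU y hy)
            · exact Finset.mem_insert_self _ _
          · rw [Function.update_self]
            have h1 : (p.concat huw).support.toFinset ⊆ p.support.toFinset ∪ {x} := by
              intro y hy
              rw [List.mem_toFinset, SimpleGraph.Walk.support_concat, List.mem_append,
                List.mem_singleton] at hy
              simpa [or_comm] using hy
            have h2 := branchCount_mono (H := H) (A := A) h1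
            have h3 := branchCount_union_le (H := H) A p.support.toFinset {x}
            omega
        · rw [Function.update_of_ne hxw]
          obtain ⟨p', hp'U, hp'b⟩ := hwalk x (Finset.mem_of_mem_insert_of_ne hx hxw)
          exact ⟨p', fun y hy => Finset.mem_insert_of_mem (hp'U y hy), hp'b⟩
      · refine hkraft.trans ?_
        rw [Finset.sum_insert hwU, Function.update_self]
        -- only `u` loses an edge
        have hloss : ∀ x ∈ U, degIn H (A \ U) x = degIn H (A \ insert w U) x +
            if x = u then 1 else 0 := by
          intro x hx
          have h1 : A \ U = insert w (A \ insert w U) := by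
            ext x
            simp only [Finset.mem_sdiff, Finset.mem_insert]
            by_cases hx : x = w
            · subst hx; simp [hwA, hwU]
            · simp [hx]
          unfold degIn
          rw [h1, Finset.filter_insert]
          split_ifs with h2 h3 h3
          · rw [Finset.card_insert_of_notMem (by simp)]
          · exact absurd h2 (hsec x hx h3)
          · exact absurd (h3 ▸ huw) h2
          · rfl
        have hgain : degIn H A w = degIn H (A \ insert w U) w + 1 := by
          have h1 : A.filter (fun x => H.Adj w x) =
              insert u ((A \ insert w U).filter fun x => H.Adj w x) := by
            ext x
            simp only [Finset.mem_filter, Finset.mem_insert, Finset.mem_sdiff]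
            constructor
            · rintro ⟨hx, hwx⟩
              by_cases hxu : x = u
              · exact Or.inl hxu
              · refine Or.inr ⟨⟨hx, ?_⟩, hwx⟩
                rintro (rfl | hxU)
                · exact hwx.ne rfl
                · exact hsec x hxU hxu hwx.symm
            · rintro (rfl | ⟨⟨hx, _⟩, hwx⟩)
              · exact ⟨hUA huU, huw.symm⟩
              · exact ⟨hx, hwx⟩
          unfold degIn
          rw [h1, Finset.card_insert_of_notMem (by simp [huU])]
        have hsum : ∑ x ∈ U, (degIn H (A \ U) x : ℝ) * (1 / 2) ^ h x =
            ∑ x ∈ U, (degIn H (A \ insert w U) x : ℝ) * (1 / 2) ^ h x + (1 / 2) ^ h u := by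
          rw [Finset.sum_congr rfl fun x hx => by rw [hloss x hx]]
          push_cast
          simp only [add_mul, Finset.sum_add_distrib]
          congr 1
          rw [Finset.sum_eq_single u]
          · simp
          · intro x _ hx; simp [hx]
          · intro hx; exact absurd huU hx
        have hupd : ∑ x ∈ U, (degIn H (A \ insert w U) x : ℝ) *
            (1 / 2) ^ Function.update h w (h u + b) x =
            ∑ x ∈ U, (degIn H (A \ insert w U) x : ℝ) * (1 / 2) ^ h x := by
          refine Finset.sum_congr rfl fun x hx => ?_
          rw [Function.update_of_ne (by rintro rfl; exact hwU hx)]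
        rw [hsum, hupd, add_comm]
        refine add_le_add ?_ le_rfl
        have hdw := hdeg w hwA
        rw [pow_add]
        have hpos : (0 : ℝ) < (1 / 2) ^ h u := by positivity
        -- a branch vertex passes on its weight to at least two edges of half the weight
        by_cases h3 : 3 ≤ degIn H A w
        · have hb' : b = 1 := by
            rw [hb, branchCount, Finset.filter_singleton, if_pos h3, Finset.card_singleton]
          have : (2 : ℝ) ≤ degIn H (A \ insert w U) w := by exact_mod_cast (by omega)
          rw [hb', pow_one]
          nlinarith
        · have hb' : b = 0 := by
            rw [hb, branchCount, Finset.filter_singleton, if_neg h3, Finset.card_empty]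
          have : (1 : ℝ) ≤ degIn H (A \ insert w U) w := by exact_mod_cast (by omega)
          rw [hb', pow_zero, mul_one]
          nlinarith

/-- A graph of minimal degree two has a cycle with few branch vertices: explore it from any vertex. -/
theorem exists_short_cycle {A : Finset V} {k : ℕ} (hA : A.Nonempty)
    (hdeg : ∀ v ∈ A, 2 ≤ degIn H A v) (hk : ∑ v ∈ A, degIn H A v < 2 ^ (k + 1)) :
    ∃ (v : V) (c : H.Walk v v), c.IsCycle ∧ (∀ x ∈ c.support, x ∈ A) ∧
      branchCount H A c.support.toFinset ≤ 2 * k + 4 := by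
  obtain ⟨r, hr⟩ := hA
  refine exists_short_cycle_of_explored hdeg hk r _ {r} (fun _ => 0) le_rfl
    (Finset.singleton_subset_iff.2 hr) (fun _ _ => Nat.zero_le _) ?_ ?_
  · intro u hu
    rw [Finset.mem_singleton] at hu
    subst hu
    refine ⟨SimpleGraph.Walk.nil, by simp, ?_⟩
    simpa using branchCount_singleton_le (H := H) A u
  · have h1 : degIn H (A \ {r}) r = degIn H A r := by
      unfold degIn
      congr 1
      ext x
      simp only [Finset.mem_filter, Finset.mem_sdiff, Finset.mem_singleton]
      exact ⟨fun h => ⟨h.1.1, h.2⟩, fun h => ⟨⟨h.1, fun hx => h.2.ne hx.symm⟩, h.2⟩⟩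
    rw [Finset.sum_singleton, h1, pow_zero, mul_one]
    exact_mod_cast (by have := hdeg r hr; omega : 1 ≤ degIn H A r)

end ShortCycles

/-! ### Many disjoint cycles -/

section DisjointCycles

variable {V : Type*} [Fintype V] {H : SimpleGraph V}

/-- Twice the number of edges minus twice the number of vertices of the subgraph on `A`. -/
noncomputable def excess (H : SimpleGraph V) (A : Finset V) : ℤ := ∑ v ∈ A, ((degIn H A v : ℤ) - 2)

theorem degIn_sdiff_add {A C : Finset V} (hC : C ⊆ A) (v : V) :
    degIn H (A \ C) v + degIn H C v = degIn H A v := by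
  unfold degIn
  rw [← Finset.card_union_of_disjoint, ← Finset.filter_union, Finset.sdiff_union_of_subset hC]
  exact Finset.disjoint_filter_filter Finset.sdiff_disjoint

theorem sum_degIn_comm (B C : Finset V) : ∑ v ∈ B, degIn H C v = ∑ v ∈ C, degIn H B v := by
  simp only [degIn, Finset.card_filter]
  rw [Finset.sum_comm]
  exact Finset.sum_congr rfl fun _ _ => Finset.sum_congr rfl fun _ _ => by
    simp only [SimpleGraph.adj_comm]

/-- Removing `C` destroys the edges in `C` and the edges that leave `C`. -/
theorem excess_sdiff {A C : Finset V} (hC : C ⊆ A) : excess H (A \ C) =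
    excess H A - ∑ v ∈ C, (((degIn H A v : ℤ) - 2) + degIn H (A \ C) v) := by
  have h1 : excess H A = ∑ v ∈ A \ C, ((degIn H A v : ℤ) - 2) + ∑ v ∈ C, ((degIn H A v : ℤ) - 2) :=
    (Finset.sum_sdiff hC).symm
  have h2 : ∑ v ∈ A \ C, ((degIn H A v : ℤ) - 2) =
      excess H (A \ C) + ∑ v ∈ A \ C, (degIn H C v : ℤ) := by
    rw [excess, ← Finset.sum_add_distrib]
    refine Finset.sum_congr rfl fun v _ => ?_
    rw [← degIn_sdiff_add hC v]
    push_cast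
    ring
  have h3 : ∑ v ∈ A \ C, (degIn H C v : ℤ) = ∑ v ∈ C, (degIn H (A \ C) v : ℤ) := by
    exact_mod_cast sum_degIn_comm (H := H) (A \ C) C
  rw [h1, h2, h3, Finset.sum_add_distrib]
  ring

theorem two_le_degIn_of_isCycle {v : V} {c : H.Walk v v} (hc : c.IsCycle) {x : V}
    (hx : x ∈ c.support) : 2 ≤ degIn H c.support.toFinset x := by
  have h1 := hc.ncard_neighborSet_toSubgraph_eq_two hx
  have h2 : c.toSubgraph.neighborSet x ⊆
      (c.support.toFinset.filter fun w => H.Adj x w : Finset V) := by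
    intro w hw
    rw [SimpleGraph.Subgraph.mem_neighborSet] at hw
    rw [Finset.coe_filter, Set.mem_ofPred_eq, List.mem_toFinset]
    exact ⟨(SimpleGraph.Walk.mem_verts_toSubgraph c).1 hw.snd_mem, hw.adj_sub⟩
  have h3 := Set.ncard_le_ncard h2 (Finset.finite_toSet _)
  rw [h1, Set.ncard_coe_finset] at h3
  exact h3

/-- Removing the vertices of a cycle with few branch vertices reduces the excess by little, since the
other vertices of the cycle have no further edges. -/
theorem excess_sdiff_cycle_ge {A : Finset V} {D b : ℕ} (hD : ∀ v, degIn H A v ≤ D)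
    {v : V} {c : H.Walk v v} (hc : c.IsCycle)
    (hcA : ∀ x ∈ c.support, x ∈ A) (hb : branchCount H A c.support.toFinset ≤ b) :
    excess H A - 2 * D * b ≤ excess H (A \ c.support.toFinset) := by
  have hsub : c.support.toFinset ⊆ A := fun x hx => hcA x (List.mem_toFinset.1 hx)
  rw [excess_sdiff hsub]
  have h1 : ∑ x ∈ c.support.toFinset, (((degIn H A x : ℤ) - 2) +
      degIn H (A \ c.support.toFinset) x) ≤
      ∑ x ∈ c.support.toFinset, if 3 ≤ degIn H A x then (2 * D : ℤ) else 0 := by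
    refine Finset.sum_le_sum fun x hx => ?_
    have h2 := two_le_degIn_of_isCycle hc (List.mem_toFinset.1 hx)
    have h3 := degIn_sdiff_add (H := H) hsub x
    have h4 := hD x
    split_ifs <;> omega
  rw [← Finset.sum_filter, Finset.sum_const, nsmul_eq_mul] at h1
  have h5 : ((c.support.toFinset.filter fun x => 3 ≤ degIn H A x).card : ℤ) ≤ b := by
    exact_mod_cast hb
  have h6 : ((c.support.toFinset.filter fun x => 3 ≤ degIn H A x).card : ℤ) * (2 * D) ≤
      b * (2 * D) := mul_le_mul_of_nonneg_right h5 (by positivity)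
  linarith

/-- Two closed walks without common vertex. -/
def DisjointWalks (c c' : Σ v, H.Walk v v) : Prop := ∀ x ∈ c.2.support, x ∉ c'.2.support

/-- A graph of bounded degree with large excess contains many disjoint cycles: vertices of degree at most
one can be dropped, and otherwise a short cycle is split off. -/
theorem exists_disjoint_cycles {D k : ℕ} (hD : ∀ v, degIn H Finset.univ v ≤ D)
    (hk : Fintype.card V * D < 2 ^ (k + 1)) (n : ℕ) : ∀ A : Finset V, A.card ≤ n → A.Nonempty →
      0 ≤ excess H A → ∃ l : List (Σ v, H.Walk v v),
        (∀ c ∈ l, c.2.IsCycle ∧ ∀ x ∈ c.2.support, x ∈ A) ∧ l.Pairwise DisjointWalks ∧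
        excess H A + 2 ≤ l.length * (2 * D * (2 * k + 4) + 2 : ℕ) := by
  induction n with
  | zero =>
    intro A hA hne
    exact absurd (Finset.card_pos.2 hne) (by omega)
  | succ n ih =>
    intro A hA hne hex
    have hDA : ∀ v, degIn H A v ≤ D := fun v =>
      (Finset.card_le_card (Finset.filter_subset_filter _ (Finset.subset_univ A))).trans (hD v)
    by_cases hlow : ∃ v ∈ A, degIn H A v ≤ 1
    · obtain ⟨v, hv, hdv⟩ := hlow
      have hsub : {v} ⊆ A := Finset.singleton_subset_iff.2 hv
      have h1 := excess_sdiff (H := H) hsub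
      rw [Finset.sum_singleton] at h1
      have h2 := degIn_sdiff_add (H := H) hsub v
      have h3 : (A \ {v}).card + 1 = A.card := by
        rw [Finset.card_sdiff_of_subset hsub, Finset.card_singleton]
        exact Nat.sub_add_cancel (Finset.card_pos.2 hne)
      obtain ⟨l, hl, hdis, hlen⟩ := ih (A \ {v}) (by omega) (by
        by_contra hem
        rw [Finset.not_nonempty_iff_eq_empty] at hem
        have h4 : degIn H (A \ {v}) v = 0 := by rw [hem]; simp [degIn]
        have h5 : degIn H {v} v = 0 := by simp [degIn, Finset.filter_singleton]
        rw [hem] at h1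
        have h6 : excess H ∅ = 0 := by simp [excess]
        rw [h6, ← hem, h4] at h1
        omega) (by omega)
      exact ⟨l, fun c hc => ⟨(hl c hc).1, fun x hx => (Finset.mem_sdiff.1 ((hl c hc).2 x hx)).1⟩,
        hdis, by omega⟩
    · push Not at hlow
      have hdeg : ∀ v ∈ A, 2 ≤ degIn H A v := fun v hv => hlow v hv
      obtain ⟨v, c, hc, hcA, hcb⟩ := exists_short_cycle (k := k) hne hdeg (by
        refine lt_of_le_of_lt ?_ hk
        refine (Finset.sum_le_card_nsmul A _ D fun v _ => hDA v).trans ?_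
        rw [smul_eq_mul]
        exact Nat.mul_le_mul_right _ (Finset.card_le_univ A))
      have hdrop := excess_sdiff_cycle_ge hDA hc hcA hcb
      have hv : v ∈ c.support.toFinset := List.mem_toFinset.2 c.start_mem_support
      have hcard : (A \ c.support.toFinset).card < A.card :=
        Finset.card_lt_card ((Finset.ssubset_iff_of_subset Finset.sdiff_subset).2
          ⟨v, hcA v c.start_mem_support, fun h => (Finset.mem_sdiff.1 h).2 hv⟩)
      push_cast at hdrop ⊢
      by_cases hpos : 1 ≤ excess H (A \ c.support.toFinset)
      · obtain ⟨l, hl, hdis, hlen⟩ := ih (A \ c.support.toFinset) (by omega) (by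
          by_contra hem
          rw [Finset.not_nonempty_iff_eq_empty] at hem
          rw [hem] at hpos
          simp [excess] at hpos) (by omega)
        refine ⟨⟨v, c⟩ :: l, ?_, ?_, ?_⟩
        · intro c' hc'
          rw [List.mem_cons] at hc'
          rcases hc' with rfl | hc'
          · exact ⟨hc, hcA⟩
          · exact ⟨(hl c' hc').1, fun x hx => (Finset.mem_sdiff.1 ((hl c' hc').2 x hx)).1⟩
        · rw [List.pairwise_cons]
          refine ⟨fun c' hc' x hx hx' => ?_, hdis⟩
          exact (Finset.mem_sdiff.1 ((hl c' hc').2 x hx')).2 (List.mem_toFinset.2 hx)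
        · rw [List.length_cons]
          push_cast at hlen ⊢
          rw [add_mul]
          linarith
      · refine ⟨[⟨v, c⟩], ?_, List.pairwise_singleton _ _, ?_⟩
        · intro c' hc'
          rw [List.mem_singleton] at hc'
          subst hc'
          exact ⟨hc, hcA⟩
        · rw [List.length_singleton]
          push_cast
          linarith

end DisjointCycles

/-! ### Removing the edges of cycles -/

section RemoveCycles

variable {V : Type*} {G : SimpleGraph V}

/-- The cochain `A` is on the edges of `H` the coboundary of `φ`. -/
def IsPotential (H : SimpleGraph V) (A : Sym2 V → ZMod 2) (φ : V → ZMod 2) : Prop :=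
  ∀ u v, H.Adj u v → A s(u, v) = φ u + φ v

theorem IsPotential.sum_edges {H : SimpleGraph V} {A : Sym2 V → ZMod 2} {φ : V → ZMod 2}
    (h : IsPotential H A φ) {u v : V} (p : G.Walk u v) (hp : ∀ e ∈ p.edges, e ∈ H.edgeSet) :
    (p.edges.map A).sum = φ u + φ v := by
  induction p with
  | nil => exact (CharTwo.add_self_eq_zero _).symm
  | @cons u v w huv p ih =>
    rw [SimpleGraph.Walk.edges_cons] at hp ⊢
    rw [List.map_cons, List.sum_cons, ih fun e he => hp e (List.mem_cons_of_mem _ he),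
      h u v (hp _ List.mem_cons_self)]
    linear_combination CharTwo.add_self_eq_zero (φ v)

/-- One edge of every cycle in a family of disjoint cycles can be removed such that the graph stays
connected; a cochain that vanishes on the cycles is exact if it is exact on the remaining graph. -/
theorem exists_remove_cycles [Finite V] (l : List (Σ v, G.Walk v v)) : ∀ H : SimpleGraph V,
    H.Connected → (∀ c ∈ l, c.2.IsCycle ∧ ∀ e ∈ c.2.edges, e ∈ H.edgeSet) →
    l.Pairwise DisjointWalks → ∃ H' ≤ H, H'.Connected ∧
      H'.edgeSet.ncard + l.length = H.edgeSet.ncard ∧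
      ∀ A : Sym2 V → ZMod 2, (∀ c ∈ l, (c.2.edges.map A).sum = 0) →
        ∀ φ, IsPotential H' A φ → IsPotential H A φ := by
  induction l with
  | nil => intro H hH _ _; exact ⟨H, le_rfl, hH, rfl, fun A _ φ h => h⟩
  | cons c l ih =>
    intro H hH hl hdis
    obtain ⟨w, c⟩ := c
    obtain ⟨hc, hcH⟩ := hl _ List.mem_cons_self
    rw [List.pairwise_cons] at hdis
    cases c with
    | nil => exact absurd hc (by simp)
    | @cons _ v _ huv p =>
      simp only at hc hcH
      have huvH : H.Adj w v := hcH s(w, v) (by rw [SimpleGraph.Walk.edges_cons]; exact List.mem_cons_self)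
      -- the first edge of the cycle is removed
      have hnb : ¬ H.IsBridge s(w, v) := by
        rw [SimpleGraph.isBridge_iff_forall_cycle_notMem ((SimpleGraph.mem_edgeSet H).2 huvH)]
        push Not
        refine ⟨w, (SimpleGraph.Walk.cons huv p).transfer H hcH, hc.transfer hcH, ?_⟩
        rw [SimpleGraph.Walk.edges_transfer, SimpleGraph.Walk.edges_cons]
        exact List.mem_cons_self
      have hH1 := hH.connected_delete_edge_of_not_isBridge hnb
      have hmem : ∀ e, e ∈ (H.deleteEdges {s(w, v)}).edgeSet ↔ e ∈ H.edgeSet ∧ e ≠ s(w, v) := by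
        intro e
        rw [SimpleGraph.edgeSet_deleteEdges]
        rfl
      obtain ⟨H', hle, hconn, hcard, htr⟩ := ih (H.deleteEdges {s(w, v)}) hH1 (fun c' hc' => by
        obtain ⟨h1, h2⟩ := hl c' (List.mem_cons_of_mem _ hc')
        refine ⟨h1, fun e he => (hmem e).2 ⟨h2 e he, ?_⟩⟩
        rintro rfl
        exact hdis.1 c' hc' w (SimpleGraph.Walk.start_mem_support _)
          (c'.2.fst_mem_support_of_mem_edges he)) hdis.2
      refine ⟨H', hle.trans (SimpleGraph.deleteEdges_le _), hconn, ?_, ?_⟩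
      · rw [List.length_cons, ← add_assoc, hcard, SimpleGraph.edgeSet_deleteEdges]
        exact Set.ncard_sdiff_singleton_add_one huvH (Set.toFinite _)
      · intro A hA φ hφ
        have h1 := htr A (fun c' hc' => hA c' (List.mem_cons_of_mem _ hc')) φ hφ
        have h2 := hA _ List.mem_cons_self
        simp only [SimpleGraph.Walk.edges_cons, List.map_cons, List.sum_cons] at h2
        have hne := ((SimpleGraph.Walk.cons_isCycle_iff _ _).1 hc).2
        rw [h1.sum_edges p fun e he => (hmem e).2 ⟨hcH e (by
          rw [SimpleGraph.Walk.edges_cons]; exact List.mem_cons_of_mem _ he), by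
          rintro rfl; exact hne he⟩] at h2
        intro x y hxy
        by_cases he : s(x, y) = s(w, v)
        · rw [he, CharTwo.add_eq_zero.1 h2]
          rcases Sym2.eq_iff.1 he with ⟨rfl, rfl⟩ | ⟨rfl, rfl⟩
          · exact add_comm _ _
          · rfl
        · exact h1 x y ((hmem s(x, y)).2 ⟨hxy, he⟩)

end RemoveCycles

/-! ### Decongestion: a generating set of cycles in few layers of disjoint cycles -/

section Decongestion

variable {V : Type*} [Fintype V] {G : SimpleGraph V}

/-- The coboundary map on potentials. -/
noncomputable def coboundary (H : SimpleGraph V) : (V → ZMod 2) →ₗ[ZMod 2] (H.edgeSet → ZMod 2) where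
  toFun φ e := ∑ w, if w ∈ (e : Sym2 V) then φ w else 0
  map_add' φ ψ := by
    funext e
    simp only [Pi.add_apply, ← Finset.sum_add_distrib]
    exact Finset.sum_congr rfl fun w _ => by split_ifs <;> simp
  map_smul' c φ := by
    funext e
    simp only [Pi.smul_apply, smul_eq_mul, RingHom.id_apply, Finset.mul_sum]
    exact Finset.sum_congr rfl fun w _ => by split_ifs <;> simp

theorem coboundary_apply {H : SimpleGraph V} (φ : V → ZMod 2) {u v : V} (h : H.Adj u v) :
    coboundary H φ ⟨s(u, v), h⟩ = φ u + φ v := sum_endpoints h.ne φ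

/-- On a tree every cochain is exact, since the constants are the only potentials with zero
coboundary. -/
theorem exists_isPotential_of_tree {H : SimpleGraph V} (hH : H.Connected)
    (hcard : H.edgeSet.ncard + 1 ≤ Fintype.card V) (A : Sym2 V → ZMod 2) :
    ∃ φ, IsPotential H A φ := by
  have hker : LinearMap.ker (coboundary H) ≤ Submodule.span (ZMod 2) {fun _ => 1} := by
    intro φ hφ
    obtain ⟨v₀⟩ := hH.nonempty
    have h1 : ∀ u v, H.Adj u v → φ u = φ v := fun u v h => by
      rw [← CharTwo.add_eq_zero, ← coboundary_apply φ h, LinearMap.mem_ker.1 hφ]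
      rfl
    rw [Submodule.mem_span_singleton]
    refine ⟨φ v₀, funext fun v => ?_⟩
    rw [Pi.smul_apply, smul_eq_mul, mul_one]
    exact eq_of_connected hH h1 v₀ v
  have h1 : Module.finrank (ZMod 2) (LinearMap.ker (coboundary H)) ≤ 1 :=
    (Submodule.finrank_mono hker).trans ((finrank_span_le_card _).trans (by simp))
  have h2 := LinearMap.finrank_range_add_finrank_ker (coboundary H)
  rw [Module.finrank_pi] at h2
  have h3 : H.edgeSet.ncard = Module.finrank (ZMod 2) (H.edgeSet → ZMod 2) := by
    rw [Module.finrank_pi, ← Nat.card_coe_set_eq, Nat.card_eq_fintype_card]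
  have h4 : LinearMap.range (coboundary H) = ⊤ := by
    apply Submodule.eq_top_of_finrank_eq
    have := Submodule.finrank_le (LinearMap.range (coboundary H))
    omega
  obtain ⟨φ, hφ⟩ := LinearMap.range_eq_top.1 h4 fun e => A e
  exact ⟨φ, fun u v h => by rw [← coboundary_apply φ h, hφ]⟩

/-- The dimension of the cycle space of a connected graph. -/
noncomputable def cycleRank (H : SimpleGraph V) : ℤ := H.edgeSet.ncard - Fintype.card V + 1

theorem degIn_univ (H : SimpleGraph V) (v : V) : degIn H Finset.univ v = H.degree v := by
  rw [degIn, ← SimpleGraph.card_neighborFinset_eq_degree]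
  congr 1
  ext w
  simp

theorem sum_degIn_univ (H : SimpleGraph V) :
    ∑ v, degIn H Finset.univ v = 2 * H.edgeSet.ncard := by
  simp only [degIn_univ]
  rw [SimpleGraph.sum_degrees_eq_twice_card_edges, ← Nat.card_coe_set_eq,
    Nat.card_eq_fintype_card, SimpleGraph.edgeFinset_card]

theorem excess_univ (H : SimpleGraph V) : excess H Finset.univ + 2 = 2 * cycleRank H := by
  have h1 : ∑ v, (degIn H Finset.univ v : ℤ) = 2 * H.edgeSet.ncard := by
    exact_mod_cast sum_degIn_univ H
  rw [excess, Finset.sum_sub_distrib, h1, Finset.sum_const, Finset.card_univ, cycleRank]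
  simp
  ring

/-- One layer: a family of disjoint cycles that makes up a fixed fraction of the cycle rank is split off
from a connected subgraph. -/
theorem exists_layer {D k : ℕ} (hD : ∀ v, G.degree v ≤ D) (hk : Fintype.card V * D < 2 ^ (k + 1))
    {H : SimpleGraph V} (hHG : H ≤ G) (hH : H.Connected) :
    ∃ l : List (Σ v, G.Walk v v), (∀ c ∈ l, c.2.IsCycle) ∧ l.Pairwise DisjointWalks ∧
      ∃ H' ≤ H, H'.Connected ∧
        (2 / (2 * D * (2 * k + 4) + 2 : ℕ) : ℝ) * cycleRank H ≤ cycleRank H - cycleRank H' ∧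
        ∀ A : Sym2 V → ZMod 2, (∀ c ∈ l, (c.2.edges.map A).sum = 0) →
          ∀ φ, IsPotential H' A φ → IsPotential H A φ := by
  set Λ := 2 * D * (2 * k + 4) + 2 with hΛ
  have hΛ0 : (0 : ℝ) < Λ := by exact_mod_cast (by omega : 0 < Λ)
  by_cases hr : 1 ≤ cycleRank H
  · have hne : (Finset.univ : Finset V).Nonempty := by
      obtain ⟨v⟩ := hH.nonempty
      exact ⟨v, Finset.mem_univ v⟩
    have hex := excess_univ H
    have hDH : ∀ v, degIn H Finset.univ v ≤ D := fun v => by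
      refine le_trans ?_ (hD v)
      rw [← degIn_univ]
      exact Finset.card_le_card (Finset.monotone_filter_right _ fun w _ h => hHG h)
    obtain ⟨l, hl, hdis, hlen⟩ := exists_disjoint_cycles hDH hk _ Finset.univ le_rfl hne (by omega)
    rw [hex] at hlen
    let f : (Σ v, H.Walk v v) → Σ v, G.Walk v v := fun c => ⟨c.1, c.2.mapLe hHG⟩
    have hsupp : ∀ c, (f c).2.support = c.2.support := fun c => by simp [f]
    have hedges : ∀ c, (f c).2.edges = c.2.edges := fun c => by simp [f]
    have hcyc : ∀ c ∈ l.map f, c.2.IsCycle := by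
      intro c hc
      obtain ⟨c', hc', rfl⟩ := List.mem_map.1 hc
      exact (hl c' hc').1.mapLe hHG
    have hdis' : (l.map f).Pairwise DisjointWalks := by
      rw [List.pairwise_map]
      refine hdis.imp fun {c c'} h x hx hx' => ?_
      rw [hsupp] at hx hx'
      exact h x hx hx'
    obtain ⟨H', hle, hconn, hcard, htr⟩ := exists_remove_cycles (l.map f) H hH (fun c hc => by
      refine ⟨hcyc c hc, ?_⟩
      obtain ⟨c', _, rfl⟩ := List.mem_map.1 hc
      rw [hedges]
      exact fun e he => c'.2.edges_subset_edgeSet he) hdis'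
    refine ⟨l.map f, hcyc, hdis', H', hle, hconn, ?_, htr⟩
    rw [List.length_map] at hcard
    have h1 : cycleRank H - cycleRank H' = l.length := by
      unfold cycleRank
      omega
    have h2 : (2 * cycleRank H : ℝ) ≤ l.length * Λ := by exact_mod_cast hlen
    have h3 : ((cycleRank H : ℝ) - cycleRank H') = l.length := by exact_mod_cast h1
    rw [h3, div_mul_eq_mul_div, div_le_iff₀ hΛ0]
    exact h2
  · refine ⟨[], by simp, List.Pairwise.nil, H, le_rfl, hH, ?_, fun A _ φ h => h⟩
    have h1 : (cycleRank H : ℝ) ≤ 0 := by exact_mod_cast (by omega : cycleRank H ≤ 0)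
    rw [sub_self]
    exact mul_nonpos_of_nonneg_of_nonpos (by positivity) h1

/-- Iterating `exists_layer`, the cycle rank decreases geometrically. -/
theorem exists_layers {D k : ℕ} (hD : ∀ v, G.degree v ≤ D)
    (hk : Fintype.card V * D < 2 ^ (k + 1)) (hG : G.Connected) :
    ∃ ls : ℕ → List (Σ v, G.Walk v v), (∀ i, (∀ c ∈ ls i, c.2.IsCycle) ∧
      (ls i).Pairwise DisjointWalks) ∧ ∀ t : ℕ, ∃ H : SimpleGraph V, H.Connected ∧
        (cycleRank H : ℝ) ≤
          (1 - 2 / (2 * D * (2 * k + 4) + 2 : ℕ) : ℝ) ^ t * cycleRank G ∧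
        ∀ A : Sym2 V → ZMod 2, (∀ i < t, ∀ c ∈ ls i, (c.2.edges.map A).sum = 0) →
          ∀ φ, IsPotential H A φ → IsPotential G A φ := by
  choose l hl hdis H' hle hconn hrank htr using
    fun H : {H : SimpleGraph V // H ≤ G ∧ H.Connected} => exists_layer hD hk H.2.1 H.2.2
  let next : {H : SimpleGraph V // H ≤ G ∧ H.Connected} →
      {H : SimpleGraph V // H ≤ G ∧ H.Connected} :=
    fun H => ⟨H' H, (hle H).trans H.2.1, hconn H⟩
  let Hs : ℕ → {H : SimpleGraph V // H ≤ G ∧ H.Connected} := fun t =>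
    Nat.rec ⟨G, le_rfl, hG⟩ (fun _ H => next H) t
  refine ⟨fun i => l (Hs i), fun i => ⟨hl _, hdis _⟩, fun t => ⟨(Hs t).1, (Hs t).2.2, ?_, ?_⟩⟩
  · induction t with
    | zero => simp [Hs]
    | succ t ih =>
      have h1 := hrank (Hs t)
      have h2 : (Hs (t + 1)).1 = H' (Hs t) := rfl
      rw [h2, pow_succ, mul_right_comm]
      have hΛ : (0 : ℝ) ≤ 1 - 2 / (2 * D * (2 * k + 4) + 2 : ℕ) := by
        rw [sub_nonneg]
        apply div_le_one_of_le₀ _ (Nat.cast_nonneg _)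
        exact_mod_cast (by omega : 2 ≤ 2 * D * (2 * k + 4) + 2)
      have h3 := mul_le_mul_of_nonneg_right ih hΛ
      linarith
  · intro A
    induction t with
    | zero => intro _ φ h; exact h
    | succ t ih =>
      intro hA φ hφ
      exact ih (fun i hi => hA i (by omega)) φ (htr (Hs t) A (hA t (by omega)) φ hφ)

theorem one_le_two_mul_log {W : ℝ} (hW : 2 ≤ W) : 1 ≤ 2 * Real.log W := by
  have h1 := Real.log_two_gt_d9
  have h2 := Real.log_le_log (by norm_num) hW
  linarith

/-- The numerical estimate for the number of layers. -/
theorem exists_layer_number (D : ℕ) : ∃ K : ℝ, ∀ W : ℕ, 2 ≤ W → ∃ k t : ℕ,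
    W * (D + 1) < 2 ^ (k + 1) ∧ (t : ℝ) ≤ K * Real.log W ^ 2 ∧
    (1 - 2 / (2 * (D + 1) * (2 * k + 4) + 2 : ℕ) : ℝ) ^ t * (W * (D + 1) : ℕ) < 1 := by
  -- `log (W (D + 1)) ≤ c₁ log W`, and the reciprocal rate of decrease is at most `c₂ log W / 2`
  set c₁ : ℝ := 1 + 2 * Real.log (D + 1) with hc₁
  set c₂ : ℝ := 4 * (D + 1) * (2 * c₁) + 2 * (8 * (D + 1) + 2) with hc₂
  refine ⟨c₂ / 2 * c₁ + 4, fun W hW => ?_⟩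
  have hW' : (2 : ℝ) ≤ W := by exact_mod_cast hW
  have hlog := one_le_two_mul_log hW'
  have hD : (0 : ℝ) ≤ Real.log (D + 1) := Real.log_nonneg (by linarith [(Nat.cast_nonneg D : (0 : ℝ) ≤ D)])
  have hlogWD : Real.log (W * (D + 1) : ℕ) ≤ c₁ * Real.log W := by
    push_cast
    rw [Real.log_mul (by positivity) (by positivity), hc₁]
    nlinarith
  have hlogWD0 : 0 ≤ Real.log (W * (D + 1) : ℕ) :=
    Real.log_nonneg (by exact_mod_cast Nat.mul_pos (by omega) (by omega))
  have hWDpos : (0 : ℝ) < (W * (D + 1) : ℕ) := by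
    exact_mod_cast Nat.mul_pos (by omega) (by omega)
  set k := Nat.log 2 (W * (D + 1)) with hk
  have hk1 : W * (D + 1) < 2 ^ (k + 1) := Nat.lt_pow_succ_log_self (by norm_num) _
  have hk2 : (k : ℝ) ≤ 2 * (c₁ * Real.log W) := by
    have h1 : 2 ^ k ≤ W * (D + 1) :=
      Nat.pow_log_le_self 2 (Nat.mul_pos (by omega) (by omega)).ne'
    have h2 : ((2 : ℝ)) ^ k ≤ (W * (D + 1) : ℕ) := by exact_mod_cast h1
    have h3 := Real.log_le_log (by positivity) h2
    rw [Real.log_pow] at h3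
    have h4 := Real.log_two_gt_d9
    have h5 : (k : ℝ) * (1 / 2) ≤ k * Real.log 2 := by gcongr; linarith
    linarith
  set Λ : ℕ := 2 * (D + 1) * (2 * k + 4) + 2 with hΛ
  have hΛ0 : (0 : ℝ) < Λ := by exact_mod_cast (by omega : 0 < Λ)
  have hΛ1 : (Λ : ℝ) ≤ c₂ * Real.log W := by
    rw [hΛ, hc₂]
    push_cast
    have h1 : (4 * (D + 1) : ℝ) * k ≤ 4 * (D + 1) * (2 * (c₁ * Real.log W)) := by gcongr
    have h2 : (8 * (D + 1) + 2 : ℝ) * 1 ≤ (8 * (D + 1) + 2) * (2 * Real.log W) := by gcongr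
    linarith
  set t := ⌊(Λ : ℝ) / 2 * Real.log (W * (D + 1) : ℕ)⌋₊ + 1 with ht
  refine ⟨k, t, hk1, ?_, ?_⟩
  · have h1 : (t : ℝ) ≤ (Λ : ℝ) / 2 * Real.log (W * (D + 1) : ℕ) + 1 := by
      rw [ht]
      push_cast
      have := Nat.floor_le (mul_nonneg (div_nonneg hΛ0.le zero_le_two) hlogWD0)
      push_cast at this
      linarith
    have h2 : (Λ : ℝ) / 2 * Real.log (W * (D + 1) : ℕ) ≤
        c₂ * Real.log W / 2 * (c₁ * Real.log W) := by
      apply mul_le_mul _ hlogWD hlogWD0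
      · have := hΛ0.le.trans hΛ1
        linarith
      · linarith
    nlinarith
  · have h1 : (Λ : ℝ) / 2 * Real.log (W * (D + 1) : ℕ) < t := by
      rw [ht]
      push_cast
      exact_mod_cast Nat.lt_floor_add_one _
    have hy : (0 : ℝ) ≤ 1 - 2 / Λ := by
      rw [sub_nonneg]
      apply div_le_one_of_le₀ _ hΛ0.le
      exact_mod_cast (by omega : 2 ≤ Λ)
    have h2 : (1 - 2 / Λ : ℝ) ^ t ≤ Real.exp (-(2 / Λ * t)) := by
      have h3 : (1 - 2 / Λ : ℝ) ≤ Real.exp (-(2 / Λ)) := by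
        have := Real.add_one_le_exp (-(2 / Λ : ℝ))
        linarith
      refine (pow_le_pow_left₀ hy h3 t).trans (le_of_eq ?_)
      rw [← Real.exp_nat_mul]
      congr 1
      ring
    have h4 : Real.log (W * (D + 1) : ℕ) < 2 / Λ * t := by
      rw [div_mul_eq_mul_div, lt_div_iff₀ hΛ0]
      linarith
    have h5 : Real.exp (-(2 / Λ * t)) < ((W * (D + 1) : ℕ) : ℝ)⁻¹ := by
      rw [← Real.exp_log (inv_pos.2 hWDpos), Real.log_inv]
      exact Real.exp_lt_exp.2 (neg_lt_neg h4)
    calc (1 - 2 / Λ : ℝ) ^ t * (W * (D + 1) : ℕ)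
        < ((W * (D + 1) : ℕ) : ℝ)⁻¹ * (W * (D + 1) : ℕ) :=
          mul_lt_mul_of_pos_right (h2.trans_lt h5) hWDpos
      _ = 1 := inv_mul_cancel₀ hWDpos.ne'

/-- Decongestion lemma of Freedman and Hastings: in a connected graph of bounded degree, a generating
set of cycles can be arranged in `O(log² W)` layers that consist of disjoint cycles. -/
theorem exists_cycle_layers (D : ℕ) : ∃ K : ℝ, ∀ (V : Type) [Fintype V] (G : SimpleGraph V),
    2 ≤ Fintype.card V → G.Connected → (∀ v, G.degree v ≤ D) →
    ∃ (t : ℕ) (ls : ℕ → List (Σ v, G.Walk v v)), (t : ℝ) ≤ K * Real.log (Fintype.card V) ^ 2 ∧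
      (∀ i, (∀ c ∈ ls i, c.2.IsCycle) ∧ (ls i).Pairwise DisjointWalks) ∧
      ∀ A : Sym2 V → ZMod 2, (∀ i < t, ∀ c ∈ ls i, (c.2.edges.map A).sum = 0) →
        ∃ φ, IsPotential G A φ := by
  obtain ⟨K, hK⟩ := exists_layer_number D
  refine ⟨K, fun V _ G hW hG hD => ?_⟩
  obtain ⟨k, t, hk, ht, hlt⟩ := hK _ hW
  obtain ⟨ls, hls, hH⟩ := exists_layers (D := D + 1) (fun v => (hD v).trans (Nat.le_succ D)) hk hG
  obtain ⟨H, hconn, hrank, htr⟩ := hH t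
  refine ⟨t, ls, ht, hls, fun A hA => ?_⟩
  have hrankG : (cycleRank G : ℝ) ≤ (Fintype.card V * (D + 1) : ℕ) := by
    have h1 := sum_degIn_univ G
    have h2 : ∑ v, degIn G Finset.univ v ≤ Fintype.card V * D := by
      refine (Finset.sum_le_card_nsmul _ _ D fun v _ => ?_).trans (le_of_eq ?_)
      · rw [degIn_univ]; exact hD v
      · rw [smul_eq_mul, Finset.card_univ]
    have h3 : cycleRank G ≤ (Fintype.card V * (D + 1) : ℕ) := by
      unfold cycleRank
      push_cast
      have : (2 * G.edgeSet.ncard : ℤ) ≤ Fintype.card V * D := by rw [h1] at h2; exact_mod_cast h2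
      nlinarith
    exact_mod_cast h3
  have hy : (0 : ℝ) ≤ 1 - 2 / (2 * (D + 1) * (2 * k + 4) + 2 : ℕ) := by
    rw [sub_nonneg]
    apply div_le_one_of_le₀ _ (Nat.cast_nonneg _)
    exact_mod_cast (by omega : 2 ≤ 2 * (D + 1) * (2 * k + 4) + 2)
  have h1 : (cycleRank H : ℝ) < 1 :=
    (hrank.trans (mul_le_mul_of_nonneg_left hrankG (pow_nonneg hy t))).trans_lt hlt
  have h2 : cycleRank H < 1 := by exact_mod_cast h1
  obtain ⟨φ, hφ⟩ := exists_isPotential_of_tree hconn (by unfold cycleRank at h2; omega) A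
  exact ⟨φ, htr A hA φ hφ⟩

end Decongestion

/-! ### Generating sets of cycles and exactness -/

section Duality

variable {V κ : Type*} [Fintype V] {H : SimpleGraph V}

/-- A family of closed edge sets generates the cycle space if all cochains with zero flux through them
are exact: otherwise some linear functional, that is, some cochain, would vanish on the family but not
on the cycle space, on which coboundaries vanish. -/
theorem generatesCycles_of_isFluxExact {c : κ → Set (Sym2 V)} (hc : ∀ p, c p ⊆ H.edgeSet)
    (hclosed : ∀ p, boundary H (fun e : H.edgeSet => if (e : Sym2 V) ∈ c p then 1 else 0) = 0)
    (hX : IsFluxExact H c) : GeneratesCycles H c := by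
  refine ⟨hc, le_antisymm ?_ ?_⟩
  · rw [Submodule.span_le]
    rintro _ ⟨p, rfl⟩
    exact hclosed p
  · intro f hf
    by_contra hnot
    obtain ⟨L, hLf, hL⟩ := Submodule.exists_le_ker_of_notMem hnot
    have hLsum : ∀ g : H.edgeSet → ZMod 2, L g = ∑ e, g e * L (Pi.single e 1) := by
      intro g
      conv_lhs => rw [pi_eq_sum_univ' g, map_sum]
      refine Finset.sum_congr rfl fun e _ => ?_
      rw [map_smul, smul_eq_mul]
    obtain ⟨φ, hφ⟩ := hX (fun e => L (Pi.single e 1)) fun p => by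
      have h1 : L (fun e : H.edgeSet => if (e : Sym2 V) ∈ c p then 1 else 0) = 0 :=
        hL (Submodule.subset_span ⟨p, rfl⟩)
      rw [hLsum] at h1
      refine Eq.trans (Finset.sum_congr rfl fun e _ => ?_) h1
      split_ifs <;> simp
    apply hLf
    rw [hLsum]
    have h1 : ∀ e : H.edgeSet, L (Pi.single e 1) = ∑ w, if w ∈ (e : Sym2 V) then φ w else 0 := by
      rintro ⟨e, he⟩
      induction e with
      | _ u v => exact (hφ u v he).trans (sum_endpoints (SimpleGraph.Adj.ne he) φ).symm
    simp only [h1, Finset.mul_sum]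
    rw [Finset.sum_comm]
    refine Finset.sum_eq_zero fun w _ => ?_
    have h2 : boundary H f w = 0 := congrFun (LinearMap.mem_ker.1 hf) w
    rw [boundary_apply] at h2
    calc _ = φ w * ∑ e : H.edgeSet, (if w ∈ (e : Sym2 V) then f e else 0) := by
          rw [Finset.mul_sum]
          exact Finset.sum_congr rfl fun e _ => by split_ifs <;> ring
      _ = 0 := by rw [h2, mul_zero]

theorem sum_edges_eq_of_nodup {l : List (Sym2 V)} (hl : l.Nodup) (hH : ∀ e ∈ l, e ∈ H.edgeSet)
    (A : Sym2 V → ZMod 2) :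
    ∑ e : H.edgeSet, (if (e : Sym2 V) ∈ l then A e else 0) = (l.map A).sum := by
  rw [← List.sum_toFinset A hl, ← Finset.sum_filter]
  refine Finset.sum_bij (fun e _ => (e : Sym2 V)) ?_ ?_ ?_ ?_
  · intro e he
    exact List.mem_toFinset.2 (Finset.mem_filter.1 he).2
  · intro e _ e' _ h
    exact Subtype.ext h
  · intro e he
    rw [List.mem_toFinset] at he
    exact ⟨⟨e, hH e he⟩, Finset.mem_filter.2 ⟨Finset.mem_univ _, he⟩, rfl⟩
  · intro e _; rfl

/-- The edge set of a cycle is closed. -/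
theorem boundary_isCycle {v : V} {c : H.Walk v v} (hc : c.IsCycle) :
    boundary H (fun e : H.edgeSet => if (e : Sym2 V) ∈ c.edges then 1 else 0) = 0 := by
  funext w
  rw [boundary_apply]
  have h1 := sum_edges_eq_of_nodup hc.edges_nodup (fun e he => c.edges_subset_edgeSet he)
    (fun e => if w ∈ e then 1 else 0)
  have h2 : IsPotential H (fun e => if w ∈ e then (1 : ZMod 2) else 0)
      (fun v => if w = v then 1 else 0) := by
    intro u v huv
    by_cases hu : w = u
    · subst hu
      simp [huv.ne]
    · simp [hu]
  rw [h2.sum_edges c fun e he => c.edges_subset_edgeSet he, CharTwo.add_self_eq_zero] at h1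
  refine Eq.trans (Finset.sum_congr rfl fun e _ => ?_) h1
  split_ifs <;> rfl

/-- The cycles of the base graph are regarded as faces. -/
theorem isFluxExact_cycles {n : ℕ} {root : Fin n → V} {c : ∀ j, H.Walk (root j) (root j)}
    (hc : ∀ j, (c j).IsCycle)
    (hX : ∀ A : Sym2 V → ZMod 2, (∀ j, ((c j).edges.map A).sum = 0) → ∃ φ, IsPotential H A φ) :
    IsFluxExact H (fun j => {e | e ∈ (c j).edges}) := by
  intro A hA
  obtain ⟨φ, hφ⟩ := hX (fun e => if h : e ∈ H.edgeSet then A ⟨e, h⟩ else 0) fun j => by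
    rw [← sum_edges_eq_of_nodup (hc j).edges_nodup fun e he => (c j).edges_subset_edgeSet he]
    refine Eq.trans (Finset.sum_congr rfl fun e _ => ?_) (hA j)
    rw [dif_pos e.2]
    by_cases h : (e : Sym2 V) ∈ (c j).edges
    · exact (if_pos h).trans (if_pos h).symm
    · exact (if_neg h).trans (if_neg h).symm
  refine ⟨φ, fun u v h => ?_⟩
  rw [← hφ u v h]
  have h' : s(u, v) ∈ H.edgeSet := h
  simp only [dif_pos h']

theorem generatesCycles_cycles {n : ℕ} {root : Fin n → V} {c : ∀ j, H.Walk (root j) (root j)}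
    (hc : ∀ j, (c j).IsCycle)
    (hX : ∀ A : Sym2 V → ZMod 2, (∀ j, ((c j).edges.map A).sum = 0) → ∃ φ, IsPotential H A φ) :
    GeneratesCycles H (fun j => {e | e ∈ (c j).edges}) :=
  generatesCycles_of_isFluxExact (fun j _ he => (c j).edges_subset_edgeSet he)
    (fun j => by convert boundary_isCycle (hc j); exact Iff.rfl) (isFluxExact_cycles hc hX)

theorem sum_edges_eq_sum_range {V : Type*} {H : SimpleGraph V} (A : Sym2 V → ZMod 2) {u v : V}
    (p : H.Walk u v) :
    (p.edges.map A).sum = ∑ i ∈ Finset.range p.length, A s(p.getVert i, p.getVert (i + 1)) := by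
  induction p with
  | nil => simp
  | cons h p ih =>
    rw [SimpleGraph.Walk.edges_cons, List.map_cons, List.sum_cons, ih, SimpleGraph.Walk.length_cons,
      Finset.sum_range_succ']
    rw [add_comm]
    simp [SimpleGraph.Walk.getVert_cons_succ]

end Duality

/-! ### The layered graph -/

namespace LayeredGraph

section Zigzag

variable {V : Type*} (G : LayeredGraph V)

/-- The zigzag enumeration visits every vertex of the cycle once. -/
theorem zigzag_injOn (j : Fin G.numCycles) {k k' : ℕ} (hk : k < (G.cycle j).length)
    (hk' : k' < (G.cycle j).length) (h : G.zigzag j k = G.zigzag j k') : k = k' := by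
  have h1 := (G.isCycle j).getVert_injOn'
    (show (if Even k then (G.cycle j).length - 1 - k / 2 else k / 2) ≤ (G.cycle j).length - 1 by
      split_ifs <;> omega)
    (show (if Even k' then (G.cycle j).length - 1 - k' / 2 else k' / 2) ≤
      (G.cycle j).length - 1 by split_ifs <;> omega) h
  split_ifs at h1 with h2 h3 h3
  · rw [Nat.even_iff] at h2 h3; omega
  · rw [Nat.even_iff] at h2 h3; omega
  · rw [Nat.even_iff] at h2 h3; omega
  · rw [Nat.even_iff] at h2 h3; omega

theorem zigzag_mem_support (j : Fin G.numCycles) (k : ℕ) : G.zigzag j k ∈ (G.cycle j).support :=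
  SimpleGraph.Walk.getVert_mem_support _ _

theorem three_le_length (j : Fin G.numCycles) : 3 ≤ (G.cycle j).length := (G.isCycle j).three_le_length

/-- Vertices at distance two in the zigzag enumeration are neighbours on the cycle. -/
theorem zigzag_edge_two (j : Fin G.numCycles) {k : ℕ} (hk : k + 2 < (G.cycle j).length) :
    s(G.zigzag j k, G.zigzag j (k + 2)) =
      s((G.cycle j).getVert (if Even k then (G.cycle j).length - 2 - k / 2 else k / 2),
        (G.cycle j).getVert ((if Even k then (G.cycle j).length - 2 - k / 2 else k / 2) + 1)) := by
  unfold zigzag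
  by_cases h : Even k
  · have h' : Even (k + 2) := by rw [Nat.even_iff] at h ⊢; omega
    rw [if_pos h, if_pos h', if_pos h, Sym2.eq_swap,
      show (G.cycle j).length - 1 - (k + 2) / 2 = (G.cycle j).length - 2 - k / 2 by omega,
      show (G.cycle j).length - 1 - k / 2 = (G.cycle j).length - 2 - k / 2 + 1 by omega]
  · have h' : ¬ Even (k + 2) := by rw [Nat.even_iff] at h ⊢; omega
    rw [if_neg h, if_neg h', if_neg h, show (k + 2) / 2 = k / 2 + 1 by omega]

/-- The first edge of the zigzag enumeration lies on the cycle. -/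
theorem zigzag_edge_first (j : Fin G.numCycles) : s(G.zigzag j 0, G.zigzag j 1) =
    s((G.cycle j).getVert ((G.cycle j).length - 1),
      (G.cycle j).getVert ((G.cycle j).length - 1 + 1)) := by
  have h3 := G.three_le_length j
  rw [Nat.sub_add_cancel (by omega), SimpleGraph.Walk.getVert_length]
  simp [zigzag]

/-- The last edge of the zigzag enumeration lies on the cycle. -/
theorem zigzag_edge_last (j : Fin G.numCycles) {k : ℕ} (hk : k + 2 = (G.cycle j).length) :
    s(G.zigzag j k, G.zigzag j (k + 1)) =
      s((G.cycle j).getVert (k / 2), (G.cycle j).getVert (k / 2 + 1)) := by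
  unfold zigzag
  by_cases h : Even k
  · have h' : ¬ Even (k + 1) := by rw [Nat.even_iff] at h ⊢; omega
    rw [if_pos h, if_neg h', Sym2.eq_swap]
    rw [Nat.even_iff] at h
    rw [show (k + 1) / 2 = k / 2 by omega,
      show (G.cycle j).length - 1 - k / 2 = k / 2 + 1 by omega]
  · have h' : Even (k + 1) := by rw [Nat.even_iff] at h ⊢; omega
    rw [if_neg h, if_pos h']
    rw [Nat.even_iff] at h
    rw [show (G.cycle j).length - 1 - (k + 1) / 2 = k / 2 + 1 by omega]

theorem base_adj_zigzag_two (j : Fin G.numCycles) {k : ℕ} (hk : k + 2 < (G.cycle j).length) :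
    G.base.Adj (G.zigzag j k) (G.zigzag j (k + 2)) := by
  rw [← SimpleGraph.mem_edgeSet, zigzag_edge_two G j hk]
  exact (G.cycle j).adj_getVert_succ (by split_ifs <;> omega)

theorem base_adj_zigzag_first (j : Fin G.numCycles) :
    G.base.Adj (G.zigzag j 0) (G.zigzag j 1) := by
  have h3 := G.three_le_length j
  rw [← SimpleGraph.mem_edgeSet, zigzag_edge_first]
  exact (G.cycle j).adj_getVert_succ (by omega)

/-- A cochain that vanishes on the triangles of the cellulation of a cycle vanishes on the cycle. -/
theorem sum_cycle_eq_zero_of_triangles (j : Fin G.numCycles) (A : Sym2 V → ZMod 2)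
    (hA : ∀ k, k + 2 < (G.cycle j).length → A s(G.zigzag j k, G.zigzag j (k + 1)) +
      A s(G.zigzag j (k + 1), G.zigzag j (k + 2)) + A s(G.zigzag j k, G.zigzag j (k + 2)) = 0) :
    ((G.cycle j).edges.map A).sum = 0 := by
  set N := (G.cycle j).length with hN
  have h3 : 3 ≤ N := G.three_le_length j
  set f : ℕ → ZMod 2 := fun i => A s((G.cycle j).getVert i, (G.cycle j).getVert (i + 1)) with hf
  set P : ℕ → ZMod 2 := fun n => ∑ i ∈ Finset.range n, f i with hP
  have hPs : ∀ n, P (n + 1) = P n + f n := fun n => Finset.sum_range_succ _ _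
  -- the zigzag edges cut off arcs of the cycle
  have harc : ∀ k, k + 1 < N → A s(G.zigzag j k, G.zigzag j (k + 1)) =
      P N + P (N - 1 - (k + 1) / 2) + P (k / 2) := by
    intro k
    induction k with
    | zero =>
      intro _
      rw [zigzag_edge_first, ← hN]
      have h1 := hPs (N - 1)
      rw [Nat.sub_add_cancel (by omega)] at h1
      have h2 : P 0 = 0 := Finset.sum_range_zero _
      simp only [zero_add, Nat.reduceDiv, Nat.sub_zero, h1, h2, add_zero]
      linear_combination -CharTwo.add_self_eq_zero (P (N - 1))
    | succ k ih =>
      intro hk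
      have h1 := hA k (by omega)
      rw [ih (by omega), zigzag_edge_two G j (by omega), ← hN] at h1
      change _ + _ + f (if Even k then N - 2 - k / 2 else k / 2) = 0 at h1
      by_cases h : Even k
      · rw [if_pos h] at h1
        rw [Nat.even_iff] at h
        have h2 := hPs (N - 2 - k / 2)
        rw [show N - 2 - k / 2 + 1 = N - 1 - (k + 1) / 2 by omega] at h2
        rw [show N - 1 - (k + 1 + 1) / 2 = N - 2 - k / 2 by omega,
          show (k + 1) / 2 = k / 2 by omega]
        rw [h2] at h1
        linear_combination h1 - CharTwo.add_self_eq_zero (P N + P (N - 2 - k / 2) + P (k / 2)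
          + f (N - 2 - k / 2))
      · rw [if_neg h] at h1
        rw [Nat.even_iff] at h
        have h2 := hPs (k / 2)
        rw [show k / 2 + 1 = (k + 1) / 2 by omega] at h2
        rw [show (k + 1 + 1) / 2 = (k + 1) / 2 by omega, h2]
        linear_combination h1 - CharTwo.add_self_eq_zero
          (P N + P (N - 1 - (k + 1) / 2) + P (k / 2) + f (k / 2))
  have hlast := harc (N - 2) (by omega)
  rw [zigzag_edge_last G j (by omega)] at hlast
  change f ((N - 2) / 2) = _ at hlast
  rw [show N - 1 - (N - 2 + 1) / 2 = (N - 2) / 2 + 1 by omega, hPs] at hlast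
  rw [sum_edges_eq_sum_range]
  change P N = 0
  linear_combination -hlast - CharTwo.add_self_eq_zero (P ((N - 2) / 2))

end Zigzag
end LayeredGraph

theorem sum_edges_eq_of_eq_setOf {V : Type*} [Fintype V] {H : SimpleGraph V} {c : Set (Sym2 V)}
    {l : List (Sym2 V)} (hl : l.Nodup) (hc : c = {e | e ∈ l}) (hH : ∀ e ∈ l, e ∈ H.edgeSet)
    (A : Sym2 V → ZMod 2) :
    ∑ e : H.edgeSet, (if (e : Sym2 V) ∈ c then A e else 0) = (l.map A).sum := by
  rw [← sum_edges_eq_of_nodup hl hH A]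
  refine Finset.sum_congr rfl fun e _ => ?_
  have h : (e : Sym2 V) ∈ c ↔ (e : Sym2 V) ∈ l := by rw [hc]; exact Iff.rfl
  by_cases he : (e : Sym2 V) ∈ c
  · rw [if_pos he, if_pos (h.1 he)]
  · rw [if_neg he, if_neg (mt h.2 he)]

theorem ite_mem_mk {V : Type*} [DecidableEq V] {a b : V} (h : a ≠ b) (v : V)
    [Decidable (v ∈ s(a, b))] :
    (if v ∈ s(a, b) then (1 : ZMod 2) else 0) = (if v = a then 1 else 0) + if v = b then 1 else 0 := by
  by_cases ha : v = a
  · subst ha; simp [h]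
  · simp [ha]

namespace LayeredGraph

section Adjacency

variable {V : Type*} (G : LayeredGraph V)

theorem adj_layer (i : Fin (G.R + 1)) {u v : V} (h : G.base.Adj u v) : G.graph.Adj (i, u) (i, v) :=
  (SimpleGraph.fromRel_adj _ _ _).2 ⟨fun h' => h.ne (Prod.mk.inj h').2, Or.inl (Or.inl ⟨rfl, h⟩)⟩

theorem adj_vertical (m : Fin G.R) (v : V) : G.graph.Adj (m.castSucc, v) (m.succ, v) :=
  (SimpleGraph.fromRel_adj _ _ _).2 ⟨fun h' => m.castSucc_lt_succ.ne (Prod.mk.inj h').1,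
    Or.inl (Or.inr (Or.inl ⟨rfl, rfl⟩))⟩

theorem adj_zigzag (j : Fin G.numCycles) {k : ℕ} (hk : k + 1 < (G.cycle j).length) :
    G.graph.Adj ((G.layer j).succ, G.zigzag j k) ((G.layer j).succ, G.zigzag j (k + 1)) :=
  (SimpleGraph.fromRel_adj _ _ _).2
    ⟨fun h' => absurd (G.zigzag_injOn j (by omega) hk (Prod.mk.inj h').2) (by omega),
      Or.inl (Or.inr (Or.inr ⟨rfl, j, k, rfl, hk, rfl, rfl⟩))⟩

/-- To prove a symmetric property of the edges it suffices to consider the edges of the layers, the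
vertical edges and the zigzag edges. -/
theorem adj_induction {P : G.Vert → G.Vert → Prop} (hsymm : ∀ a b, P a b → P b a)
    (hlayer : ∀ i u v, G.base.Adj u v → P (i, u) (i, v))
    (hvert : ∀ (m : Fin G.R) v, P (m.castSucc, v) (m.succ, v))
    (hzig : ∀ j k, k + 1 < (G.cycle j).length →
      P ((G.layer j).succ, G.zigzag j k) ((G.layer j).succ, G.zigzag j (k + 1)))
    {a b : G.Vert} (h : G.graph.Adj a b) : P a b := by
  have key : ∀ a b : G.Vert, ((a.1 = b.1 ∧ G.base.Adj a.2 b.2) ∨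
      (a.2 = b.2 ∧ (a.1 : ℕ) + 1 = (b.1 : ℕ)) ∨
      (a.1 = b.1 ∧ ∃ (j : Fin G.numCycles) (k : ℕ), a.1 = (G.layer j).succ ∧
        k + 1 < (G.cycle j).length ∧ a.2 = G.zigzag j k ∧ b.2 = G.zigzag j (k + 1))) → P a b := by
    rintro ⟨i, u⟩ ⟨i', v⟩ (⟨h1, h2⟩ | ⟨h1, h2⟩ | ⟨h1, j, k, h2, h3, h4, h5⟩)
    · obtain rfl : i = i' := h1
      exact hlayer _ _ _ h2
    · obtain rfl : u = v := h1
      have h2 : (i : ℕ) + 1 = i' := h2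
      have h3 := i'.2
      obtain ⟨m, rfl⟩ : ∃ m : Fin G.R, m.castSucc = i := ⟨⟨i, by omega⟩, rfl⟩
      obtain rfl : m.succ = i' := Fin.ext h2
      exact hvert m u
    · obtain rfl : i = i' := h1
      obtain rfl : i = _ := h2
      obtain rfl : u = _ := h4
      obtain rfl : v = _ := h5
      exact hzig j k h3
  rcases ((SimpleGraph.fromRel_adj _ _ _).1 h).2 with h | h
  · exact key _ _ h
  · exact hsymm _ _ (key _ _ h)

theorem connected (h : G.base.Connected) : G.graph.Connected := by
  have h0 : ∀ n (hn : n < G.R + 1) v, G.graph.Reachable (0, v) (⟨n, hn⟩, v) := by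
    intro n
    induction n with
    | zero => intro _ v; exact SimpleGraph.Reachable.refl _
    | succ n ih =>
      intro hn v
      exact (ih (by omega) v).trans (G.adj_vertical ⟨n, by omega⟩ v).reachable
  have h1 : ∀ u v, G.graph.Reachable (0, u) (0, v) := fun u v =>
    (h.preconnected u v).map (⟨fun v => (0, v), fun h => G.adj_layer 0 h⟩ : G.base →g G.graph)
  have := h.nonempty
  refine SimpleGraph.Connected.mk ?_
  rintro ⟨i, u⟩ ⟨i', v⟩
  exact (h0 i i.2 u).symm.trans ((h1 u v).trans (h0 i' i'.2 v))

end Adjacency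

section Faces

variable {V : Type*} (G : LayeredGraph V)

/-- The edges of a square. -/
def squareEdges (m : Fin G.R) (u v : V) : List (Sym2 G.Vert) :=
  [s((m.castSucc, u), (m.castSucc, v)), s((m.succ, u), (m.succ, v)),
    s((m.castSucc, u), (m.succ, u)), s((m.castSucc, v), (m.succ, v))]

/-- The edges of a triangle of the cellulation of a cycle. -/
def triangleEdges (j : Fin G.numCycles) (k : ℕ) : List (Sym2 G.Vert) :=
  [s(((G.layer j).succ, G.zigzag j k), ((G.layer j).succ, G.zigzag j (k + 1))),
    s(((G.layer j).succ, G.zigzag j (k + 1)), ((G.layer j).succ, G.zigzag j (k + 2))),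
    s(((G.layer j).succ, G.zigzag j k), ((G.layer j).succ, G.zigzag j (k + 2)))]

theorem faceEdges_square (m : Fin G.R) {u v : V} (h : s(u, v) ∈ G.base.edgeSet) :
    G.faceEdges (.inl (m, ⟨s(u, v), h⟩)) = {e | e ∈ G.squareEdges m u v} := by
  ext e
  simp only [faceEdges, squareEdges, Sym2.map_mk, Set.mem_union, Set.mem_insert_iff,
    Set.mem_singleton_iff, Set.mem_ofPred_eq, Sym2.mem_iff, List.mem_cons, List.not_mem_nil, or_false,
    exists_eq_or_imp, exists_eq_left, or_assoc]

theorem faceEdges_triangle (j : Fin G.numCycles) (k : Fin ((G.cycle j).length - 2)) :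
    G.faceEdges (.inr ⟨j, k⟩) = {e | e ∈ G.triangleEdges j k} := by
  ext e
  simp only [faceEdges, triangleEdges, Set.mem_insert_iff, Set.mem_singleton_iff, Set.mem_ofPred_eq,
    List.mem_cons, List.not_mem_nil, or_false]

theorem nodup_squareEdges (m : Fin G.R) {u v : V} (h : u ≠ v) : (G.squareEdges m u v).Nodup := by
  have h1 := m.castSucc_lt_succ.ne
  have h2 := h1.symm
  have h3 := h.symm
  simp only [squareEdges, List.nodup_cons, List.mem_cons, List.not_mem_nil, or_false, Sym2.eq_iff,
    Prod.mk.injEq]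
  tauto

theorem nodup_triangleEdges (j : Fin G.numCycles) {k : ℕ} (hk : k + 2 < (G.cycle j).length) :
    (G.triangleEdges j k).Nodup := by
  have h1 : G.zigzag j k ≠ G.zigzag j (k + 1) := fun h =>
    absurd (G.zigzag_injOn j (by omega) (by omega) h) (by omega)
  have h2 : G.zigzag j (k + 1) ≠ G.zigzag j (k + 2) := fun h =>
    absurd (G.zigzag_injOn j (by omega) (by omega) h) (by omega)
  have h3 : G.zigzag j k ≠ G.zigzag j (k + 2) := fun h =>
    absurd (G.zigzag_injOn j (by omega) (by omega) h) (by omega)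
  have h1' := h1.symm
  have h2' := h2.symm
  have h3' := h3.symm
  simp only [triangleEdges, List.nodup_cons, List.mem_cons, List.not_mem_nil, or_false, Sym2.eq_iff,
    Prod.mk.injEq]
  tauto

theorem squareEdges_subset (m : Fin G.R) {u v : V} (h : G.base.Adj u v) :
    ∀ e ∈ G.squareEdges m u v, e ∈ G.graph.edgeSet := by
  simp only [squareEdges, List.forall_mem_cons, SimpleGraph.mem_edgeSet]
  exact ⟨G.adj_layer _ h, G.adj_layer _ h, G.adj_vertical m u, G.adj_vertical m v, by simp⟩

theorem triangleEdges_subset (j : Fin G.numCycles) {k : ℕ} (hk : k + 2 < (G.cycle j).length) :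
    ∀ e ∈ G.triangleEdges j k, e ∈ G.graph.edgeSet := by
  simp only [triangleEdges, List.forall_mem_cons, SimpleGraph.mem_edgeSet]
  exact ⟨G.adj_zigzag j (by omega), G.adj_zigzag j (by omega),
    G.adj_layer _ (G.base_adj_zigzag_two j hk), by simp⟩

/-- A face is a closed list of at most four edges. -/
theorem exists_list_faceEdges (p : G.Face) : ∃ l : List (Sym2 G.Vert), l.Nodup ∧ l.length ≤ 4 ∧
    (∀ e ∈ l, e ∈ G.graph.edgeSet) ∧ G.faceEdges p = {e | e ∈ l} ∧
    ∀ a : G.Vert, (l.map fun e => if a ∈ e then (1 : ZMod 2) else 0).sum = 0 := by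
  rcases p with ⟨m, ⟨e, he⟩⟩ | ⟨j, k⟩
  · induction e with
    | _ u v =>
      have h := squareEdges_subset G m he
      refine ⟨_, G.nodup_squareEdges m (SimpleGraph.Adj.ne he), le_rfl, h,
        G.faceEdges_square m he, fun a => ?_⟩
      simp only [squareEdges, List.forall_mem_cons, SimpleGraph.mem_edgeSet] at h
      simp only [squareEdges, List.map_cons, List.map_nil, List.sum_cons, List.sum_nil,
        ite_mem_mk h.1.ne, ite_mem_mk h.2.1.ne, ite_mem_mk h.2.2.1.ne, ite_mem_mk h.2.2.2.1.ne]
      generalize (if a = (m.castSucc, u) then (1 : ZMod 2) else 0) = x1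
      generalize (if a = (m.castSucc, v) then (1 : ZMod 2) else 0) = x2
      generalize (if a = (m.succ, u) then (1 : ZMod 2) else 0) = x3
      generalize (if a = (m.succ, v) then (1 : ZMod 2) else 0) = x4
      linear_combination CharTwo.add_self_eq_zero (x1 + x2 + x3 + x4)
  · have hk := k.2
    have hk' : (k : ℕ) + 2 < (G.cycle j).length := by omega
    have h := triangleEdges_subset G j hk'
    refine ⟨_, G.nodup_triangleEdges j hk', by simp [triangleEdges], h, G.faceEdges_triangle j k,
      fun a => ?_⟩
    simp only [triangleEdges, List.forall_mem_cons, SimpleGraph.mem_edgeSet] at h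
    simp only [triangleEdges, List.map_cons, List.map_nil, List.sum_cons, List.sum_nil,
      ite_mem_mk h.1.ne, ite_mem_mk h.2.1.ne, ite_mem_mk h.2.2.1.ne]
    generalize (if a = ((G.layer j).succ, G.zigzag j k) then (1 : ZMod 2) else 0) = x1
    generalize (if a = ((G.layer j).succ, G.zigzag j (k + 1)) then (1 : ZMod 2) else 0) = x2
    generalize (if a = ((G.layer j).succ, G.zigzag j (k + 2)) then (1 : ZMod 2) else 0) = x3
    linear_combination CharTwo.add_self_eq_zero (x1 + x2 + x3)

theorem faceEdges_subset (p : G.Face) : G.faceEdges p ⊆ G.graph.edgeSet := by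
  obtain ⟨l, -, -, h, hl, -⟩ := G.exists_list_faceEdges p
  rw [hl]
  exact h

theorem ncard_faceEdges_le (p : G.Face) : (G.faceEdges p).ncard ≤ 4 := by
  obtain ⟨l, -, h, -, hl, -⟩ := G.exists_list_faceEdges p
  rw [hl, ← List.coe_toFinset, Set.ncard_coe_finset]
  exact (List.toFinset_card_le l).trans h

theorem boundary_faceEdges [Fintype V] (p : G.Face) :
    boundary G.graph (fun e => if (e : Sym2 G.Vert) ∈ G.faceEdges p then 1 else 0) = 0 := by
  obtain ⟨l, hl, -, h, hp, h0⟩ := G.exists_list_faceEdges p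
  funext a
  rw [boundary_apply, Pi.zero_apply]
  refine Eq.trans (Finset.sum_congr rfl fun e _ => ?_)
    ((sum_edges_eq_of_eq_setOf hl hp h fun e => if a ∈ e then 1 else 0).trans (h0 a))
  split_ifs <;> rfl

end Faces

section Exactness

variable {V : Type*} [Fintype V] (G : LayeredGraph V)

/-- Squares let a cochain without flux be moved from any layer to layer `0`. There its sums along the
cellulated cycles vanish, because each of these cycles is filled by triangles in its own layer. So a
generating set of cycles of the base graph makes the layered graph exact. -/
theorem isFluxExact
    (hbase : ∀ A : Sym2 V → ZMod 2, (∀ j, ((G.cycle j).edges.map A).sum = 0) →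
      ∃ φ, IsPotential G.base A φ) : IsFluxExact G.graph G.faceEdges := by
  intro A hA
  set B : Sym2 G.Vert → ZMod 2 := fun x => if h : x ∈ G.graph.edgeSet then A ⟨x, h⟩ else 0 with hB
  have hBA : ∀ e : G.graph.edgeSet, B e = A e := fun e => dif_pos e.2
  have hflux : ∀ p, ∑ e : G.graph.edgeSet, (if (e : Sym2 G.Vert) ∈ G.faceEdges p then B e else 0) = 0 :=
    fun p => by simp only [hBA]; exact hA p
  have hsq : ∀ (m : Fin G.R) u v, G.base.Adj u v →
      B s((m.castSucc, u), (m.castSucc, v)) + (B s((m.succ, u), (m.succ, v)) +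
        (B s((m.castSucc, u), (m.succ, u)) + B s((m.castSucc, v), (m.succ, v)))) = 0 := by
    intro m u v h
    have h1 := hflux (.inl (m, ⟨s(u, v), h⟩))
    rw [sum_edges_eq_of_eq_setOf (G.nodup_squareEdges m h.ne) (G.faceEdges_square m h)
      (G.squareEdges_subset m h) B] at h1
    simpa only [squareEdges, List.map_cons, List.map_nil, List.sum_cons, List.sum_nil, add_zero]
      using h1
  have htri : ∀ j k, k + 2 < (G.cycle j).length →
      B s(((G.layer j).succ, G.zigzag j k), ((G.layer j).succ, G.zigzag j (k + 1))) +
      B s(((G.layer j).succ, G.zigzag j (k + 1)), ((G.layer j).succ, G.zigzag j (k + 2))) +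
      B s(((G.layer j).succ, G.zigzag j k), ((G.layer j).succ, G.zigzag j (k + 2))) = 0 := by
    intro j k hk
    have h1 := hflux (.inr ⟨j, ⟨k, by omega⟩⟩)
    rw [sum_edges_eq_of_eq_setOf (G.nodup_triangleEdges j hk) (G.faceEdges_triangle j _)
      (G.triangleEdges_subset j hk) B] at h1
    simpa only [triangleEdges, List.map_cons, List.map_nil, List.sum_cons, List.sum_nil, add_zero,
      add_assoc] using h1
  -- `ψ n v` is the sum of the cochain along the vertical path from layer `0` to layer `n` at `v`
  set ψ : ℕ → V → ZMod 2 := fun n v =>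
    ∑ m : Fin G.R, if (m : ℕ) < n then B s((m.castSucc, v), (m.succ, v)) else 0 with hψ
  have hψ0 : ∀ v, ψ 0 v = 0 := fun v => Finset.sum_eq_zero fun m _ => if_neg (Nat.not_lt_zero _)
  have hψs : ∀ (m : Fin G.R) v, ψ (m + 1) v = ψ m v + B s((m.castSucc, v), (m.succ, v)) := by
    intro m v
    have h1 : B s((m.castSucc, v), (m.succ, v)) =
        ∑ m' : Fin G.R, if m' = m then B s((m'.castSucc, v), (m'.succ, v)) else 0 := by simp
    rw [h1, ← Finset.sum_add_distrib]
    refine Finset.sum_congr rfl fun m' _ => ?_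
    rcases lt_trichotomy (m' : ℕ) m with h | h | h
    · have h2 : m' ≠ m := fun h' => h.ne (congrArg Fin.val h')
      rw [if_pos (by omega), if_pos h, if_neg h2, add_zero]
    · rw [if_pos (by omega), if_neg (by omega), if_pos (Fin.ext h), zero_add]
    · have h2 : m' ≠ m := fun h' => h.ne' (congrArg Fin.val h')
      rw [if_neg (by omega), if_neg (by omega), if_neg h2, add_zero]
  have hlay : ∀ n (hn : n < G.R + 1) u v, G.base.Adj u v →
      B s((⟨n, hn⟩, u), (⟨n, hn⟩, v)) = B s((0, u), (0, v)) + (ψ n u + ψ n v) := by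
    intro n
    induction n with
    | zero => intro _ u v _; rw [hψ0, hψ0, add_zero, add_zero]; rfl
    | succ n ih =>
      intro hn u v h
      have h1 := hsq ⟨n, by omega⟩ u v h
      have h2 := hψs ⟨n, by omega⟩ u
      have h3 := hψs ⟨n, by omega⟩ v
      have h4 := ih (by omega) u v h
      simp only [Fin.castSucc_mk, Fin.succ_mk] at h1 h2 h3
      rw [h4] at h1
      rw [h2, h3]
      linear_combination h1 - CharTwo.add_self_eq_zero (B s((0, u), (0, v)) + ψ n u + ψ n v +
        B s((⟨n, by omega⟩, u), (⟨n + 1, hn⟩, u)) + B s((⟨n, by omega⟩, v), (⟨n + 1, hn⟩, v)))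
  obtain ⟨φ, hφ⟩ := hbase (fun e => B (Sym2.map (fun v => (0, v)) e)) fun j => by
    have h1 := G.sum_cycle_eq_zero_of_triangles j
      (fun e => B (Sym2.map (fun v => ((G.layer j).succ, v)) e)) (htri j)
    have h2 : IsPotential G.base (fun e => B (Sym2.map (fun v => ((G.layer j).succ, v)) e) +
        B (Sym2.map (fun v => (0, v)) e)) (ψ (G.layer j).succ) := by
      intro u v h
      have h3 := hlay _ (G.layer j).succ.2 u v h
      simp only [Sym2.map_mk]
      rw [show (⟨_, (G.layer j).succ.2⟩ : Fin (G.R + 1)) = (G.layer j).succ from rfl] at h3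
      rw [h3]
      linear_combination CharTwo.add_self_eq_zero (B s((0, u), (0, v)))
    have h3 := h2.sum_edges (G.cycle j) fun e he => (G.cycle j).edges_subset_edgeSet he
    rw [CharTwo.add_self_eq_zero, List.sum_map_add, h1, zero_add] at h3
    exact h3
  have hlayer : ∀ (i : Fin (G.R + 1)) u v, G.base.Adj u v →
      B s((i, u), (i, v)) = (φ u + ψ i u) + (φ v + ψ i v) := by
    intro i u v h
    have h1 : B s((0, u), (0, v)) = φ u + φ v := hφ u v h
    rw [hlay i i.2 u v h, h1]
    ring
  have hzig : ∀ j k, k + 1 < (G.cycle j).length →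
      B s(((G.layer j).succ, G.zigzag j k), ((G.layer j).succ, G.zigzag j (k + 1))) =
        (φ (G.zigzag j k) + ψ (G.layer j).succ (G.zigzag j k)) +
        (φ (G.zigzag j (k + 1)) + ψ (G.layer j).succ (G.zigzag j (k + 1))) := by
    intro j k
    induction k with
    | zero => exact fun _ => hlayer _ _ _ (G.base_adj_zigzag_first j)
    | succ k ih =>
      intro hk
      have h1 := htri j k hk
      rw [ih (by omega), hlayer _ _ _ (G.base_adj_zigzag_two j hk)] at h1
      linear_combination h1 - CharTwo.add_self_eq_zero (φ (G.zigzag j k) +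
        ψ (G.layer j).succ (G.zigzag j k) + φ (G.zigzag j (k + 1)) +
        ψ (G.layer j).succ (G.zigzag j (k + 1)) + φ (G.zigzag j (k + 2)) +
        ψ (G.layer j).succ (G.zigzag j (k + 2)))
  refine ⟨fun a => φ a.2 + ψ a.1 a.2, fun a b h => ?_⟩
  rw [← hBA ⟨s(a, b), h⟩]
  refine G.adj_induction (P := fun a b => B s(a, b) = (φ a.2 + ψ a.1 a.2) + (φ b.2 + ψ b.1 b.2))
    (fun a b h => by rw [Sym2.eq_swap, h, add_comm]) hlayer (fun m v => ?_) hzig h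
  have h1 := hψs m v
  simp only [Fin.val_castSucc, Fin.val_succ]
  rw [h1]
  linear_combination -CharTwo.add_self_eq_zero (φ v + ψ m v)

end Exactness
end LayeredGraph
namespace LayeredGraph

variable {V : Type*} [Fintype V] (G : LayeredGraph V)

/-- The cycles that are cellulated in the same layer are vertex-disjoint. -/
def HasDisjointCycles {V : Type*} (G : LayeredGraph V) : Prop :=
  ∀ j j', G.layer j = G.layer j' → j ≠ j' → ∀ v ∈ (G.cycle j).support, v ∉ (G.cycle j').support

variable {G}

/-- A vertex of the layered graph occurs in at most one zigzag enumeration in its layer, and there at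
only one position. -/
theorem HasDisjointCycles.exists_position (h : G.HasDisjointCycles) (i : Fin (G.R + 1)) (v : V) :
    ∃ n : ℕ, ∀ j k j' k', k < (G.cycle j).length → k' < (G.cycle j').length →
      i = (G.layer j).succ → i = (G.layer j').succ → v = G.zigzag j k → v = G.zigzag j' k' →
      j = j' ∧ k = n := by
  have hj : ∀ j k j' k', i = (G.layer j).succ → i = (G.layer j').succ → v = G.zigzag j k →
      v = G.zigzag j' k' → j = j' := by
    intro j k j' k' h1 h2 h3 h4
    by_contra hne
    refine h j j' (Fin.succ_injective _ (h1.symm.trans h2)) hne v ?_ ?_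
    · rw [h3]; exact G.zigzag_mem_support j k
    · rw [h4]; exact G.zigzag_mem_support j' k'
  by_cases hex : ∃ j k, k < (G.cycle j).length ∧ i = (G.layer j).succ ∧ v = G.zigzag j k
  · obtain ⟨j₀, n, hn, h1, h2⟩ := hex
    refine ⟨n, fun j k j' k' hk hk' h3 h4 h5 h6 => ⟨hj _ _ _ _ h3 h4 h5 h6, ?_⟩⟩
    obtain rfl := hj _ _ _ _ h3 h1 h5 h2
    exact G.zigzag_injOn j hk hn (h5.symm.trans h2)
  · exact ⟨0, fun j k _ _ hk _ h1 _ h2 _ => absurd ⟨j, k, hk, h1, h2⟩ hex⟩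

/-- The neighbours of a vertex are those in the base graph, its two copies in the adjacent layers, and at
most two neighbours in the zigzag enumeration. -/
theorem degree_le (h : G.HasDisjointCycles) {D : ℕ} (hD : ∀ v, G.base.degree v ≤ D) (a : G.Vert) :
    G.graph.degree a ≤ D + 4 := by
  obtain ⟨i, v⟩ := a
  obtain ⟨n, hn⟩ := h.exists_position i v
  -- the two possible zigzag neighbours
  obtain ⟨x, hx⟩ : ∃ x, ∀ j k, k + 1 < (G.cycle j).length → i = (G.layer j).succ →
      v = G.zigzag j k → G.zigzag j (k + 1) = x := by
    by_cases hex : ∃ j k, k + 1 < (G.cycle j).length ∧ i = (G.layer j).succ ∧ v = G.zigzag j k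
    · obtain ⟨j₀, k₀, h1, h2, h3⟩ := hex
      refine ⟨G.zigzag j₀ (k₀ + 1), fun j k h4 h5 h6 => ?_⟩
      have h7 := hn j k j₀ k₀ (by omega) (by omega) h5 h2 h6 h3
      have h8 := hn j₀ k₀ j₀ k₀ (by omega) (by omega) h2 h2 h3 h3
      rw [h7.1, h7.2, h8.2]
    · exact ⟨v, fun j k h1 h2 h3 => absurd ⟨j, k, h1, h2, h3⟩ hex⟩
  obtain ⟨y, hy⟩ : ∃ y, ∀ j k, k + 1 < (G.cycle j).length → i = (G.layer j).succ →
      v = G.zigzag j (k + 1) → G.zigzag j k = y := by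
    by_cases hex : ∃ j k, k + 1 < (G.cycle j).length ∧ i = (G.layer j).succ ∧ v = G.zigzag j (k + 1)
    · obtain ⟨j₀, k₀, h1, h2, h3⟩ := hex
      refine ⟨G.zigzag j₀ k₀, fun j k h4 h5 h6 => ?_⟩
      have h7 := hn j _ j₀ _ h4 h1 h5 h2 h6 h3
      have h8 := hn j₀ _ j₀ _ h1 h1 h2 h2 h3 h3
      rw [h7.1, show k = k₀ by omega]
    · exact ⟨v, fun j k h1 h2 h3 => absurd ⟨j, k, h1, h2, h3⟩ hex⟩
  set S : Finset G.Vert := (G.base.neighborFinset v).image (fun u => (i, u)) ∪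
    {(⟨min (i + 1) G.R, by omega⟩, v), (⟨i - 1, by omega⟩, v), (i, x), (i, y)} with hS
  have hsub : G.graph.neighborFinset (i, v) ⊆ S := by
    rintro ⟨i', u⟩ hu
    rw [SimpleGraph.mem_neighborFinset, graph, SimpleGraph.fromRel_adj] at hu
    simp only [hS, Finset.mem_union, Finset.mem_image, SimpleGraph.mem_neighborFinset,
      Finset.mem_insert, Finset.mem_singleton, Prod.mk.injEq, Fin.ext_iff]
    have hi := i'.2
    rcases hu.2 with (⟨h1, h2⟩ | ⟨h1, h2⟩ | ⟨h1, j, k, h2, h3, h4, h5⟩) |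
      (⟨h1, h2⟩ | ⟨h1, h2⟩ | ⟨h1, j, k, h2, h3, h4, h5⟩)
    · exact Or.inl ⟨u, h2, congrArg Fin.val h1, rfl⟩
    · exact Or.inr (Or.inl ⟨by dsimp only at h2; omega, h1.symm⟩)
    · exact Or.inr (Or.inr (Or.inr (Or.inl ⟨congrArg Fin.val h1.symm,
        h5.trans (hx j k h3 h2 h4)⟩)))
    · exact Or.inl ⟨u, h2.symm, congrArg Fin.val h1.symm, rfl⟩
    · exact Or.inr (Or.inr (Or.inl ⟨by dsimp only at h2; omega, h1⟩))
    · exact Or.inr (Or.inr (Or.inr (Or.inr ⟨congrArg Fin.val h1,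
        h4.trans (hy j k h3 (h1.symm.trans h2) h5)⟩)))
  calc G.graph.degree (i, v) = (G.graph.neighborFinset (i, v)).card := rfl
    _ ≤ S.card := Finset.card_le_card hsub
    _ ≤ ((G.base.neighborFinset v).image (fun u => ((i, u) : G.Vert))).card + _ :=
      Finset.card_union_le _ _
    _ ≤ D + 4 := add_le_add (Finset.card_image_le.trans (hD v)) Finset.card_le_four

/-- A face through an edge passes through each endpoint `(i, v)` of the edge. -/
theorem faceEdges_endpoint (p : G.Face) {e : Sym2 G.Vert} (he : e ∈ G.faceEdges p) {i : Fin (G.R + 1)}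
    {v : V} (hv : (i, v) ∈ e) :
    (∃ m e', p = .inl (m, e') ∧ (m.castSucc = i ∨ m.succ = i) ∧ v ∈ (e' : Sym2 V)) ∨
    (∃ j k, p = .inr ⟨j, k⟩ ∧ i = (G.layer j).succ ∧
      (v = G.zigzag j k ∨ v = G.zigzag j (k + 1) ∨ v = G.zigzag j (k + 2))) := by
  rcases p with ⟨m, ⟨e', he'⟩⟩ | ⟨j, k⟩
  · refine Or.inl ⟨m, _, rfl, ?_⟩
    induction e' with
    | _ x y =>
      rw [faceEdges_square] at he
      simp only [squareEdges, Set.mem_ofPred_eq, List.mem_cons, List.not_mem_nil, or_false] at he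
      rw [Sym2.mem_iff]
      rcases he with rfl | rfl | rfl | rfl <;>
      · rw [Sym2.mem_iff, Prod.mk.injEq, Prod.mk.injEq] at hv
        tauto
  · refine Or.inr ⟨j, k, rfl, ?_⟩
    rw [faceEdges_triangle] at he
    simp only [triangleEdges, Set.mem_ofPred_eq, List.mem_cons, List.not_mem_nil, or_false] at he
    rcases he with rfl | rfl | rfl <;>
    · rw [Sym2.mem_iff, Prod.mk.injEq, Prod.mk.injEq] at hv
      tauto

/-- An endpoint of the edge lies in at most `2 D` squares and three triangles. -/
theorem card_faces_le (h : G.HasDisjointCycles) {D : ℕ} (hD : ∀ v, G.base.degree v ≤ D) (e : G.Edge) :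
    (Finset.univ.filter fun p => (e : Sym2 G.Vert) ∈ G.faceEdges p).card ≤ 2 * D + 3 := by
  obtain ⟨⟨i, v⟩, hv⟩ : ∃ a, a ∈ (e : Sym2 G.Vert) := ⟨_, Sym2.out_fst_mem _⟩
  obtain ⟨n, hn⟩ := h.exists_position i v
  set S₁ : Finset G.Face := Finset.univ.filter fun p => ∃ m e', p = .inl (m, e') ∧
    (m.castSucc = i ∨ m.succ = i) ∧ v ∈ (e' : Sym2 V) with hS₁
  set S₂ : Finset G.Face := Finset.univ.filter fun p => ∃ j k, p = .inr ⟨j, k⟩ ∧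
    i = (G.layer j).succ ∧ (v = G.zigzag j k ∨ v = G.zigzag j (k + 1) ∨ v = G.zigzag j (k + 2)) with hS₂
  have h1 : S₁.card ≤ 2 * D := by
    have h2 : S₁.card ≤ (({(i : ℕ), (i : ℕ) - 1} : Finset ℕ) ×ˢ G.base.incidenceFinset v).card := by
      refine Finset.card_le_card_of_injOn
        (fun p => Sum.elim (fun q : Fin G.R × G.base.edgeSet => ((q.1 : ℕ), (q.2 : Sym2 V)))
          (fun _ => (0, s(v, v))) p) ?_ ?_
      · intro p hp
        obtain ⟨m, e', rfl, hm, he'⟩ := (Finset.mem_filter.1 hp).2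
        simp only [Sum.elim_inl, Finset.coe_product, Set.mem_prod, Finset.mem_coe, Finset.mem_insert,
          Finset.mem_singleton, SimpleGraph.mem_incidenceFinset]
        refine ⟨?_, e'.2, he'⟩
        rcases hm with rfl | rfl
        · exact Or.inl rfl
        · exact Or.inr rfl
      · intro p hp p' hp' hpp
        obtain ⟨m, e', rfl, -, -⟩ := (Finset.mem_filter.1 hp).2
        obtain ⟨m', e'', rfl, -, -⟩ := (Finset.mem_filter.1 hp').2
        have h3 := Prod.mk.inj hpp
        have h4 : m = m' := Fin.ext h3.1
        have h5 : e' = e'' := Subtype.ext h3.2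
        rw [h4, h5]
    rw [Finset.card_product, SimpleGraph.card_incidenceFinset_eq_degree] at h2
    exact h2.trans (Nat.mul_le_mul Finset.card_le_two (hD v))
  have h2 : S₂.card ≤ 3 := by
    have h3 : S₂.card ≤ ({n, n - 1, n - 2} : Finset ℕ).card := by
      refine Finset.card_le_card_of_injOn
        (fun p => Sum.elim (fun _ => 0)
          (fun q : Σ j : Fin G.numCycles, Fin ((G.cycle j).length - 2) => (q.2 : ℕ)) p) ?_ ?_
      · intro p hp
        obtain ⟨j, k, rfl, hi, hk⟩ := (Finset.mem_filter.1 hp).2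
        have hk2 := k.2
        simp only [Sum.elim_inr, Finset.coe_insert, Finset.coe_singleton, Set.mem_insert_iff,
          Set.mem_singleton_iff]
        rcases hk with hk | hk | hk
        · have h4 := (hn j _ j _ (by omega) (by omega) hi hi hk hk).2
          omega
        · have h4 := (hn j _ j _ (by omega) (by omega) hi hi hk hk).2
          omega
        · have h4 := (hn j _ j _ (by omega) (by omega) hi hi hk hk).2
          omega
      · intro p hp p' hp' hpp
        obtain ⟨j, k, rfl, hi, hk⟩ := (Finset.mem_filter.1 hp).2
        obtain ⟨j', k', rfl, hi', hk'⟩ := (Finset.mem_filter.1 hp').2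
        have hk2 := k.2
        have hk2' := k'.2
        have hj : j = j' := by
          obtain ⟨l, hl, h4⟩ : ∃ l, l < (G.cycle j).length ∧ v = G.zigzag j l := by
            rcases hk with hk | hk | hk
            exacts [⟨_, by omega, hk⟩, ⟨_, by omega, hk⟩, ⟨_, by omega, hk⟩]
          obtain ⟨l', hl', h4'⟩ : ∃ l, l < (G.cycle j').length ∧ v = G.zigzag j' l := by
            rcases hk' with hk | hk | hk
            exacts [⟨_, by omega, hk⟩, ⟨_, by omega, hk⟩, ⟨_, by omega, hk⟩]
          exact (hn j l j' l' hl hl' hi hi' h4 h4').1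
        subst hj
        rw [Fin.ext (show (k : ℕ) = k' from hpp)]
    exact h3.trans Finset.card_le_three
  refine (Finset.card_le_card (t := S₁ ∪ S₂) fun p hp => ?_).trans
    ((Finset.card_union_le _ _).trans (add_le_add h1 h2))
  rw [Finset.mem_union, hS₁, hS₂, Finset.mem_filter, Finset.mem_filter]
  rcases faceEdges_endpoint p (Finset.mem_filter.1 hp).2 hv with h3 | h3
  · exact Or.inl ⟨Finset.mem_univ _, h3⟩
  · exact Or.inr ⟨Finset.mem_univ _, h3⟩

end LayeredGraph

/-! ### The base graph -/

section BaseGraph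

/-- A set of even size whose vertices are pairwise adjacent has a perfect matching. -/
theorem exists_isPerfectMatchingOf {V : Type*} {H : SimpleGraph V} {S : Finset V} (hS : Even S.card)
    (hadj : ∀ u ∈ S, ∀ v ∈ S, u ≠ v → H.Adj u v) : ∃ M, IsPerfectMatchingOf H S M ∧ M.card ≤ S.card := by
  induction h : S.card using Nat.strong_induction_on generalizing S with
  | _ n ih =>
    subst h
    rcases S.eq_empty_or_nonempty with rfl | ⟨u, hu⟩
    · exact ⟨∅, ⟨by simp, by simp⟩, by simp⟩
    · have h1 := Finset.card_erase_add_one hu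
      obtain ⟨v, hv⟩ : (S.erase u).Nonempty := by
        rw [Finset.nonempty_iff_ne_empty]
        intro h0
        rw [h0, Finset.card_empty] at h1
        rw [← h1] at hS
        exact absurd hS (by decide)
      have h2 := Finset.card_erase_add_one hv
      set S' := (S.erase u).erase v with hS'
      have hmem : ∀ x, x ∈ S' ↔ x ≠ v ∧ x ≠ u ∧ x ∈ S := fun x => by
        rw [hS', Finset.mem_erase, Finset.mem_erase]
      have hvu := Finset.ne_of_mem_erase hv
      have hvS := Finset.mem_of_mem_erase hv
      obtain ⟨M, ⟨hM1, hM2⟩, hM3⟩ := ih S'.card (by omega) (S := S')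
        (by rw [← h1, ← h2] at hS; rw [Nat.even_iff] at hS ⊢; omega)
        (fun x hx y hy => hadj x ((hmem x).1 hx).2.2 y ((hmem y).1 hy).2.2) rfl
      refine ⟨insert s(u, v) M, ⟨?_, ?_⟩, ?_⟩
      · intro e he
        rcases Finset.mem_insert.1 he with rfl | he
        · refine ⟨hadj u hu v hvS hvu.symm, fun x hx => ?_⟩
          rcases Sym2.mem_iff.1 hx with rfl | rfl
          exacts [hu, hvS]
        · exact ⟨(hM1 e he).1, fun x hx => ((hmem x).1 ((hM1 e he).2 x hx)).2.2⟩
      · intro x hx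
        by_cases hxu : x = u ∨ x = v
        · refine ⟨s(u, v), ⟨Finset.mem_insert_self _ _, Sym2.mem_iff.2 hxu⟩, ?_⟩
          rintro e ⟨he, hxe⟩
          rcases Finset.mem_insert.1 he with rfl | he
          · rfl
          · have h3 := (hmem x).1 ((hM1 e he).2 x hxe)
            tauto
        · rw [not_or] at hxu
          obtain ⟨e, ⟨he, hxe⟩, huniq⟩ := hM2 x ((hmem x).2 ⟨hxu.2, hxu.1, hx⟩)
          refine ⟨e, ⟨Finset.mem_insert_of_mem he, hxe⟩, ?_⟩
          rintro e' ⟨he', hxe'⟩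
          rcases Finset.mem_insert.1 he' with rfl | he'
          · exact absurd (Sym2.mem_iff.1 hxe') (not_or.2 hxu)
          · exact huniq e' ⟨he', hxe'⟩
      · exact (Finset.card_insert_le _ _).trans (by omega)

/-- The expansion of sets of at most half the vertices, in terms of the Cheeger constant. -/
theorem one_le_cheeger {V : Type*} [Fintype V] {H : SimpleGraph V}
    (hC : ∀ S : Finset V, 2 * S.card ≤ Fintype.card V → S.card ≤ (H.interedges S Sᶜ).card) :
    1 ≤ cheeger H := by
  unfold cheeger
  refine le_iInf₂ fun S hS => ?_
  rw [ENNReal.le_div_iff_mul_le (Or.inl (by simpa using hS.1.ne_empty)) (Or.inl (by simp)), one_mul]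
  exact_mod_cast hC S hS.2

/-- No edges leave a connected component, which expansion forbids for it or for its complement. -/
theorem connected_of_card_le_interedges {V : Type*} [Fintype V] [Nonempty V] {H : SimpleGraph V}
    (hC : ∀ S : Finset V, 2 * S.card ≤ Fintype.card V → S.card ≤ (H.interedges S Sᶜ).card) :
    H.Connected := by
  refine SimpleGraph.Connected.mk fun u v => ?_
  by_contra huv
  set S : Finset V := Finset.univ.filter fun x => H.Reachable u x with hS
  have hmem : ∀ x, x ∈ S ↔ H.Reachable u x := fun x => by simp [hS]
  have hcut : ∀ x y, x ∈ S → y ∉ S → ¬ H.Adj x y := fun x y hx hy h =>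
    hy ((hmem y).2 (((hmem x).1 hx).trans h.reachable))
  have h1 := Finset.card_add_card_compl S
  have hu : 0 < S.card := Finset.card_pos.2 ⟨u, (hmem u).2 (SimpleGraph.Reachable.refl u)⟩
  have hv : 0 < Sᶜ.card := Finset.card_pos.2 ⟨v, Finset.mem_compl.2 (mt (hmem v).1 huv)⟩
  rcases le_total S.card Sᶜ.card with h | h
  · have h2 := hC S (by omega)
    have h3 : H.interedges S Sᶜ = ∅ := by
      refine Finset.eq_empty_of_forall_notMem fun x hx => ?_
      rw [SimpleGraph.mem_interedges_iff] at hx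
      exact hcut _ _ hx.1 (Finset.mem_compl.1 hx.2.1) hx.2.2
    rw [h3, Finset.card_empty] at h2
    omega
  · have h2 := hC Sᶜ (by omega)
    have h3 : H.interedges Sᶜ Sᶜᶜ = ∅ := by
      refine Finset.eq_empty_of_forall_notMem fun x hx => ?_
      rw [SimpleGraph.mem_interedges_iff, compl_compl] at hx
      exact hcut _ _ hx.2.1 (Finset.mem_compl.1 hx.1) hx.2.2.symm
    rw [h3, Finset.card_empty] at h2
    omega

/-- A bounded-degree expander in which each set of a sparse family spans a clique: the union of an
expander and of these cliques. -/
theorem exists_expander_with_cliques (V : Type*) [Fintype V] {ι : Type*} [Fintype ι] (Z : ι → Finset V)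
    {w Δ : ℕ} (hw : ∀ j, (Z j).card ≤ w) (hΔ : ∀ v, (Finset.univ.filter fun j => v ∈ Z j).card ≤ Δ) :
    ∃ H : SimpleGraph V, (∀ v, H.degree v ≤ 68 + Δ * w) ∧
      (∀ S : Finset V, 2 * S.card ≤ Fintype.card V → S.card ≤ (H.interedges S Sᶜ).card) ∧
      ∀ j, ∀ u ∈ Z j, ∀ v ∈ Z j, u ≠ v → H.Adj u v := by
  obtain ⟨H, hH, hC⟩ := exists_expander V
  obtain ⟨H', hH'⟩ : ∃ H', H' = H ⊔ SimpleGraph.fromRel fun u v => ∃ j, u ∈ Z j ∧ v ∈ Z j := ⟨_, rfl⟩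
  refine ⟨H', fun v => ?_, fun S hS => ?_, fun j u hu v hv huv => ?_⟩
  · have hsub : H'.neighborFinset v ⊆
        H.neighborFinset v ∪ (Finset.univ.filter fun j => v ∈ Z j).biUnion Z := by
      intro u hu
      rw [SimpleGraph.mem_neighborFinset, hH', SimpleGraph.sup_adj, SimpleGraph.fromRel_adj] at hu
      rw [Finset.mem_union, SimpleGraph.mem_neighborFinset, Finset.mem_biUnion]
      rcases hu with hu | ⟨-, ⟨j, h1, h2⟩ | ⟨j, h1, h2⟩⟩
      · exact Or.inl hu
      · exact Or.inr ⟨j, by simpa using h1, h2⟩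
      · exact Or.inr ⟨j, by simpa using h2, h1⟩
    calc H'.degree v = (H'.neighborFinset v).card := rfl
      _ ≤ _ := (Finset.card_le_card hsub).trans (Finset.card_union_le _ _)
      _ ≤ 68 + Δ * w := add_le_add (hH v)
        ((Finset.card_biUnion_le_card_mul _ _ _ fun j _ => hw j).trans
          (Nat.mul_le_mul_right _ (hΔ v)))
  · refine (hC S hS).trans (Finset.card_le_card fun x hx => ?_)
    rw [SimpleGraph.mem_interedges_iff] at hx ⊢
    exact ⟨hx.1, hx.2.1, hH' ▸ Or.inl hx.2.2⟩
  · rw [hH']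
    exact Or.inr ((SimpleGraph.fromRel_adj _ _ _).2 ⟨huv, Or.inl ⟨j, hu, hv⟩⟩)

end BaseGraph

section ZSupport

variable {Q : Type*} [Fintype Q] {L P : Pauli Q}

/-- The number of sites at which two commuting operators anticommute locally is even. -/
theorem even_card_zSupport (h : L.comm P = 0) : Even (zSupport L P).card := by
  rw [← ZMod.natCast_eq_zero_iff_even, ← h]
  unfold zSupport Pauli.comm
  rw [Finset.card_filter, Nat.cast_sum]
  have h1 : ∀ q ∉ L.support, siteComm (L q) (P q) = 0 := fun q hq => by
    have h2 : L q = 0 := by simpa [Pauli.support] using hq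
    simp [siteComm, h2]
  rw [← Finset.sum_subset (Finset.subset_univ L.support) fun q _ hq => h1 q hq,
    ← Finset.sum_coe_sort L.support fun q => siteComm (L q) (P q)]
  refine Finset.sum_congr rfl fun v _ => ?_
  by_cases h2 : siteComm (L v) (P v) = 0
  · simp [h2]
  · simp [zmod_two_eq_one h2]

theorem ne_zero_of_mem_zSupport {v : L.support} (h : v ∈ zSupport L P) : P v ≠ 0 := by
  intro h0
  exact (Finset.mem_filter.1 h).2 (by simp [siteComm, h0])

theorem card_zSupport_le : (zSupport L P).card ≤ P.weight :=
  Finset.card_le_card_of_injOn (fun v => (v : Q))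
    (fun v hv => by simpa [Pauli.support] using ne_zero_of_mem_zSupport hv)
    fun _ _ _ _ h => Subtype.ext h

end ZSupport

/-! ### Existence of layered graphs -/

/-- The layered graph of the cycles from `exists_cycle_layers`; on a single vertex no layers are needed. -/
theorem exists_layeredGraph (D : ℕ) : ∃ K : ℕ, ∀ (V : Type) [Fintype V] (H : SimpleGraph V),
    H.Connected → (∀ v, H.degree v ≤ D) → ∃ G : LayeredGraph V, G.base = H ∧
      (G.R : ℝ) ≤ K * Real.log (Fintype.card V) ^ 2 ∧ G.HasDisjointCycles ∧
      ∀ A : Sym2 V → ZMod 2, (∀ j, ((G.cycle j).edges.map A).sum = 0) →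
        ∃ φ, IsPotential G.base A φ := by
  obtain ⟨K, hK⟩ := exists_cycle_layers D
  refine ⟨⌈K⌉₊, fun V _ H hconn hdeg => ?_⟩
  obtain ⟨t, ls, ht, hls, hA⟩ : ∃ (t : ℕ) (ls : ℕ → List (Σ v, H.Walk v v)),
      (t : ℝ) ≤ ⌈K⌉₊ * Real.log (Fintype.card V) ^ 2 ∧
      (∀ i, (∀ c ∈ ls i, c.2.IsCycle) ∧ (ls i).Pairwise DisjointWalks) ∧
      ∀ A : Sym2 V → ZMod 2, (∀ i < t, ∀ c ∈ ls i, (c.2.edges.map A).sum = 0) →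
        ∃ φ, IsPotential H A φ := by
    rcases lt_or_ge (Fintype.card V) 2 with h | h
    · have : Subsingleton V := Fintype.card_le_one_iff_subsingleton.1 (by omega)
      exact ⟨0, fun _ => [], by simpa using by positivity, fun i => by simp,
        fun A _ => ⟨0, fun u v huv => absurd (Subsingleton.elim u v) huv.ne⟩⟩
    · obtain ⟨t, ls, ht, hls, hA⟩ := hK V H h hconn hdeg
      exact ⟨t, ls, ht.trans (mul_le_mul_of_nonneg_right (Nat.le_ceil K) (sq_nonneg _)), hls, hA⟩
  set J : Type := Σ i : Fin t, Fin (ls i).length with hJ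
  set f : Fin (Fintype.card J) ≃ J := (Fintype.equivFin J).symm with hf
  refine ⟨{ base := H, R := t, numCycles := Fintype.card J,
            root := fun j => ((ls (f j).1).get (f j).2).1,
            cycle := fun j => ((ls (f j).1).get (f j).2).2,
            isCycle := fun j => (hls _).1 _ (List.get_mem _ _),
            layer := fun j => (f j).1 }, rfl, ht, ?_, ?_⟩
  · intro j j' hl hne v hv hv'
    have h1 : f j ≠ f j' := fun h => hne (f.injective h)
    change (f j).1 = (f j').1 at hl
    change v ∈ ((ls (f j).1).get (f j).2).2.support at hv
    change v ∈ ((ls (f j').1).get (f j').2).2.support at hv'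
    generalize f j = x at *
    generalize f j' = y at *
    obtain ⟨i, a⟩ := x
    obtain ⟨i', b⟩ := y
    obtain rfl : i = i' := hl
    have h2 := List.pairwise_iff_get.1 (hls i).2
    have h3 : a ≠ b := fun h => h1 (by rw [h])
    rcases lt_or_gt_of_ne h3 with h | h
    · exact h2 a b h v hv hv'
    · exact h2 b a h v hv' hv
  · intro A h
    refine hA A fun i hi c hc => ?_
    obtain ⟨n, rfl⟩ := List.get_of_mem hc
    have h1 : ∀ x : J, (((ls x.1).get x.2).2.edges.map A).sum = 0 := fun x => by
      rw [← f.apply_symm_apply x]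
      exact h _
    exact h1 ⟨⟨i, hi⟩, n⟩


/-! ### Parameters of the deformed code -/

theorem card_filter_sum_le {α β : Type*} [Fintype α] [Fintype β] {p : α ⊕ β → Prop} [DecidablePred p]
    [DecidablePred fun a => p (.inl a)] [DecidablePred fun b => p (.inr b)] {m n : ℕ}
    (hm : (Finset.univ.filter fun a => p (.inl a)).card ≤ m)
    (hn : (Finset.univ.filter fun b => p (.inr b)).card ≤ n) : (Finset.univ.filter p).card ≤ m + n := by
  refine Eq.trans_le ?_ (add_le_add hm hn)
  simp only [Finset.card_filter, Fintype.sum_sum_type]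
  congr!

theorem card_filter_edge_le {V : Type*} (H : SimpleGraph V) [Fintype H.edgeSet] (S : Finset (Sym2 V))
    [DecidablePred fun e : H.edgeSet => (e : Sym2 V) ∈ S] :
    (Finset.univ.filter fun e : H.edgeSet => (e : Sym2 V) ∈ S).card ≤ S.card :=
  Finset.card_le_card_of_injOn (fun e => (e : Sym2 V)) (fun _ he => (Finset.mem_filter.1 he).2)
    fun _ _ _ _ h => Subtype.ext h

theorem card_filter_mem_edge_le {V : Type*} [Fintype V] (H : SimpleGraph V) (v : V) :
    (Finset.univ.filter fun e : H.edgeSet => v ∈ (e : Sym2 V)).card ≤ H.degree v := by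
  rw [← SimpleGraph.card_incidenceFinset_eq_degree]
  exact Finset.card_le_card_of_injOn (fun e => (e : Sym2 V))
    (fun e he => by simpa using ⟨e.2, (Finset.mem_filter.1 he).2⟩) fun _ _ _ _ h => Subtype.ext h

section Deformed

variable {Q ι : Type*} [Fintype Q] [Fintype ι] {L : Pauli Q} {G : LayeredGraph L.support}
  {s : ι → Pauli Q} {M : ι → Finset (Sym2 L.support)}

theorem isStabilizerCode_deformedChecks (hs : IsStabilizerCode s)
    (hM : ∀ j, IsPerfectMatchingOf G.base (zSupport L (s j)) (M j)) :
    IsStabilizerCode (deformedChecks G s M) := by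
  have hf : ∀ p, IsGaussInvariant G (0 : Pauli Q) (edgeIndicator G (G.faceEdges p)) :=
    fun p => isGaussInvariant_flux G (G.boundary_faceEdges p)
  have hm : ∀ j, IsGaussInvariant G (s j) (layerZeroChain G (M j)) :=
    fun j => isGaussInvariant_matching G (hM j)
  have h0 : ∀ P : Pauli Q, Pauli.comm 0 P = 0 := fun P => Pauli.comm_zero_left _
  rintro (u | p | i) (v | q | j) <;>
    simp only [deformedChecks, fluxOp_eq_withZ, deform_eq_withZ, withZ_comm_withZ, h0]
  · exact gaussOp_comm_gaussOp G u v
  · exact gaussOp_comm_withZ G (hf q) u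
  · exact gaussOp_comm_withZ G (hm j) u
  · rw [Pauli.comm_symm]; exact gaussOp_comm_withZ G (hf p) v
  · rw [Pauli.comm_symm]; exact gaussOp_comm_withZ G (hm i) v
  · exact Pauli.comm_zero_right _
  · exact hs i j

theorem weight_deformedChecks_le {w Δ D : ℕ} (hL : IsLDPC s w Δ)
    (hcard : ∀ j, (M j).card ≤ (zSupport L (s j)).card) (hD : ∀ a, G.graph.degree a ≤ D)
    (k : G.Vert ⊕ G.Face ⊕ ι) : (deformedChecks G s M k).weight ≤ 2 * w + D + 4 := by
  change (Finset.univ.filter fun q => deformedChecks G s M k q ≠ 0).card ≤ _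
  rcases k with v | p | j
  · have h1 : (Finset.univ.filter fun q => gaussOp G v (.inl q) ≠ 0).card ≤ 1 := by
      refine Finset.card_le_one.2 fun q hq q' hq' => ?_
      simp only [gaussOp, Finset.mem_filter, ne_eq, ite_eq_right_iff, not_forall] at hq hq'
      exact hq.2.1.2.symm.trans hq'.2.1.2
    have h2 : (Finset.univ.filter fun e => gaussOp G v (.inr e) ≠ 0).card ≤ D := by
      refine (Finset.card_le_card fun e he => ?_).trans ((card_filter_mem_edge_le _ v).trans (hD v))
      simp only [gaussOp, Finset.mem_filter, ne_eq, ite_eq_right_iff, not_forall] at he ⊢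
      exact ⟨he.1, he.2.1⟩
    exact (card_filter_sum_le (p := fun q => gaussOp G v q ≠ 0) h1 h2).trans (by omega)
  · have h1 : (Finset.univ.filter fun q => fluxOp G p (.inl q) ≠ 0).card ≤ 0 := by simp [fluxOp]
    have h2 : (Finset.univ.filter fun e => fluxOp G p (.inr e) ≠ 0).card ≤ 4 := by
      refine le_trans ?_ (G.ncard_faceEdges_le p)
      rw [Set.ncard_eq_toFinset_card']
      refine (Finset.card_le_card fun e he => ?_).trans (card_filter_edge_le G.graph _)
      simp only [fluxOp, Finset.mem_filter, ne_eq, ite_eq_right_iff, not_forall] at he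
      simpa using he.2.1
    exact (card_filter_sum_le (p := fun q => fluxOp G p q ≠ 0) h1 h2).trans (by omega)
  · have h1 : (Finset.univ.filter fun q => deform G (s j) (M j) (.inl q) ≠ 0).card ≤ w := hL.1 j
    have h2 : (Finset.univ.filter fun e => deform G (s j) (M j) (.inr e) ≠ 0).card ≤ w := by
      refine le_trans ?_ ((hcard j).trans (card_zSupport_le.trans (hL.1 j)))
      refine le_trans (Finset.card_le_card fun e he => ?_)
        ((card_filter_edge_le G.graph ((M j).image (Sym2.map fun v => (0, v)))).trans
          Finset.card_image_le)
      simp only [deform, Finset.mem_filter, ne_eq, ite_eq_right_iff, not_forall] at he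
      obtain ⟨x, hx, hex⟩ := he.2.1
      exact Finset.mem_filter.2 ⟨Finset.mem_univ _, Finset.mem_image.2 ⟨x, hx, hex.symm⟩⟩
    exact (card_filter_sum_le (p := fun q => deform G (s j) (M j) q ≠ 0) h1 h2).trans (by omega)

theorem card_zSupport_mem_le {w Δ : ℕ} (hL : IsLDPC s w Δ) (v : L.support) :
    (Finset.univ.filter fun j => v ∈ zSupport L (s j)).card ≤ Δ :=
  (Finset.card_le_card fun _ hj => Finset.mem_filter.2 ⟨Finset.mem_univ _,
    ne_zero_of_mem_zSupport (Finset.mem_filter.1 hj).2⟩).trans (hL.2 v)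

theorem card_deformedChecks_le {w Δ D : ℕ} (hL : IsLDPC s w Δ)
    (hM : ∀ j, IsPerfectMatchingOf G.base (zSupport L (s j)) (M j))
    (hD : ∀ e : G.Edge, (Finset.univ.filter fun p => (e : Sym2 G.Vert) ∈ G.faceEdges p).card ≤ D)
    (q : DefQubit G) :
    (Finset.univ.filter fun k => deformedChecks G s M k q ≠ 0).card ≤ Δ + D + 2 := by
  rcases q with q | e
  · have h1 : (Finset.univ.filter fun v => gaussOp G v (.inl q) ≠ 0).card ≤ 1 := by
      refine Finset.card_le_one.2 fun v hv v' hv' => ?_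
      simp only [gaussOp, Finset.mem_filter, ne_eq, ite_eq_right_iff, not_forall] at hv hv'
      exact Prod.ext (hv.2.1.1.trans hv'.2.1.1.symm)
        (Subtype.ext (hv.2.1.2.trans hv'.2.1.2.symm))
    have h2 : (Finset.univ.filter fun p => fluxOp G p (.inl q) ≠ 0).card ≤ 0 := by simp [fluxOp]
    have h3 : (Finset.univ.filter fun j => deform G (s j) (M j) (.inl q) ≠ 0).card ≤ Δ := hL.2 q
    exact (card_filter_sum_le (p := fun k => deformedChecks G s M k (.inl q) ≠ 0) h1
      (card_filter_sum_le (p := fun k => deformedChecks G s M (.inr k) (.inl q) ≠ 0) h2 h3)).trans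
      (by omega)
  · have h1 : (Finset.univ.filter fun v => gaussOp G v (.inr e) ≠ 0).card ≤ 2 := by
      obtain ⟨⟨e, he⟩⟩ : Nonempty {e' : G.Edge // e' = e} := ⟨⟨e, rfl⟩⟩
      subst he
      obtain ⟨x, hx⟩ := e
      induction x with
      | _ a b =>
        refine (Finset.card_le_card fun v hv => ?_).trans (Finset.card_le_two (a := a) (b := b))
        simp only [gaussOp, Finset.mem_filter, ne_eq, ite_eq_right_iff, not_forall] at hv
        simpa using hv.2.1
    have h2 : (Finset.univ.filter fun p => fluxOp G p (.inr e) ≠ 0).card ≤ D := by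
      refine (Finset.card_le_card fun p hp => ?_).trans (hD e)
      simp only [fluxOp, Finset.mem_filter, ne_eq, ite_eq_right_iff, not_forall] at hp ⊢
      exact ⟨hp.1, hp.2.1⟩
    have h3 : (Finset.univ.filter fun j => deform G (s j) (M j) (.inr e) ≠ 0).card ≤ Δ := by
      -- an endpoint of `e` lies in the `Z`-type supports of all checks whose matching contains `e`
      obtain ⟨a, ha⟩ : ∃ a, a ∈ (e : Sym2 G.Vert) := ⟨_, Sym2.out_fst_mem _⟩
      refine (Finset.card_le_card fun j hj => ?_).trans (card_zSupport_mem_le hL a.2)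
      simp only [deform, Finset.mem_filter, ne_eq, ite_eq_right_iff, not_forall] at hj ⊢
      obtain ⟨x, hx, hex⟩ := hj.2.1
      rw [hex, Sym2.mem_map] at ha
      obtain ⟨v, hv, rfl⟩ := ha
      exact ⟨hj.1, ((hM j).1 x hx).2 v hv⟩
    exact (card_filter_sum_le (p := fun k => deformedChecks G s M k (.inr e) ≠ 0) h1
      (card_filter_sum_le (p := fun k => deformedChecks G s M (.inr k) (.inr e) ≠ 0) h2 h3)).trans
      (by omega)

end Deformed

theorem LayeredGraph.two_mul_card_edge_le {V : Type*} [Fintype V] (G : LayeredGraph V) {D : ℕ}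
    (hD : ∀ a, G.graph.degree a ≤ D) :
    2 * Fintype.card G.Edge ≤ (G.R + 1) * Fintype.card V * D := by
  rw [← SimpleGraph.edgeFinset_card, ← SimpleGraph.sum_degrees_eq_twice_card_edges]
  calc ∑ a, G.graph.degree a ≤ ∑ _a : G.Vert, D := Finset.sum_le_sum fun a _ => hD a
    _ = _ := by simp

/-- The overhead: all `R + 1` layers together have `O(W log² W)` vertices and edges. -/
theorem LayeredGraph.card_edge_add_le {V : Type*} [Fintype V] [Nonempty V] (G : LayeredGraph V)
    {D K : ℕ} (hD : ∀ a, G.graph.degree a ≤ D)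
    (hR : (G.R : ℝ) ≤ K * Real.log (Fintype.card V) ^ 2) :
    ((Fintype.card G.Edge + G.R * Fintype.card V : ℕ) : ℝ) ≤
      (K + 4) * (D + 1) * (Fintype.card V * Real.log (Fintype.card V) ^ 2) := by
  rcases lt_or_ge (Fintype.card V) 2 with h | h
  · have h1 : Fintype.card V = 1 := le_antisymm (by omega) Fintype.card_pos
    have h2 : G.R = 0 := by
      rw [h1] at hR
      have h3 : (G.R : ℝ) ≤ 0 := by simpa using hR
      exact_mod_cast le_antisymm h3 (Nat.cast_nonneg _)
    have h3 : Subsingleton G.Vert := by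
      have h4 : Subsingleton V := Fintype.card_le_one_iff_subsingleton.1 h1.le
      refine ⟨fun a b => Prod.ext (Fin.ext ?_) (Subsingleton.elim _ _)⟩
      have h5 := a.1.2
      have h6 := b.1.2
      omega
    have h4 : IsEmpty G.Edge := by
      refine ⟨fun e => ?_⟩
      obtain ⟨x, hx⟩ := e
      induction x with
      | _ a b => exact SimpleGraph.Adj.ne (G := G.graph) hx (Subsingleton.elim a b)
    rw [Fintype.card_eq_zero, h1, h2]
    simp
  · have h1 := one_le_two_mul_log (W := Fintype.card V) (by exact_mod_cast h)
    set l := Real.log (Fintype.card V) with hl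
    have h2 : (G.R : ℝ) + 1 ≤ (K + 4) * l ^ 2 := by nlinarith
    have h3 : Fintype.card G.Edge + G.R * Fintype.card V ≤
        (G.R + 1) * Fintype.card V * (D + 1) := by
      have h4 := G.two_mul_card_edge_le hD
      have h5 : G.R * Fintype.card V ≤ (G.R + 1) * Fintype.card V :=
        Nat.mul_le_mul_right _ (Nat.le_succ _)
      rw [Nat.mul_succ]
      omega
    calc ((Fintype.card G.Edge + G.R * Fintype.card V : ℕ) : ℝ) ≤
          (((G.R + 1) * Fintype.card V * (D + 1) : ℕ) : ℝ) := by exact_mod_cast h3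
      _ = ((G.R : ℝ) + 1) * (Fintype.card V * (D + 1)) := by push_cast; ring
      _ ≤ ((K + 4) * l ^ 2) * (Fintype.card V * (D + 1)) :=
        mul_le_mul_of_nonneg_right h2 (by positivity)
      _ = _ := by ring

end Gauging

theorem mainTheorem5 (w Δ : ℕ) :
    ∃ K : ℕ, ∀ (n m : ℕ) (s : Fin m → Gauging.Pauli (Fin n)) (L : Gauging.Pauli (Fin n)) (d : ℕ),
      Gauging.IsStabilizerCode s → Gauging.IsLDPC s w Δ → Gauging.HasDistance s d →
      Gauging.IsLogical s L →
      ∃ (G : Gauging.LayeredGraph L.support) (M : Fin m → Finset (Sym2 L.support)),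
        -- perfect matchings, by edges of the base graph, of the `Z`-type supports of the checks
        (∀ j, Gauging.IsPerfectMatchingOf G.base (Gauging.zSupport L (s j)) (M j)) ∧
        -- the base graph is an expander of constant degree
        (∀ v, G.base.degree v ≤ K) ∧ 1 ≤ Gauging.cheeger G.base ∧
        -- `O(log² W)` layers, in which a generating set of cycles of the base graph is cellulated
        (G.R : ℝ) ≤ K * Real.log L.weight ^ 2 ∧
        Gauging.GeneratesCycles G.base (fun j => {e | e ∈ (G.cycle j).edges}) ∧
        -- the layered graph is connected and of constant degree
        G.graph.Connected ∧ (∀ v, G.graph.degree v ≤ K) ∧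
        -- short paths between the vertices in the `Z`-type support of a check
        (∀ j, ∀ u ∈ Gauging.zSupport L (s j), ∀ v ∈ Gauging.zSupport L (s j),
          ∃ p : G.graph.Walk (0, u) (0, v), p.length ≤ K) ∧
        -- cycles of weight at most four generate, and every edge lies in a bounded number of them
        Gauging.GeneratesCycles G.graph G.faceEdges ∧ (∀ p, (G.faceEdges p).ncard ≤ 4) ∧
        (∀ e : G.Edge, (Finset.univ.filter fun p => (e : Sym2 G.Vert) ∈ G.faceEdges p).card ≤ K) ∧
        -- the deformed code is an LDPC stabilizer code
        Gauging.IsStabilizerCode (Gauging.deformedChecks G s M) ∧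
        Gauging.IsLDPC (Gauging.deformedChecks G s M) K K ∧
        -- qubit overhead, where each dummy vertex is counted as a qubit as well
        ((Fintype.card G.Edge + G.R * L.weight : ℕ) : ℝ) ≤
          K * (L.weight * Real.log L.weight ^ 2) ∧
        -- spacetime fault distance
        (∀ a b, d ≤ a → d ≤ b → (Gauging.gaugingProcedure G s M a d b).HasFaultDistance d) ∧
        (∀ a T b, d ≤ a → d ≤ T → d ≤ b →
          ∀ k ∈ (Gauging.gaugingProcedure G s M a T b).logicalFaultWeights, d ≤ k) := by
  obtain ⟨K₁, hK₁⟩ := Gauging.exists_layeredGraph (68 + Δ * w)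
  set D := 68 + Δ * w with hD
  set K : ℕ := (K₁ + 4) * (D + 5) + 2 * w + Δ + 10 with hK
  have hKD : 4 * (D + 5) ≤ (K₁ + 4) * (D + 5) := Nat.mul_le_mul_right _ (by omega)
  have hKK₁ : K₁ ≤ (K₁ + 4) * (D + 5) := by nlinarith
  refine ⟨K, fun n m s L d hs hLDPC hd hL => ?_⟩
  have hW : Fintype.card L.support = L.weight := Fintype.card_coe _
  have : Nonempty L.support := by
    by_contra hempty
    apply hL.2
    have h0 : L = 0 := funext fun q => by
      by_contra hq
      exact hempty ⟨⟨q, Gauging.Pauli.mem_support.2 hq⟩⟩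
    rw [h0]
    exact zero_mem _
  obtain ⟨H, hdeg, hC, hclique⟩ := Gauging.exists_expander_with_cliques L.support
    (fun j => Gauging.zSupport L (s j)) (fun j => Gauging.card_zSupport_le.trans (hLDPC.1 j))
    (fun v => by convert Gauging.card_zSupport_mem_le (L := L) hLDPC v)
  have hconn := Gauging.connected_of_card_le_interedges hC
  obtain ⟨G, rfl, hR, hdis, hcyc⟩ := hK₁ L.support H hconn hdeg
  choose M hM hMcard using fun j =>
    Gauging.exists_isPerfectMatchingOf (Gauging.even_card_zSupport (hL.1 j)) (hclique j)
  have hdegG := Gauging.LayeredGraph.degree_le hdis hdeg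
  have hfaces := Gauging.LayeredGraph.card_faces_le hdis hdeg
  have hX := G.isFluxExact hcyc
  have hG := G.connected hconn
  have hinv := fun j => Gauging.isGaussInvariant_matching G (hM j)
  have hstab : ∀ a T b, d ≤ a → d ≤ T → d ≤ b →
      ∀ k ∈ (Gauging.gaugingProcedure G s M a T b).logicalFaultWeights, d ≤ k := by
    rintro a T b ha hT hb k ⟨F, hF, hF', rfl⟩
    by_contra hlt
    exact hF' (Gauging.isStabilizer_of_weight_lt hG hs hd hL
      (fun S hS => by convert hC S hS) hX G.boundary_faceEdges hinv ha hT hb F hF (not_le.1 hlt))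
  refine ⟨G, M, hM, fun v => (hdeg v).trans (by omega), Gauging.one_le_cheeger hC, ?_,
    Gauging.generatesCycles_cycles G.isCycle hcyc, hG, fun v => (hdegG v).trans (by omega), ?_,
    Gauging.generatesCycles_of_isFluxExact G.faceEdges_subset G.boundary_faceEdges hX,
    G.ncard_faceEdges_le, fun e => (hfaces e).trans (by omega),
    Gauging.isStabilizerCode_deformedChecks hs hM, ⟨fun k => ?_, fun q => ?_⟩, ?_, ?_, hstab⟩
  · rw [← hW]
    exact hR.trans (mul_le_mul_of_nonneg_right (by exact_mod_cast (by omega : K₁ ≤ K)) (sq_nonneg _))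
  · intro j u hu v hv
    by_cases huv : u = v
    · subst huv
      exact ⟨.nil, Nat.zero_le _⟩
    · exact ⟨(G.adj_layer 0 (hclique j u hu v hv huv)).toWalk, by
        rw [SimpleGraph.Walk.length_cons, SimpleGraph.Walk.length_nil]; omega⟩
  · exact (Gauging.weight_deformedChecks_le hLDPC hMcard hdegG k).trans (by omega)
  · exact (Gauging.card_deformedChecks_le hLDPC hM hfaces q).trans (by omega)
  · rw [← hW]
    refine (G.card_edge_add_le hdegG hR).trans (mul_le_mul_of_nonneg_right ?_ (by positivity))
    have h1 : (K₁ + 4) * (D + 4 + 1) ≤ K := by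
      rw [show D + 4 + 1 = D + 5 from rfl]
      omega
    exact_mod_cast h1
  · intro a b ha hb
    refine ⟨?_, fun k hk => hstab a d b ha le_rfl hb k hk⟩
    exact Gauging.mem_logicalFaultWeights hG hL (hd.pos.trans_le ha) hd.pos
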